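/- **Setting.** Let $J,T>0$, $h\in\mathbb R$, and let the anisotropy be $\Delta=\cosh\eta>-1$, $\Delta\ne1$: either $\eta>0$, or $\eta=i\gamma$ with $0<\gamma<\pi$. The canonical contour $\mathcal C$ is the positively oriented boundary of a rectangle: $|\mathrm{Re}\,z|\le\delta$, $|\mathrm{Im}\,z|\le\pi/2$ with $0<\delta<\eta/2$ if $\eta>0$; and $|\mathrm{Re}\,z|\le R$, $|\mathrm{Im}\,z|\le\delta$ with $R>0$, $0<\delta<\min(\gamma,\pi-\gamma)/2$ if $\eta=i\gamma$ (any $R$; the contour around the whole real axis corresponds to $R$ large). Let $\mathfrak a$ solve on $\mathcal C$ (with a continuous branch of $\ln(1+\mathfrak a)$ along $\mathcal C$) $$\ln\mathfrak a(\lambda)=-\frac hT-\frac{2J\sinh^2\eta}{T\sinh\lambda\,\sinh(\lambda+\eta)}-\int_{\mathcal C}\frac{d\omega}{2\pi i}\frac{\sinh(2\eta)\ln(1+\mathfrak a(\omega))}{\sinh(\lambda-\omega+\eta)\sinh(\lambda-\omega-\eta)},$$ and put $\bar{\mathfrak a}=1/\mathfrak a$. With $K(\lambda;\alpha)=e^{\alpha\eta}\coth(\lambda-\eta)-e^{-\alpha\eta}\coth(\lambda+\eta)$,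 let $G(\lambda,\mu;\alpha)$, for $\mu$ inside $\mathcal C$, be continuous in $(\lambda,\alpha)$ for $\lambda\in\mathcal C$ and complex $\alpha$ near $0$, and satisfy there $$G(\lambda,\mu;\alpha)=-\coth(\lambda-\mu)+e^{\alpha\eta}\coth(\lambda-\mu-\eta)+\int_{\mathcal C}\frac{d\omega\,G(\omega,\mu;\alpha)}{2\pi i(1+\mathfrak a(\omega))}K(\lambda-\omega;\alpha).$$ **Functions.** Define $$\varphi(\mu;\alpha)=1+\int_{\mathcal C}\frac{d\omega\,G(\omega,\mu;\alpha)}{\pi i(1+\mathfrak a(\omega))},$$ $$\psi(\mu_1,\mu_2;\alpha)=\int_{\mathcal C}\frac{d\omega\,G(\omega,\mu_1;\alpha)}{\pi i(1+\mathfrak a(\omega))}\bigl(-\coth(\omega-\mu_2)+e^{-\alpha\eta}\coth(\omega-\mu_2-\eta)\bigr),$$ $$\omega(\mu_1,\mu_2;\alpha)=-e^{\alpha(\mu_1-\mu_2)}\psi(\mu_1,\mu_2;\alpha)-\frac{e^{\alpha(\mu_1-\mu_2)}}{2\cosh^2(\alpha\eta/2)}K(\mu_1-\mu_2;-\alpha),$$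 $$\omega'(\mu_1,\mu_2;\alpha)=\partial_\alpha\bigl(e^{\alpha(\mu_2-\mu_1)}\omega(\mu_1,\mu_2;\alpha)\bigr).$$ **Density matrix.** For $\lambda_1,\dots,\lambda_n$ inside $\mathcal C$ and signs $\alpha_j,\beta_j=\pm$, let $s$ be the number of plus signs among the $\alpha_j$ and $s'$ the number of minus signs among the $\beta_j$. The inhomogeneous density matrix elements are $$D^{\beta_1\dots\beta_n}_{\alpha_1\dots\alpha_n}(\lambda_1,\dots,\lambda_n;\alpha)=\delta_{s,n-s'}\Bigl[\prod_{j=1}^{s}\int_{\mathcal C}\frac{d\omega_j\,e^{-\alpha\eta}}{2\pi i(1+\mathfrak a(\omega_j))}\prod_{k<x_j}\sinh(\omega_j-\lambda_k-\eta)\prod_{k>x_j}\sinh(\omega_j-\lambda_k)\Bigr]$$ $$\times\Bigl[\prod_{j=s+1}^{n}\int_{\mathcal C}\frac{d\omega_j\,e^{\alpha\eta}}{2\pi i(1+\bar{\mathfrak a}(\omega_j))}\prod_{k<x_j}\sinh(\omega_j-\lambda_k+\eta)\prod_{k>x_j}\sinh(\omega_j-\lambda_k)\Bigr]\frac{\det[-G(\omega_j,\lambda_k;\alpha)]}{\prod_{j<k}\sinh(\lambda_k-\lambda_j)\sinh(\omega_j-\omega_k-\eta)},$$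 where, for $j\le s$, $x_j$ is the position of the $j$-th plus sign in $(\alpha_k)$ counted from the right and, for $j>s$, $x_j$ is the position of the $(j-s)$-th minus sign in $(\beta_k)$. Let $D_2(\lambda_1,\lambda_2;\alpha)=\sum D^{\beta_1\beta_2}_{\alpha_1\alpha_2}(\lambda_1,\lambda_2;\alpha)\,e_{\alpha_1}^{\beta_1}\otimes e_{\alpha_2}^{\beta_2}$, where $e_\alpha^\beta$ has its single entry $1$ in row $\alpha$ and column $\beta$ (so $e_+^-=\sigma^+$). Unless indicated otherwise, matrix elements are taken at $\alpha=0$. **Theorem.** For every $\lambda$ inside $\mathcal C$, $$2D^+_+(\lambda)=1-\varphi(\lambda;0).$$ Let $\lambda_1\neq\lambda_2$ be inside $\mathcal C$ and $\lambda=\lambda_1-\lambda_2$. Then $\psi(\lambda_1,\lambda_2;\alpha)$ and $e^{\alpha(\lambda_2-\lambda_1)}\omega(\lambda_1,\lambda_2;\alpha)$ are differentiable in $\alpha$ at $0$. Moreover: (i) $D_q:=e^{\lambda}D^{+-}_{-+}+e^{-\lambda}D^{-+}_{+-}-e^{-\eta}D^{+-}_{+-}-e^{\eta}D^{-+}_{-+}=\dfrac{\sinh(\lambda+\eta)\sinh(\lambda-\eta)}{2\sinh\eta}\,\psi(\lambda_1,\lambda_2;0)$.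 (ii) $D^{++}_{++}=\dfrac12-\dfrac14\bigl(\varphi(\lambda_1;0)+\varphi(\lambda_2;0)\bigr)-\dfrac{\coth\eta}4\psi(\lambda_1,\lambda_2;0)-\dfrac{\coth\lambda}{4\eta}\,\partial_\alpha\psi(\lambda_1,\lambda_2;\alpha)\big|_{\alpha=0}$. (iii) $D_2(\lambda_1,\lambda_2;0)=\lim_{\alpha\to0}D_2(\lambda_1,\lambda_2;\alpha)=D_2^{\mathrm{even}}+D_2^{\mathrm{odd}}$, where, with $\omega=\omega(\lambda_1,\lambda_2;0)$, $\omega'=\omega'(\lambda_1,\lambda_2;0)$, $\varphi_j=\varphi(\lambda_j;0)$, $$D_2^{\mathrm{even}}=\tfrac14 I\otimes I+\tfrac14\Bigl[\coth\eta\;\omega+\tfrac{\coth\lambda}{\eta}\omega'\Bigr]\sigma^z\otimes\sigma^z-\tfrac14\Bigl[\tfrac{\cosh\lambda}{\sinh\eta}\omega+\tfrac{\cosh\eta}{\eta\sinh\lambda}\omega'\Bigr](\sigma^+\otimes\sigma^-+\sigma^-\otimes\sigma^+),$$ $$D_2^{\mathrm{odd}}=-\tfrac{\varphi_1}4\sigma^z\otimes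 I-\tfrac{\varphi_2}4I\otimes\sigma^z-\tfrac{\sinh\eta\,(\varphi_1-\varphi_2)}{4\sinh\lambda}(\sigma^+\otimes\sigma^--\sigma^-\otimes\sigma^+).$$ (iv) (Exponential formula for $n=2$.) For every $O\in\mathrm{End}(\mathbb C^2\otimes\mathbb C^2)$ commuting with $\sigma^z\otimes I+I\otimes\sigma^z$, $$\mathrm{tr}\bigl(D_2(\lambda_1,\lambda_2;0)\,O\bigr)=\tfrac14\,\mathrm{tr}\bigl(e^{\Omega}(O)\bigr),\qquad \Omega=-\omega\,\Omega_1^+-\omega'\,\Omega_1^--\varphi_1\mathbf H_1-\varphi_2\mathbf H_2.$$ Here the linear operators $\Omega_1^\pm,\mathbf H_j$ act on such $O$ as follows ($\epsilon,\sigma=\pm$; $q=e^\eta$, $\xi_j=e^{\lambda_j}$, $x=\xi_1/\xi_2$; we write $e_\alpha^\beta e_\gamma^\delta$ for $e_\alpha^\beta\otimes e_\gamma^\delta$): $$\Omega_1^+(e_\epsilon^\epsilon e_\sigma^\sigma)=-\tfrac{\epsilon\sigma}4\coth\eta\;I\otimes I,\quad \Omega_1^+(e_\epsilon^{-\epsilon}e_{-\epsilon}^{\epsilon})=\tfrac{\cosh\lambda}{4\sinh\eta}I\otimes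 I,$$ $$\Omega_1^-(e_\epsilon^\epsilon e_\sigma^\sigma)=-\tfrac{\epsilon\sigma}{4\eta}\coth\lambda\;I\otimes I,\quad \Omega_1^-(e_\epsilon^{-\epsilon}e_{-\epsilon}^{\epsilon})=\tfrac{\cosh\eta}{4\eta\sinh\lambda}I\otimes I,$$ $$\mathbf H_1(e_\epsilon^\epsilon e_\sigma^\sigma)=\tfrac\epsilon2\bigl(f_1^{\epsilon\sigma}e_\epsilon^\epsilon e_\epsilon^\epsilon+f_1^{-\epsilon\sigma}e_{-\epsilon}^{-\epsilon}e_{-\epsilon}^{-\epsilon}+f_2^{\epsilon\sigma}e_\epsilon^\epsilon e_{-\epsilon}^{-\epsilon}+f_2^{-\epsilon\sigma}e_{-\epsilon}^{-\epsilon}e_\epsilon^\epsilon-\sigma g_1(e_+^-e_-^+-e_-^+e_+^-)\bigr),$$ $$\mathbf H_1(e_\epsilon^{-\epsilon}e_{-\epsilon}^\epsilon)=\tfrac12\bigl(q^{-1}f_3^\epsilon e_\epsilon^\epsilon e_\epsilon^\epsilon+qf_3^{-\epsilon}e_{-\epsilon}^{-\epsilon}e_{-\epsilon}^{-\epsilon}+\epsilon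 q^{-1}g_2^+e_\epsilon^\epsilon e_{-\epsilon}^{-\epsilon}-\epsilon qg_2^-e_{-\epsilon}^{-\epsilon}e_\epsilon^\epsilon+g_3(e_+^-e_-^+-e_-^+e_+^-)\bigr),$$ $$\mathbf H_2(e_\epsilon^\epsilon e_\sigma^\sigma)=\tfrac\sigma2\bigl(f_1^-e_\epsilon^\epsilon\otimes I+f_1^+e_{-\epsilon}^{-\epsilon}\otimes I\bigr),\quad \mathbf H_2(e_\epsilon^{-\epsilon}e_{-\epsilon}^\epsilon)=-\tfrac\epsilon2\bigl(q^{-1}f_3^+e_\epsilon^\epsilon\otimes I+qf_3^-e_{-\epsilon}^{-\epsilon}\otimes I\bigr),$$ with $P=(qx-q^{-1}x^{-1})(qx^{-1}-q^{-1}x)$ and $$f_1^+=\frac1{1-x^2},\quad f_2^+=\frac{(q-q^{-1})^2+(1-x^2)^2}{(1-x^2)P},\quad f_3^+=\frac1{x-x^{-1}},\quad f_i^-=f_i^+\big|_{x\to x^{-1}},$$ $$g_1=\frac{(x+x^{-1})(q-q^{-1})}P,\quad g_2^\pm=\frac{(q-q^{-1})^2+q^{\pm2}(x-x^{-1})^2}{(x-x^{-1})P},\quad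 g_3=\frac{q^2-q^{-2}}P.$$ -/

import Mathlib

open Complex Matrix Topology Filter
open scoped Kronecker Nat

namespace XXZ

noncomputable section

/-! ### Rectangular contours -/

/-- Boundary of the rectangle `[-A, A] × [-B, B]` of the complex plane. -/
def contour (A B : ℝ) : Set ℂ :=
  {z | |z.re| ≤ A ∧ |z.im| ≤ B ∧ (|z.re| = A ∨ |z.im| = B)}

/-- The points encircled by the contour. -/
def inside (A B : ℝ) : Set ℂ := {z | |z.re| < A ∧ |z.im| < B}

/-- Integral over the boundary of `[-A, A] × [-B, B]`, counterclockwise. -/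
def contourIntegral (A B : ℝ) (f : ℂ → ℂ) : ℂ :=
  (∫ x in (-A)..A, f (x - B * I)) - (∫ x in (-A)..A, f (x + B * I))
    + I * (∫ y in (-B)..B, f (A + y * I)) - I * (∫ y in (-B)..B, f (-A + y * I))

/-- Iterated contour integral over `ω₁, …, ω_n`, with `ω₁` outermost. -/
def iteratedIntegral (A B : ℝ) : (n : ℕ) → ((Fin n → ℂ) → ℂ) → ℂ
  | 0, F => F ![]
  | n + 1, F => contourIntegral A B fun w => iteratedIntegral A B n fun v => F (Fin.cons w v)

/-- The canonical contour, for anisotropy `Δ = cosh η > -1`, `Δ ≠ 1`.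
For `Δ > 1` (`η > 0`): a rectangle of height `π` (one period) around the imaginary segment, of
half-width `δ < η / 2`.
For `-1 < Δ < 1` (`η = i γ`, `0 < γ < π`): a rectangle around the real segment `[-R, R]`, of
half-height `δ < γ / 2`; it also stays away from the `iπ`-translates of the singularities of the
kernel, `δ < (π - γ) / 2`. The length `R` is arbitrary; the two-line contour around the whole real
axis is the case of large `R`, where, the integrands being analytic far out in the strip, nothing
depends on `R` any more. -/
inductive IsCanonicalContour : ℂ → ℝ → ℝ → Prop
  | offCritical (η δ : ℝ) (hη : 0 < η) (hδ : 0 < δ) (hδη : δ < η / 2) :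
      IsCanonicalContour (η : ℂ) δ (Real.pi / 2)
  | critical (γ δ R : ℝ) (hγ : 0 < γ) (hγπ : γ < Real.pi) (hδ : 0 < δ) (hδγ : δ < γ / 2)
      (hδπ : δ < (Real.pi - γ) / 2) (hR : 0 < R) :
      IsCanonicalContour (γ * I) R δ

/-! ### The functions `𝔞`, `G`, `φ`, `ψ`, `ω` -/

/-- The hyperbolic cotangent. -/
def coth (z : ℂ) : ℂ := cosh z / sinh z

/-- The kernel `K(z; α)`. -/
def kernel (η z α : ℂ) : ℂ := exp (α * η) * coth (z - η) - exp (-α * η) * coth (z + η)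

/-- `a` solves the non-linear integral equation for the auxiliary function `𝔞` at temperature `T`
and magnetic field `h`. Here `logOnePlus` is a continuous branch of `ln (1 + 𝔞)` along the contour,
and the equation for `ln 𝔞` is written in its exponentiated form. -/
def IsAuxiliaryFunction (J T h : ℝ) (η : ℂ) (A B : ℝ) (a : ℂ → ℂ) : Prop :=
  ∃ logOnePlus : ℂ → ℂ, ContinuousOn logOnePlus (contour A B) ∧
    (∀ w ∈ contour A B, exp (logOnePlus w) = 1 + a w) ∧
    ∀ z ∈ contour A B,
      a z = exp (-(h : ℂ) / T - 2 * J * sinh η ^ 2 / (T * (sinh z * sinh (z + η)))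
        - contourIntegral A B fun w =>
            1 / (2 * Real.pi * I) *
              (sinh (2 * η) * logOnePlus w / (sinh (z - w + η) * sinh (z - w - η))))

/-- `G(z, μ; α)` solves the linear integral equation on the contour, for every `μ` inside it and
all `α` in a neighbourhood of `0` on which `G` is continuous in `(z, α)`. -/
def IsDensityFunction (η : ℂ) (A B : ℝ) (a : ℂ → ℂ) (G : ℂ → ℂ → ℂ → ℂ) : Prop :=
  ∀ μ ∈ inside A B, ∃ r > 0,
    ContinuousOn (fun p : ℂ × ℂ => G p.1 μ p.2) (contour A B ×ˢ Metric.ball 0 r) ∧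
    ∀ α ∈ Metric.ball (0 : ℂ) r, ∀ z ∈ contour A B,
      G z μ α = -coth (z - μ) + exp (α * η) * coth (z - μ - η)
        + contourIntegral A B fun w =>
            G w μ α / (2 * Real.pi * I * (1 + a w)) * kernel η (z - w) α

section
variable (η : ℂ) (A B : ℝ) (a : ℂ → ℂ) (G : ℂ → ℂ → ℂ → ℂ)

/-- `φ(μ; α)`. -/
def phi (μ α : ℂ) : ℂ :=
  1 + contourIntegral A B fun w => G w μ α / (Real.pi * I * (1 + a w))

/-- `ψ(μ₁, μ₂; α)`. -/
def psi (μ₁ μ₂ α : ℂ) : ℂ :=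
  contourIntegral A B fun w =>
    G w μ₁ α / (Real.pi * I * (1 + a w)) *
      (-coth (w - μ₂) + exp (-α * η) * coth (w - μ₂ - η))

/-- `∂_α ψ(μ₁, μ₂; α)`. -/
def psiPrime (μ₁ μ₂ α : ℂ) : ℂ := deriv (fun β => psi η A B a G μ₁ μ₂ β) α

/-- `ω(μ₁, μ₂; α)`. -/
def omega (μ₁ μ₂ α : ℂ) : ℂ :=
  -exp (α * (μ₁ - μ₂)) * psi η A B a G μ₁ μ₂ α
    - exp (α * (μ₁ - μ₂)) / (2 * cosh (α * η / 2) ^ 2) * kernel η (μ₁ - μ₂) (-α)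

/-- `ω'(μ₁, μ₂; α) = ∂_α (e^{α (μ₂ - μ₁)} ω(μ₁, μ₂; α))`. -/
def omegaPrime (μ₁ μ₂ α : ℂ) : ℂ :=
  deriv (fun β => exp (β * (μ₂ - μ₁)) * omega η A B a G μ₁ μ₂ β) α

/-! ### The inhomogeneous density matrix -/

/-- The list `x₁, x₂, …`: first the positions of the plus signs of `low`, counted from the right,
then the positions of the minus signs of `up`, counted from the left.
Spins are elements of `Fin 2`, with `0` for `+` and `1` for `-`. -/
def positions {n : ℕ} (up low : Fin n → Fin 2) : List (Fin n) :=
  ((List.finRange n).filter fun k => low k = 0).reverse ++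
    (List.finRange n).filter fun k => up k = 1

/-- The number `s` of plus signs of `low`. -/
def numPlus {n : ℕ} (low : Fin n → Fin 2) : ℕ :=
  ((List.finRange n).filter fun k => low k = 0).length

/-- The inhomogeneous density matrix element with upper indices `up`, lower indices `low`,
inhomogeneities `lam` and disorder parameter `α`, defined by the multiple contour integral; it
vanishes unless `s + s' = n`. The other auxiliary function is `1 / 𝔞`. -/
def densityElement {n : ℕ} (lam : Fin n → ℂ) (α : ℂ) (up low : Fin n → Fin 2) : ℂ :=
  if hn : (positions up low).length = n then
    iteratedIntegral A B n fun w =>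
      (∏ j : Fin n,
        if (j : ℕ) < numPlus low then
          exp (-α * η) / (2 * Real.pi * I * (1 + a (w j)))
            * (∏ k with k < (positions up low)[(j : ℕ)]'(hn.symm ▸ j.isLt),
                sinh (w j - lam k - η))
            * ∏ k with (positions up low)[(j : ℕ)]'(hn.symm ▸ j.isLt) < k, sinh (w j - lam k)
        else
          exp (α * η) / (2 * Real.pi * I * (1 + (a (w j))⁻¹))
            * (∏ k with k < (positions up low)[(j : ℕ)]'(hn.symm ▸ j.isLt),
                sinh (w j - lam k + η))
            * ∏ k with (positions up low)[(j : ℕ)]'(hn.symm ▸ j.isLt) < k, sinh (w j - lam k))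
      * Matrix.det (Matrix.of fun j k => -G (w j) (lam k) α)
      / ∏ j : Fin n, ∏ k with j < k, sinh (lam k - lam j) * sinh (w j - w k - η)
  else 0

/-- The one-point function `D⁺₊(μ)` at `α = 0`. -/
def onePoint (μ : ℂ) : ℂ := densityElement η A B a G ![μ] 0 ![0] ![0]

/-- The two-point density matrix element with upper indices `(u₁, u₂)` and lower indices
`(d₁, d₂)`. -/
def twoPoint (l₁ l₂ α : ℂ) (u₁ u₂ d₁ d₂ : Fin 2) : ℂ :=
  densityElement η A B a G ![l₁, l₂] α ![u₁, u₂] ![d₁, d₂]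

/-- The matrix unit `e_d^u`, in the convention in which `e_+^-` is the spin-raising matrix `σ⁺`. -/
def unit (d u : Fin 2) : Matrix (Fin 2) (Fin 2) ℂ := Matrix.single d u 1

/-- The inhomogeneous density matrix for `n = 2`. -/
def densityMatrix₂ (l₁ l₂ α : ℂ) : Matrix (Fin 2 × Fin 2) (Fin 2 × Fin 2) ℂ :=
  ∑ u₁, ∑ u₂, ∑ d₁, ∑ d₂,
    twoPoint η A B a G l₁ l₂ α u₁ u₂ d₁ d₂ • (unit d₁ u₁ ⊗ₖ unit d₂ u₂)

/-- The quantum group invariant combination `D_q(λ₁, λ₂)`. -/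
def Dq (l₁ l₂ : ℂ) : ℂ :=
  exp (l₁ - l₂) * twoPoint η A B a G l₁ l₂ 0 0 1 1 0
    + exp (l₂ - l₁) * twoPoint η A B a G l₁ l₂ 0 1 0 0 1
    - exp (-η) * twoPoint η A B a G l₁ l₂ 0 0 1 0 1
    - exp η * twoPoint η A B a G l₁ l₂ 0 1 0 1 0

/-! ### The factorized form -/

def sigmaZ : Matrix (Fin 2) (Fin 2) ℂ := !![1, 0; 0, -1]
def sigmaPlus : Matrix (Fin 2) (Fin 2) ℂ := !![0, 1; 0, 0]
def sigmaMinus : Matrix (Fin 2) (Fin 2) ℂ := !![0, 0; 1, 0]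

def Deven (l₁ l₂ : ℂ) : Matrix (Fin 2 × Fin 2) (Fin 2 × Fin 2) ℂ :=
  (1 / 4 : ℂ) • ((1 : Matrix (Fin 2) (Fin 2) ℂ) ⊗ₖ (1 : Matrix (Fin 2) (Fin 2) ℂ))
  + ((1 / 4 : ℂ) * (coth η * omega η A B a G l₁ l₂ 0
      + coth (l₁ - l₂) / η * omegaPrime η A B a G l₁ l₂ 0)) • (sigmaZ ⊗ₖ sigmaZ)
  - ((1 / 4 : ℂ) * (cosh (l₁ - l₂) / sinh η * omega η A B a G l₁ l₂ 0
      + cosh η / (η * sinh (l₁ - l₂)) * omegaPrime η A B a G l₁ l₂ 0)) •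
      (sigmaPlus ⊗ₖ sigmaMinus + sigmaMinus ⊗ₖ sigmaPlus)

def Dodd (l₁ l₂ : ℂ) : Matrix (Fin 2 × Fin 2) (Fin 2 × Fin 2) ℂ :=
  -(phi A B a G l₁ 0 / 4) • (sigmaZ ⊗ₖ (1 : Matrix (Fin 2) (Fin 2) ℂ))
  - (phi A B a G l₂ 0 / 4) • ((1 : Matrix (Fin 2) (Fin 2) ℂ) ⊗ₖ sigmaZ)
  - (sinh η * (phi A B a G l₁ 0 - phi A B a G l₂ 0) / (4 * sinh (l₁ - l₂))) •
      (sigmaPlus ⊗ₖ sigmaMinus - sigmaMinus ⊗ₖ sigmaPlus)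

end

/-! ### The operators of the exponential formula, for two sites

Linear operators on `End(ℂ² ⊗ ℂ²)`, given on the products `e_d₁^u₁ ⊗ e_d₂^u₂` of matrix units of
total spin zero; the remaining matrix units are sent to `0`, and are never used. Signs are elements
of `Fin 2` as above: the product of two signs is the sum in `Fin 2`, and `-ε` is `ε + 1`. -/

/-- The number `±1` that corresponds to a sign. -/
def sgn (e : Fin 2) : ℂ := if e = 0 then 1 else -1

section
variable (q x₁ x₂ : ℂ)

def f1 (s : Fin 2) : ℂ := if s = 0 then 1 / (1 - x₁ ^ 2 / x₂ ^ 2) else 1 / (1 - x₂ ^ 2 / x₁ ^ 2)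

/-- The denominator `(q ξ₁/ξ₂ - q⁻¹ ξ₂/ξ₁) (q ξ₂/ξ₁ - q⁻¹ ξ₁/ξ₂)`. -/
def den : ℂ := (q * (x₁ / x₂) - q⁻¹ * (x₂ / x₁)) * (q * (x₂ / x₁) - q⁻¹ * (x₁ / x₂))

def f2 (s : Fin 2) : ℂ :=
  if s = 0 then
    ((q - q⁻¹) ^ 2 + (1 - x₁ ^ 2 / x₂ ^ 2) ^ 2) / ((1 - x₁ ^ 2 / x₂ ^ 2) * den q x₁ x₂)
  else
    ((q - q⁻¹) ^ 2 + (1 - x₂ ^ 2 / x₁ ^ 2) ^ 2) / ((1 - x₂ ^ 2 / x₁ ^ 2) * den q x₂ x₁)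

def f3 (s : Fin 2) : ℂ := if s = 0 then 1 / (x₁ / x₂ - x₂ / x₁) else 1 / (x₂ / x₁ - x₁ / x₂)

def g1 : ℂ := (x₁ / x₂ + x₂ / x₁) * (q - q⁻¹) / den q x₁ x₂

def g2 (s : Fin 2) : ℂ :=
  ((q - q⁻¹) ^ 2 + (if s = 0 then q ^ 2 else (q⁻¹) ^ 2) * (x₁ / x₂ - x₂ / x₁) ^ 2)
    / ((x₁ / x₂ - x₂ / x₁) * den q x₁ x₂)

def g3 : ℂ := (q ^ 2 - (q⁻¹) ^ 2) / den q x₁ x₂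

/-- The linear operator with prescribed values on `e_d₁^u₁ ⊗ e_d₂^u₂`. -/
def operatorOf (img : (d₁ u₁ d₂ u₂ : Fin 2) → Matrix (Fin 2 × Fin 2) (Fin 2 × Fin 2) ℂ) :
    Module.End ℂ (Matrix (Fin 2 × Fin 2) (Fin 2 × Fin 2) ℂ) :=
  (Matrix.stdBasis ℂ (Fin 2 × Fin 2) (Fin 2 × Fin 2)).constr ℂ
    fun p => img p.1.1 p.2.1 p.1.2 p.2.2

/-- The operator with value `diag ε σ` on `e_ε^ε ⊗ e_σ^σ`, value `off ε` on
`e_ε^{-ε} ⊗ e_{-ε}^ε`. -/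
def spinZeroOperator (diag : Fin 2 → Fin 2 → Matrix (Fin 2 × Fin 2) (Fin 2 × Fin 2) ℂ)
    (off : Fin 2 → Matrix (Fin 2 × Fin 2) (Fin 2 × Fin 2) ℂ) :
    Module.End ℂ (Matrix (Fin 2 × Fin 2) (Fin 2 × Fin 2) ℂ) :=
  operatorOf fun d₁ u₁ d₂ u₂ =>
    if d₁ = u₁ ∧ d₂ = u₂ then diag d₁ d₂
    else if u₁ = d₁ + 1 ∧ d₂ = d₁ + 1 ∧ u₂ = d₁ then off d₁
    else 0

/-- `e_+^- ⊗ e_-^+ - e_-^+ ⊗ e_+^-`. -/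
def exchangeOdd : Matrix (Fin 2 × Fin 2) (Fin 2 × Fin 2) ℂ :=
  unit 0 1 ⊗ₖ unit 1 0 - unit 1 0 ⊗ₖ unit 0 1

/-- The operator `H₁`. -/
def opH1 : Module.End ℂ (Matrix (Fin 2 × Fin 2) (Fin 2 × Fin 2) ℂ) :=
  spinZeroOperator
    (fun e s => (sgn e / 2) •
      (f1 x₁ x₂ (e + s) • (unit e e ⊗ₖ unit e e)
        + f1 x₁ x₂ (e + s + 1) • (unit (e + 1) (e + 1) ⊗ₖ unit (e + 1) (e + 1))
        + f2 q x₁ x₂ (e + s) • (unit e e ⊗ₖ unit (e + 1) (e + 1))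
        + f2 q x₁ x₂ (e + s + 1) • (unit (e + 1) (e + 1) ⊗ₖ unit e e)
        - (sgn s * g1 q x₁ x₂) • exchangeOdd))
    (fun e => (1 / 2 : ℂ) •
      ((q⁻¹ * f3 x₁ x₂ e) • (unit e e ⊗ₖ unit e e)
        + (q * f3 x₁ x₂ (e + 1)) • (unit (e + 1) (e + 1) ⊗ₖ unit (e + 1) (e + 1))
        + (sgn e * q⁻¹ * g2 q x₁ x₂ 0) • (unit e e ⊗ₖ unit (e + 1) (e + 1))
        - (sgn e * q * g2 q x₁ x₂ 1) • (unit (e + 1) (e + 1) ⊗ₖ unit e e)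
        + g3 q x₁ x₂ • exchangeOdd))

/-- The operator `H₂`. -/
def opH2 : Module.End ℂ (Matrix (Fin 2 × Fin 2) (Fin 2 × Fin 2) ℂ) :=
  spinZeroOperator
    (fun e s => (sgn s / 2) •
      (f1 x₁ x₂ 1 • (unit e e ⊗ₖ (1 : Matrix (Fin 2) (Fin 2) ℂ))
        + f1 x₁ x₂ 0 • (unit (e + 1) (e + 1) ⊗ₖ (1 : Matrix (Fin 2) (Fin 2) ℂ))))
    (fun e => -(sgn e / 2) •
      ((q⁻¹ * f3 x₁ x₂ 0) • (unit e e ⊗ₖ (1 : Matrix (Fin 2) (Fin 2) ℂ))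
        + (q * f3 x₁ x₂ 1) • (unit (e + 1) (e + 1) ⊗ₖ (1 : Matrix (Fin 2) (Fin 2) ℂ))))

end

/-- The operator `Ω₁⁺`. -/
def opOmegaPlus (η l₁ l₂ : ℂ) : Module.End ℂ (Matrix (Fin 2 × Fin 2) (Fin 2 × Fin 2) ℂ) :=
  spinZeroOperator (fun e s => (-(sgn e * sgn s) / 4 * coth η) • 1)
    (fun _ => ((1 / 4 : ℂ) * (cosh (l₁ - l₂) / sinh η)) • 1)

/-- The operator `Ω₁⁻`. -/
def opOmegaMinus (η l₁ l₂ : ℂ) : Module.End ℂ (Matrix (Fin 2 × Fin 2) (Fin 2 × Fin 2) ℂ) :=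
  spinZeroOperator (fun e s => (-(sgn e * sgn s) / (4 * η) * coth (l₁ - l₂)) • 1)
    (fun _ => (1 / (4 * η) * (cosh η / sinh (l₁ - l₂))) • 1)

/-- `Ω = Ω₁ + Ω₂` with `Ω₁ = -ω Ω₁⁺ - ω' Ω₁⁻` and `Ω₂ = -φ(λ₁; 0) H₁ - φ(λ₂; 0) H₂`, where
`q = e^η` and `ξ_j = e^{λ_j}`. -/
def opOmega (η : ℂ) (A B : ℝ) (a : ℂ → ℂ) (G : ℂ → ℂ → ℂ → ℂ) (l₁ l₂ : ℂ) :
    Module.End ℂ (Matrix (Fin 2 × Fin 2) (Fin 2 × Fin 2) ℂ) :=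
  (-omega η A B a G l₁ l₂ 0 • opOmegaPlus η l₁ l₂
      - omegaPrime η A B a G l₁ l₂ 0 • opOmegaMinus η l₁ l₂)
    + (-phi A B a G l₁ 0 • opH1 (exp η) (exp l₁) (exp l₂)
      - phi A B a G l₂ 0 • opH2 (exp η) (exp l₁) (exp l₂))

/-- Operators of total spin zero, that is, commuting with `σᶻ ⊗ I + I ⊗ σᶻ`. -/
def IsSpinZero (O : Matrix (Fin 2 × Fin 2) (Fin 2 × Fin 2) ℂ) : Prop :=
  Commute (sigmaZ ⊗ₖ (1 : Matrix (Fin 2) (Fin 2) ℂ) + (1 : Matrix (Fin 2) (Fin 2) ℂ) ⊗ₖ sigmaZ) O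

end

end XXZ

namespace XXZ

noncomputable section

/-! ### The contour integral as an integral over a compact space -/

section ContourIntegral

open MeasureTheory unitInterval

/-! For two sites every matrix element is a double contour integral of the determinant of the
functions `G (·) λ_k`, multiplied by `sinh (w - c) * sinh (v - d) / sinh (w - v - η)`, where only
the nodes `c`, `d` and the weights depend on the spins. Since `1 / (1 + 1/𝔞) = 1 - 1 / (1 + 𝔞)`,
each weight is `weight a` or the constant `cauchyWeight` minus `weight a`. A variable with constant
weight is integrated out exactly: by the linear integral equation, `G (·) μ` behaves under the
integral like `-coth (· - μ)` plus a function holomorphic on the rectangle, so that only the residue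
at `μ` survives (`IsDensitySolution.contourIntegral_mul`).

What remains is the integral with `weight a` in both variables. The determinant is antisymmetric, so
only the antisymmetric part of the hyperbolic factor counts, and `sinh_mul_sinh_div_antisymm` splits
it in two. The first part is the kernel `K` times `S w - S v`; here the integral equation does one
integration, leaving single integrals. The second part is a constant times the odd kernel `coth (w -
v - η) + coth (w - v + η)`, whose double integral does not factorize. It is, however, the one in the
`α`-derivative of `ψ` at `0`: pairing the equation for `G (·) λ₁ α` with the equation at `α = 0` for
`G (·) λ₂ 0` (`IsDensitySolution.weightedIntegral_transpose`) moves the deformation from the unknown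
function to the explicit factors `exp (±α η) - 1`. Continuity of `G` in `α` therefore suffices for
differentiability of `ψ` at `0`, and the derivative is known (`IsDensityFunction.hasDerivAt_psi`).

All elements are now combinations of `φ_j`, `ψ`, `ψ'` and two auxiliary single integrals, which
cancel by rational identities in `exp λ_j` and `exp η` (`twoPoint_values`). Passing from `ψ`, `ψ'`
to `ω`, `ω'` only shifts constants (`coth_identity`, `cosh_identity`), which gives the factorized
density matrix.

For the exponential formula, `H₁` and `H₂` square to zero, anticommute and annihilate the identity,
and the functional belonging to `ω`, `ω'` vanishes on their images and on the identity. Hence `Ω`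
squares to zero (`opOmega_opOmega`), the exponential is `1 + Ω`, and the claim becomes a comparison
of traces. -/

/-- Parametrization of the four sides of the rectangle. -/
def side (A B : ℝ) (p : Fin 4 × I) : ℂ :=
  ![(-A + 2 * A * (p.2 : ℝ) : ℂ) - B * Complex.I, (-A + 2 * A * (p.2 : ℝ) : ℂ) + B * Complex.I,
    A + (-B + 2 * B * (p.2 : ℝ) : ℂ) * Complex.I,
    -A + (-B + 2 * B * (p.2 : ℝ) : ℂ) * Complex.I] p.1

/-- Derivatives of the parametrizations of the sides, with orientation. -/
def sideWeight (A B : ℝ) (p : Fin 4 × I) : ℂ :=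
  (![2 * A, -(2 * A), 2 * B * Complex.I, -(2 * B * Complex.I)] : Fin 4 → ℂ) p.1

/-- Lebesgue measure on the four sides. -/
def sideMeasure : Measure (Fin 4 × I) := Measure.count.prod volume

instance : IsFiniteMeasure sideMeasure := by unfold sideMeasure; infer_instance

lemma continuous_side (A B : ℝ) : Continuous (side A B) := by
  refine continuous_prod_of_discrete_left.2 fun i => ?_
  fin_cases i <;> simp [side] <;> fun_prop

lemma continuous_sideWeight (A B : ℝ) : Continuous (sideWeight A B) := by
  refine continuous_prod_of_discrete_left.2 fun i => ?_
  simp only [sideWeight]; fun_prop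

lemma side_mem {A B : ℝ} (hA : 0 < A) (hB : 0 < B) (p : Fin 4 × I) :
    side A B p ∈ contour A B := by
  obtain ⟨i, t, h0, h1⟩ := p
  have key : ∀ C : ℝ, 0 < C → |-C + 2 * C * t| ≤ C := fun C hC =>
    abs_le.2 ⟨by nlinarith, by nlinarith⟩
  fin_cases i <;>
    simp [side, contour, abs_of_pos hA, abs_of_pos hB, key A hA, key B hB]

lemma integrable_of_continuous {f : Fin 4 × I → ℂ} (hf : Continuous f) :
    Integrable f sideMeasure :=
  hf.integrable_of_hasCompactSupport (HasCompactSupport.of_compactSpace f)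

lemma intervalIntegral_eq_unitInterval (C : ℝ) (hC : 0 < C) (g : ℝ → ℂ) :
    ∫ x in (-C)..C, g x = ∫ t : I, 2 * C * g (-C + 2 * C * (t : ℝ)) := by
  have h := integral_subtype (s := Set.Icc (0 : ℝ) 1) measurableSet_Icc
    (fun t => 2 * (C : ℂ) * g (-C + 2 * C * t))
  have h2 := intervalIntegral.integral_comp_add_mul (a := 0) (b := 1) g
    (c := 2 * C) (by positivity) (-C)
  refine Eq.trans ?_ h.symm
  rw [MeasureTheory.integral_const_mul, integral_Icc_eq_integral_Ioc,
    ← intervalIntegral.integral_of_le zero_le_one, h2]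
  simp only [mul_zero, add_zero, mul_one, Complex.real_smul, ofReal_inv, ofReal_mul]
  rw [show -C + 2 * C = C by ring]
  have : (C : ℂ) ≠ 0 := by exact_mod_cast hC.ne'
  push_cast
  field_simp

/-- One finite measure on a compact space replaces the four separate side integrals, so that
additivity, Fubini and continuity in parameters follow at once for continuous integrands. -/
lemma contourIntegral_eq {A B : ℝ} (hA : 0 < A) (hB : 0 < B) {f : ℂ → ℂ}
    (hf : ContinuousOn f (contour A B)) :
    contourIntegral A B f = ∫ p, sideWeight A B p * f (side A B p) ∂sideMeasure := by
  have hc : Continuous fun p => sideWeight A B p * f (side A B p) :=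
    (continuous_sideWeight A B).mul (hf.comp_continuous (continuous_side A B) (side_mem hA hB))
  rw [sideMeasure, integral_prod _ (integrable_of_continuous hc), integral_fintype]
  · simp only [contourIntegral, intervalIntegral_eq_unitInterval _ hA,
      intervalIntegral_eq_unitInterval _ hB]
    simp [Fin.sum_univ_four, side, sideWeight, MeasureTheory.integral_const_mul]
    ring
  · exact Integrable.of_finite

lemma contourIntegral_congr {A B : ℝ} (hA : 0 < A) (hB : 0 < B) {f g : ℂ → ℂ}
    (h : ∀ w ∈ contour A B, f w = g w) : contourIntegral A B f = contourIntegral A B g := by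
  have h1 : ∀ x ∈ Set.uIcc (-A) A, ∀ s : ℝ, |s| = B → f (x + s * Complex.I) = g (x + s * Complex.I) := by
    intro x hx s hs
    rw [Set.uIcc_of_le (by linarith)] at hx
    exact h _ (by simp [contour, hs, abs_le.2 hx])
  have h2 : ∀ x ∈ Set.uIcc (-B) B, ∀ s : ℝ, |s| = A → f (s + x * Complex.I) = g (s + x * Complex.I) := by
    intro x hx s hs
    rw [Set.uIcc_of_le (by linarith)] at hx
    exact h _ (by simp [contour, hs, abs_le.2 hx])
  simp only [contourIntegral]
  congr 1
  · congr 1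
    · congr 1
      · refine intervalIntegral.integral_congr fun x hx => ?_
        simpa [sub_eq_add_neg] using h1 x hx (-B) (by simp [abs_of_pos hB])
      · refine intervalIntegral.integral_congr fun x hx => ?_
        simpa [sub_eq_add_neg] using h1 x hx B (by simp [abs_of_pos hB])
    · congr 1
      refine intervalIntegral.integral_congr fun x hx => ?_
      simpa [sub_eq_add_neg] using h2 x hx A (by simp [abs_of_pos hA])
  · congr 1
    refine intervalIntegral.integral_congr fun x hx => ?_
    simpa [sub_eq_add_neg] using h2 x hx (-A) (by simp [abs_of_pos hA])

lemma contourIntegral_const_mul (A B : ℝ) (c : ℂ) (f : ℂ → ℂ) :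
    contourIntegral A B (fun w => c * f w) = c * contourIntegral A B f := by
  simp only [contourIntegral, intervalIntegral.integral_const_mul]; ring

lemma contourIntegral_mul_const (A B : ℝ) (c : ℂ) (f : ℂ → ℂ) :
    contourIntegral A B (fun w => f w * c) = contourIntegral A B f * c := by
  simp only [contourIntegral, intervalIntegral.integral_mul_const]; ring

lemma contourIntegral_neg (A B : ℝ) (f : ℂ → ℂ) :
    contourIntegral A B (fun w => -f w) = -contourIntegral A B f := by
  simpa using contourIntegral_const_mul A B (-1) f

lemma contourIntegral_add {A B : ℝ} (hA : 0 < A) (hB : 0 < B) {f g : ℂ → ℂ}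
    (hf : ContinuousOn f (contour A B)) (hg : ContinuousOn g (contour A B)) :
    contourIntegral A B (fun w => f w + g w) = contourIntegral A B f + contourIntegral A B g := by
  have aux : ∀ {f : ℂ → ℂ}, ContinuousOn f (contour A B) →
      Continuous fun p => sideWeight A B p * f (side A B p) := fun hf =>
    (continuous_sideWeight A B).mul (hf.comp_continuous (continuous_side A B) (side_mem hA hB))
  rw [contourIntegral_eq hA hB hf, contourIntegral_eq hA hB hg,
    contourIntegral_eq (f := fun w => f w + g w) hA hB (hf.add hg), ← integral_add (integrable_of_continuous (aux hf))
      (integrable_of_continuous (aux hg))]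
  simp only [mul_add]

lemma contourIntegral_sub {A B : ℝ} (hA : 0 < A) (hB : 0 < B) {f g : ℂ → ℂ}
    (hf : ContinuousOn f (contour A B)) (hg : ContinuousOn g (contour A B)) :
    contourIntegral A B (fun w => f w - g w) = contourIntegral A B f - contourIntegral A B g := by
  simp only [sub_eq_add_neg]
  rw [contourIntegral_add (g := fun w => -g w) hA hB hf hg.neg, contourIntegral_neg]

/-- A contour integral depends continuously on parameters. -/
lemma continuousOn_contourIntegral {A B : ℝ} (hA : 0 < A) (hB : 0 < B) {Y : Type*}
    [TopologicalSpace Y] [T2Space Y] [FirstCountableTopology Y] {S : Set Y} (hS : IsCompact S)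
    {F : ℂ → Y → ℂ} (hF : ContinuousOn (fun p : ℂ × Y => F p.1 p.2) (contour A B ×ˢ S)) :
    ContinuousOn (fun y => contourIntegral A B fun w => F w y) S := by
  have : CompactSpace S := isCompact_iff_compactSpace.1 hS
  have hc : Continuous (Function.uncurry fun (y : S) (p : Fin 4 × I) =>
      sideWeight A B p * F (side A B p) y) := by
    refine ((continuous_sideWeight A B).comp continuous_snd).mul ?_
    refine hF.comp_continuous (f := fun q : S × (Fin 4 × I) => (side A B q.2, (q.1 : Y))) ?_ ?_
    · exact ((continuous_side A B).comp continuous_snd).prodMk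
        (continuous_subtype_val.comp continuous_fst)
    · exact fun q => ⟨side_mem hA hB _, q.1.2⟩
  have h := continuous_parametric_integral_of_continuous (μ := sideMeasure) hc
    (isCompact_univ (X := Fin 4 × I))
  rw [continuousOn_iff_continuous_domRestrict]
  convert h using 2 with y
  rw [Measure.restrict_univ]
  refine contourIntegral_eq (f := fun w => F w y) hA hB ?_
  exact hF.comp (continuousOn_id.prodMk continuousOn_const) fun w hw => ⟨hw, y.2⟩

lemma isCompact_contour (A B : ℝ) : IsCompact (contour A B) := by
  refine Metric.isCompact_of_isClosed_isBounded ?_ ?_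
  · have h1 : IsClosed {z : ℂ | |z.re| ≤ A} := isClosed_le (by fun_prop) (by fun_prop)
    have h2 : IsClosed {z : ℂ | |z.im| ≤ B} := isClosed_le (by fun_prop) (by fun_prop)
    have h3 : IsClosed {z : ℂ | |z.re| = A} := isClosed_eq (by fun_prop) (by fun_prop)
    have h4 : IsClosed {z : ℂ | |z.im| = B} := isClosed_eq (by fun_prop) (by fun_prop)
    exact h1.inter (h2.inter (h3.union h4))
  · refine (Metric.isBounded_iff_subset_closedBall 0).2 ⟨A + B, fun z hz => ?_⟩
    simpa using (Complex.norm_le_abs_re_add_abs_im z).trans (add_le_add hz.1 hz.2.1)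

/-- Fubini's theorem for contour integrals. -/
lemma contourIntegral_swap {A B : ℝ} (hA : 0 < A) (hB : 0 < B) {F : ℂ → ℂ → ℂ}
    (hF : ContinuousOn (fun p : ℂ × ℂ => F p.1 p.2) (contour A B ×ˢ contour A B)) :
    contourIntegral A B (fun w => contourIntegral A B fun v => F w v) =
      contourIntegral A B fun v => contourIntegral A B fun w => F w v := by
  have hF' : ContinuousOn (fun p : ℂ × ℂ => F p.2 p.1) (contour A B ×ˢ contour A B) :=
    hF.comp continuous_swap.continuousOn fun p hp => ⟨hp.2, hp.1⟩
  have hcpt := isCompact_contour A B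
  rw [contourIntegral_eq hA hB (continuousOn_contourIntegral hA hB hcpt hF'),
    contourIntegral_eq hA hB (continuousOn_contourIntegral hA hB hcpt hF)]
  have e1 : ∀ p, contourIntegral A B (fun v => F (side A B p) v) =
      ∫ p', sideWeight A B p' * F (side A B p) (side A B p') ∂sideMeasure := fun p =>
    contourIntegral_eq hA hB (hF.comp (continuousOn_const.prodMk continuousOn_id)
      fun w hw => ⟨side_mem hA hB p, hw⟩)
  have e2 : ∀ p, contourIntegral A B (fun w => F w (side A B p)) =
      ∫ p', sideWeight A B p' * F (side A B p') (side A B p) ∂sideMeasure := fun p =>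
    contourIntegral_eq hA hB (hF.comp (continuousOn_id.prodMk continuousOn_const)
      fun w hw => ⟨hw, side_mem hA hB p⟩)
  simp only [e1, e2, ← MeasureTheory.integral_const_mul]
  rw [integral_integral_swap]
  · simp only [mul_left_comm]
  · refine Continuous.integrable_of_hasCompactSupport ?_ (HasCompactSupport.of_compactSpace _)
    refine ((continuous_sideWeight A B).comp continuous_fst).mul
      (((continuous_sideWeight A B).comp continuous_snd).mul ?_)
    exact hF.comp_continuous (f := fun q : (Fin 4 × I) × (Fin 4 × I) => (side A B q.1, side A B q.2))
      (((continuous_side A B).comp continuous_fst).prodMk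
        ((continuous_side A B).comp continuous_snd))
      fun q => ⟨side_mem hA hB _, side_mem hA hB _⟩

end ContourIntegral

/-! ### Cauchy's theorem on the rectangle -/

section Cauchy

/-- The closed rectangle. -/
def rect (A B : ℝ) : Set ℂ := {z | |z.re| ≤ A ∧ |z.im| ≤ B}

lemma contour_subset_rect (A B : ℝ) : contour A B ⊆ rect A B := fun _ hz => ⟨hz.1, hz.2.1⟩

lemma inside_subset_rect (A B : ℝ) : inside A B ⊆ rect A B := fun _ hz => ⟨hz.1.le, hz.2.le⟩

lemma ne_of_mem_contour_of_mem_inside {A B : ℝ} {w μ : ℂ} (hw : w ∈ contour A B)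
    (hμ : μ ∈ inside A B) : w ≠ μ := by
  rintro rfl
  rcases hw.2.2 with h | h
  · exact absurd h hμ.1.ne
  · exact absurd h hμ.2.ne

lemma rect_mem_nhds {A B : ℝ} {μ : ℂ} (hμ : μ ∈ inside A B) : rect A B ∈ 𝓝 μ := by
  have h1 : IsOpen {z : ℂ | |z.re| < A} := isOpen_lt (by fun_prop) (by fun_prop)
  have h2 : IsOpen {z : ℂ | |z.im| < B} := isOpen_lt (by fun_prop) (by fun_prop)
  exact mem_of_superset ((h1.inter h2).mem_nhds hμ) (inside_subset_rect A B)

lemma contourIntegral_eq_zero {A B : ℝ} (hA : 0 < A) (hB : 0 < B) {f : ℂ → ℂ}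
    (hf : DifferentiableOn ℂ f (rect A B)) : contourIntegral A B f = 0 := by
  have h := integral_boundary_rect_eq_zero_of_differentiableOn f (-A - B * I) (A + B * I) (by
    refine hf.mono fun z hz => ?_
    simp only [sub_re, neg_re, ofReal_re, mul_re, I_re, mul_zero, ofReal_im, I_im, mul_one,
      sub_self, sub_zero, add_re, add_zero, sub_im, neg_im, neg_zero, mul_im, zero_sub, add_im,
      zero_add, mem_reProdIm] at hz
    rw [Set.uIcc_of_le (by linarith), Set.uIcc_of_le (by linarith)] at hz
    exact ⟨abs_le.2 hz.1, abs_le.2 hz.2⟩)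
  simpa [contourIntegral, sub_eq_add_neg] using h

lemma integral_inv_sub_eq_log {μ : ℂ} {a b c : ℝ} (h : ∀ x : ℝ, x + c * I - μ ∈ slitPlane) :
    ∫ x in a..b, ((x : ℂ) + c * I - μ)⁻¹ = log (b + c * I - μ) - log (a + c * I - μ) := by
  have hd : ∀ x : ℝ, HasDerivAt (fun x : ℝ => log ((x : ℂ) + c * I - μ)) ((x : ℂ) + c * I - μ)⁻¹ x := by
    intro x
    have h1 : HasDerivAt (fun x : ℝ => (x : ℂ) + c * I - μ) 1 x :=
      ((Complex.ofRealCLM.hasDerivAt (x := x)).add_const _).sub_const _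
    simpa using h1.clog_real (h x)
  refine intervalIntegral.integral_eq_sub_of_hasDerivAt (fun x _ => hd x) ?_
  refine Continuous.intervalIntegrable ?_ _ _
  exact Continuous.inv₀ (by fun_prop) fun x => slitPlane_ne_zero (h x)

/-- A constant factor inside the logarithm does not change its derivative. The choice `s = -1`
serves the left side of the rectangle, where `w - μ` crosses the cut of the principal branch. -/
lemma integral_inv_sub_eq_log' {μ : ℂ} {a b c : ℝ} (s : ℂ) (hs : s = 1 ∨ s = -1)
    (h : ∀ y : ℝ, s * (c + y * I - μ) ∈ slitPlane) :
    I * ∫ y in a..b, ((c : ℂ) + y * I - μ)⁻¹ =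
      log (s * (c + b * I - μ)) - log (s * (c + a * I - μ)) := by
  have hs0 : s ≠ 0 := by rcases hs with rfl | rfl <;> norm_num
  have hd : ∀ y : ℝ, HasDerivAt (fun y : ℝ => log (s * ((c : ℂ) + y * I - μ)))
      (I * ((c : ℂ) + y * I - μ)⁻¹) y := by
    intro y
    have h1 : HasDerivAt (fun y : ℝ => s * ((c : ℂ) + y * I - μ)) (s * (1 * I)) y :=
      ((((Complex.ofRealCLM.hasDerivAt (x := y)).mul_const I).const_add _).sub_const _).const_mul s
    convert h1.clog_real (h y) using 1
    have := right_ne_zero_of_mul (slitPlane_ne_zero (h y))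
    field_simp
  rw [← intervalIntegral.integral_const_mul]
  refine intervalIntegral.integral_eq_sub_of_hasDerivAt (fun x _ => hd x) ?_
  refine Continuous.intervalIntegrable ?_ _ _
  exact continuous_const.mul (Continuous.inv₀ (by fun_prop) fun y =>
    right_ne_zero_of_mul (slitPlane_ne_zero (h y)))

lemma log_neg_of_im_pos {z : ℂ} (h : 0 < z.im) : log (-z) = log z - Real.pi * I := by
  rw [log, log, arg_neg_eq_arg_sub_pi_of_im_pos h]; push_cast; simp; ring

lemma log_neg_of_im_neg {z : ℂ} (h : z.im < 0) : log (-z) = log z + Real.pi * I := by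
  rw [log, log, arg_neg_eq_arg_add_pi_of_im_neg h]; push_cast; simp; ring

/-- The values of the principal logarithm telescope at the corners. Only the left side uses `log
(-·)`, and the shifts by `π i` at its two ends add up to `2 π i`. -/
lemma contourIntegral_inv_sub {A B : ℝ} {μ : ℂ} (hμ : μ ∈ inside A B) :
    contourIntegral A B (fun w => (w - μ)⁻¹) = 2 * Real.pi * I := by
  obtain ⟨h1, h2⟩ := hμ
  rw [abs_lt] at h1 h2
  have e1 := integral_inv_sub_eq_log (μ := μ) (a := -A) (b := A) (c := -B)
    (fun x => Or.inr (by simp; linarith))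
  have e2 := integral_inv_sub_eq_log (μ := μ) (a := -A) (b := A) (c := B)
    (fun x => Or.inr (by simp; linarith))
  have e3 := integral_inv_sub_eq_log' (μ := μ) (a := -B) (b := B) (c := A) 1 (Or.inl rfl)
    (fun x => Or.inl (by simp; linarith))
  have e4 := integral_inv_sub_eq_log' (μ := μ) (a := -B) (b := B) (c := -A) (-1) (Or.inr rfl)
    (fun x => Or.inl (by simp; linarith))
  have l1 : log (-(-(A : ℂ) + B * I - μ)) = _ := log_neg_of_im_pos (by simp; linarith)
  have l2 : log (-(-(A : ℂ) + -B * I - μ)) = _ := log_neg_of_im_neg (by simp; linarith)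
  simp only [ofReal_neg, one_mul, neg_one_mul] at e1 e2 e3 e4
  rw [l1, l2] at e4
  simp only [contourIntegral]
  rw [e3, e4, e2]
  simp only [neg_mul] at e1
  simp only [sub_eq_add_neg, neg_mul] at e1 ⊢
  rw [e1]
  ring

lemma sinh_eq_zero {z : ℂ} (h : sinh z = 0) : z.re = 0 ∧ Real.sin z.im = 0 := by
  rw [← re_add_im z, sinh_add, sinh_mul_I, cosh_mul_I, ← ofReal_sinh, ← ofReal_cosh,
    ← ofReal_sin, ← ofReal_cos] at h
  have hre := congrArg re h
  have him := congrArg im h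
  simp only [add_re, mul_re, ofReal_re, ofReal_im, I_re, I_im, add_im, mul_im, zero_re,
    zero_im, mul_zero, mul_one, zero_mul, sub_zero, add_zero, zero_add] at hre him
  have hs : Real.sin z.im = 0 := by
    rcases mul_eq_zero.1 him with h | h
    · exact absurd h (Real.cosh_pos _).ne'
    · exact h
  have hc : Real.cos z.im ≠ 0 := by
    intro hc; have := Real.sin_sq_add_cos_sq z.im; rw [hs, hc] at this; norm_num at this
  refine ⟨?_, hs⟩
  rcases mul_eq_zero.1 hre with h | h
  · exact Real.sinh_eq_zero.1 h
  · exact absurd h hc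

lemma sinh_ne_zero_of_abs_im_lt_pi {z : ℂ} (h : |z.im| < Real.pi) (hz : z ≠ 0) : sinh z ≠ 0 := by
  intro h0
  obtain ⟨hre, him⟩ := sinh_eq_zero h0
  rw [abs_lt] at h
  exact hz (Complex.ext hre ((Real.sin_eq_zero_iff_of_lt_of_lt h.1 h.2).1 him))

/-- Cauchy's integral formula with the hyperbolic cotangent as kernel. -/
lemma contourIntegral_coth_mul {A B : ℝ} (hA : 0 < A) (hB : 0 < B) (hBπ : B ≤ Real.pi / 2)
    {μ : ℂ} (hμ : μ ∈ inside A B) {f : ℂ → ℂ} (hf : DifferentiableOn ℂ f (rect A B)) :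
    contourIntegral A B (fun w => coth (w - μ) * f w) = 2 * Real.pi * I * f μ := by
  -- `s` is `sinh (w - μ) / (w - μ)` with the singularity removed. It has no zero on the rectangle
  -- because imaginary parts of differences stay below `π`. Thus `coth (w - μ) * f w = k w / (w -
  -- μ)` with `k` holomorphic, and `dslope k μ` separates off the pole `f μ / (w - μ)`.
  set s : ℂ → ℂ := dslope (fun w => sinh (w - μ)) μ with hs
  have hnhds := rect_mem_nhds hμ
  have hsμ : s μ = 1 := by
    have : HasDerivAt (fun w => sinh (w - μ)) (cosh (μ - μ) * 1) μ :=
      ((hasDerivAt_id μ).sub_const μ).csinh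
    rw [hs, dslope_same, this.deriv]; simp
  have hsne : ∀ w, w ≠ μ → s w = (w - μ)⁻¹ * sinh (w - μ) := by
    intro w hw
    rw [hs, dslope_of_ne _ hw, slope_def_field]; simp [div_eq_inv_mul]
  have hs0 : ∀ w ∈ rect A B, s w ≠ 0 := by
    intro w hw
    by_cases h : w = μ
    · rw [h, hsμ]; exact one_ne_zero
    · rw [hsne w h]
      refine mul_ne_zero (inv_ne_zero (sub_ne_zero.2 h)) (sinh_ne_zero_of_abs_im_lt_pi ?_ (sub_ne_zero.2 h))
      rw [sub_im]
      have := abs_sub (w.im) (μ.im)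
      have := hw.2; have := hμ.2
      linarith
  have hsd : DifferentiableOn ℂ s (rect A B) :=
    (Complex.differentiableOn_dslope hnhds).2 (by fun_prop)
  set k : ℂ → ℂ := fun w => f w * cosh (w - μ) / s w with hk
  have hkd : DifferentiableOn ℂ k (rect A B) :=
    (hf.mul (by fun_prop)).div hsd hs0
  have hkμ : k μ = f μ := by simp [hk, hsμ]
  have hdk := (Complex.differentiableOn_dslope hnhds).2 hkd
  have hc : ContinuousOn (fun w : ℂ => (w - μ)⁻¹) (contour A B) :=
    ContinuousOn.inv₀ (by fun_prop) fun w hw =>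
      sub_ne_zero.2 (ne_of_mem_contour_of_mem_inside hw hμ)
  rw [contourIntegral_congr hA hB (g := fun w => dslope k μ w + f μ * (w - μ)⁻¹),
    contourIntegral_add hA hB (hdk.continuousOn.mono (contour_subset_rect A B))
      (g := fun w => f μ * (w - μ)⁻¹) (continuousOn_const.mul hc), contourIntegral_eq_zero hA hB hdk, contourIntegral_const_mul,
    contourIntegral_inv_sub hμ]
  · ring
  · intro w hw
    have hne := ne_of_mem_contour_of_mem_inside hw hμ
    have h0 : w - μ ≠ 0 := sub_ne_zero.2 hne
    have h1 : sinh (w - μ) ≠ 0 := by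
      have := hs0 w (contour_subset_rect A B hw)
      rw [hsne w hne] at this
      exact right_ne_zero_of_mul this
    rw [dslope_of_ne _ hne, slope_def_field, hkμ, hk]
    simp only [hsne w hne, coth]
    field_simp
    ring

end Cauchy

/-! ### Admissible contours and the linear integral equation -/

section IntegralEquation

/-- The properties of a rectangle on which the reduction of the multiple integrals is based: no
singularity of the kernel at a difference of two of its points. -/
structure Admissible (η : ℂ) (A B : ℝ) : Prop where
  A_pos : 0 < A
  B_pos : 0 < B
  B_le : B ≤ Real.pi / 2
  sinh_sub_ne : ∀ z ∈ rect A B, ∀ w ∈ rect A B, sinh (z - w - η) ≠ 0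
  sinh_add_ne : ∀ z ∈ rect A B, ∀ w ∈ rect A B, sinh (z - w + η) ≠ 0

/-- A zero of `sinh` has real part `0` and imaginary part in `π ℤ`. For `η > 0` the real part of `z
- w - η` is at most `2 δ - η < 0`; for `η = i γ` its imaginary part lies strictly between `-π` and
`0`, by the two bounds on `δ`. The condition with `+η` is the one with `-η` after exchanging the
points. -/
lemma IsCanonicalContour.admissible {η : ℂ} {A B : ℝ} (h : IsCanonicalContour η A B) :
    Admissible η A B := by
  have key : Admissible η A B ↔ 0 < A ∧ 0 < B ∧ B ≤ Real.pi / 2 ∧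
      ∀ z ∈ rect A B, ∀ w ∈ rect A B, sinh (z - w - η) ≠ 0 := by
    refine ⟨fun h => ⟨h.1, h.2, h.3, h.4⟩, fun ⟨h1, h2, h3, h4⟩ => ⟨h1, h2, h3, h4, ?_⟩⟩
    intro z hz w hw h0
    refine h4 w hw z hz ?_
    rw [show w - z - η = -(z - w + η) by ring, sinh_neg, h0, neg_zero]
  rw [key]
  cases h with
  | offCritical η' δ hη hδ hδη =>
    refine ⟨hδ, by positivity, le_rfl, fun z hz w hw h0 => ?_⟩
    have := (sinh_eq_zero h0).1
    have h1 := abs_le.1 hz.1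
    have h2 := abs_le.1 hw.1
    simp only [sub_re, ofReal_re] at this
    linarith
  | critical γ δ R hγ hγπ hδ hδγ hδπ hR =>
    refine ⟨hR, hδ, by linarith, fun z hz w hw h0 => ?_⟩
    have := (sinh_eq_zero h0).2
    have h1 := abs_le.1 hz.2
    have h2 := abs_le.1 hw.2
    simp only [sub_im, mul_im, ofReal_re, ofReal_im, I_re, I_im, mul_one, mul_zero, add_zero] at this
    have h3 := (Real.sin_eq_zero_iff_of_lt_of_lt (by linarith) (by linarith)).1 this
    linarith

variable {η : ℂ} {A B : ℝ}

lemma Admissible.sinh_ne (hC : Admissible η A B) : sinh η ≠ 0 := by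
  have h0 : (0 : ℂ) ∈ rect A B := by simp [rect, hC.A_pos.le, hC.B_pos.le]
  simpa using hC.sinh_add_ne 0 h0 0 h0

lemma Admissible.ne_zero (hC : Admissible η A B) : η ≠ 0 := fun h =>
  hC.sinh_ne (by rw [h, sinh_zero])

lemma sinh_sub_ne_zero (hB : B ≤ Real.pi / 2) {z w : ℂ} (hz : z ∈ rect A B) (hw : w ∈ inside A B)
    (hne : z ≠ w) : sinh (z - w) ≠ 0 := by
  refine sinh_ne_zero_of_abs_im_lt_pi ?_ (sub_ne_zero.2 hne)
  rw [sub_im]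
  have := abs_sub z.im w.im
  have := hz.2
  have := hw.2
  linarith

lemma _root_.ContinuousOn.xxz_coth {X : Type*} [TopologicalSpace X] {f : X → ℂ} {s : Set X}
    (hf : ContinuousOn f s) (h0 : ∀ x ∈ s, sinh (f x) ≠ 0) :
    ContinuousOn (fun x => coth (f x)) s :=
  (continuous_cosh.comp_continuousOn hf).div (continuous_sinh.comp_continuousOn hf) h0

lemma _root_.DifferentiableOn.xxz_coth {f : ℂ → ℂ} {s : Set ℂ}
    (hf : DifferentiableOn ℂ f s) (h0 : ∀ x ∈ s, sinh (f x) ≠ 0) :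
    DifferentiableOn ℂ (fun x => coth (f x)) s :=
  hf.ccosh.div hf.csinh h0

lemma coth_neg (z : ℂ) : coth (-z) = -coth z := by simp [coth, div_neg]

lemma kernel_neg (η z α : ℂ) : kernel η (-z) (-α) = kernel η z α := by
  simp only [kernel]
  rw [show -z - η = -(z + η) by ring, show -z + η = -(z - η) by ring, coth_neg, coth_neg]
  ring_nf

lemma kernel_zero (η z : ℂ) : kernel η z 0 = coth (z - η) - coth (z + η) := by simp [kernel]

lemma kernel_zero_sub_comm (η z w : ℂ) : kernel η (z - w) 0 = kernel η (w - z) 0 := by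
  rw [← kernel_neg, neg_zero, neg_sub]

lemma Admissible.continuousOn_coth_sub (hC : Admissible η A B) {X : Type*} [TopologicalSpace X]
    {f g : X → ℂ} {s : Set X} (hf : ContinuousOn f s) (hg : ContinuousOn g s)
    (hfm : ∀ x ∈ s, f x ∈ rect A B) (hgm : ∀ x ∈ s, g x ∈ rect A B) :
    ContinuousOn (fun x => coth (f x - g x - η)) s :=
  ((hf.sub hg).sub continuousOn_const).xxz_coth fun x hx => hC.sinh_sub_ne _ (hfm x hx) _ (hgm x hx)

lemma Admissible.continuousOn_coth_add (hC : Admissible η A B) {X : Type*} [TopologicalSpace X]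
    {f g : X → ℂ} {s : Set X} (hf : ContinuousOn f s) (hg : ContinuousOn g s)
    (hfm : ∀ x ∈ s, f x ∈ rect A B) (hgm : ∀ x ∈ s, g x ∈ rect A B) :
    ContinuousOn (fun x => coth (f x - g x + η)) s :=
  ((hf.sub hg).add continuousOn_const).xxz_coth fun x hx => hC.sinh_add_ne _ (hfm x hx) _ (hgm x hx)

lemma Admissible.continuousOn_kernel (hC : Admissible η A B) {X : Type*} [TopologicalSpace X]
    {f g : X → ℂ} {s : Set X} (hf : ContinuousOn f s) (hg : ContinuousOn g s)
    (hfm : ∀ x ∈ s, f x ∈ rect A B) (hgm : ∀ x ∈ s, g x ∈ rect A B) :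
    ContinuousOn (fun x => kernel η (f x - g x) 0) s := by
  simp only [kernel_zero]
  exact (hC.continuousOn_coth_sub hf hg hfm hgm).sub (hC.continuousOn_coth_add hf hg hfm hgm)

lemma Admissible.continuousOn_coth_inside (hC : Admissible η A B) {μ : ℂ} (hμ : μ ∈ inside A B) :
    ContinuousOn (fun w => coth (w - μ)) (contour A B) :=
  ContinuousOn.xxz_coth (by fun_prop) fun _ hw => sinh_sub_ne_zero hC.B_le
    (contour_subset_rect A B hw) hμ (ne_of_mem_contour_of_mem_inside hw hμ)

lemma Admissible.continuousOn_coth_sub_inside (hC : Admissible η A B) {μ : ℂ}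
    (hμ : μ ∈ inside A B) : ContinuousOn (fun w => coth (w - μ - η)) (contour A B) :=
  hC.continuousOn_coth_sub continuousOn_id continuousOn_const (contour_subset_rect A B)
    fun _ _ => inside_subset_rect A B hμ

/-- The linear integral equation at `α = 0`, with weight `b` on the contour. -/
structure IsDensitySolution (η : ℂ) (A B : ℝ) (b : ℂ → ℂ) (μ : ℂ) (g : ℂ → ℂ) : Prop where
  continuousOn : ContinuousOn g (contour A B)
  eq : ∀ z ∈ contour A B, g z = -coth (z - μ) + coth (z - μ - η)
    + contourIntegral A B fun w => b w * g w * kernel η (z - w) 0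

/-- Closing the contour on the simple pole of the density function. -/
lemma IsDensitySolution.contourIntegral_mul (hC : Admissible η A B) {b : ℂ → ℂ}
    (hb : ContinuousOn b (contour A B)) {μ : ℂ} (hμ : μ ∈ inside A B) {g : ℂ → ℂ}
    (hg : IsDensitySolution η A B b μ g) {f : ℂ → ℂ} (hf : DifferentiableOn ℂ f (rect A B)) :
    contourIntegral A B (fun w => g w * f w) = -(2 * Real.pi * I * f μ) := by
  have hA := hC.A_pos
  have hB := hC.B_pos
  have hsub := contour_subset_rect A B
  have hfc : ContinuousOn f (contour A B) := hf.continuousOn.mono hsub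
  have hμr := inside_subset_rect A B hμ
  have c1 : ContinuousOn (fun w => coth (w - μ) * f w) (contour A B) :=
    (hC.continuousOn_coth_inside hμ).mul hfc
  have d2 : DifferentiableOn ℂ (fun w => coth (w - μ - η) * f w) (rect A B) :=
    DifferentiableOn.mul (DifferentiableOn.xxz_coth (by fun_prop)
      fun w hw => hC.sinh_sub_ne w hw μ hμr) hf
  have cF : ContinuousOn (fun p : ℂ × ℂ => b p.2 * g p.2 * kernel η (p.1 - p.2) 0 * f p.1)
      (contour A B ×ˢ contour A B) :=
    (((hb.comp continuousOn_snd fun _ hp => hp.2).mul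
      (hg.continuousOn.comp continuousOn_snd fun _ hp => hp.2)).mul
      (hC.continuousOn_kernel continuousOn_fst continuousOn_snd (fun _ hp => hsub hp.1)
        fun _ hp => hsub hp.2)).mul (hfc.comp continuousOn_fst fun _ hp => hp.1)
  have cF' : ContinuousOn (fun p : ℂ × ℂ => b p.1 * g p.1 * kernel η (p.2 - p.1) 0 * f p.2)
      (contour A B ×ˢ contour A B) :=
    (((hb.comp continuousOn_fst fun _ hp => hp.1).mul
      (hg.continuousOn.comp continuousOn_fst fun _ hp => hp.1)).mul
      (hC.continuousOn_kernel continuousOn_snd continuousOn_fst (fun _ hp => hsub hp.2)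
        fun _ hp => hsub hp.1)).mul (hfc.comp continuousOn_snd fun _ hp => hp.2)
  have c3 : ContinuousOn (fun z => contourIntegral A B fun w =>
      b w * g w * kernel η (z - w) 0 * f z) (contour A B) :=
    continuousOn_contourIntegral hA hB (isCompact_contour A B)
      (F := fun w z => b w * g w * kernel η (z - w) 0 * f z) cF'
  -- The kernel term contributes nothing: with the `z`-integral done first, the integrand is
  -- holomorphic in `z` on the whole rectangle.
  have h3 : contourIntegral A B (fun z => contourIntegral A B fun w =>
      b w * g w * kernel η (z - w) 0 * f z) = 0 := by
    -- Zero is written as `0 * 0` so that `contourIntegral_const_mul` evaluates its integral.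
    rw [contourIntegral_swap hA hB (F := fun z w => b w * g w * kernel η (z - w) 0 * f z) cF,
      contourIntegral_congr hA hB (g := fun _ => 0 * 0), contourIntegral_const_mul, zero_mul]
    intro w hw
    simp only [mul_assoc]
    rw [contourIntegral_const_mul, contourIntegral_const_mul, contourIntegral_eq_zero hA hB]
    · simp
    · simp only [kernel_zero]
      have k1 : DifferentiableOn ℂ (fun z => coth (z - w - η)) (rect A B) :=
        DifferentiableOn.xxz_coth (by fun_prop) fun z hz => hC.sinh_sub_ne z hz w (hsub hw)
      have k2 : DifferentiableOn ℂ (fun z => coth (z - w + η)) (rect A B) :=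
        DifferentiableOn.xxz_coth (by fun_prop) fun z hz => hC.sinh_add_ne z hz w (hsub hw)
      exact (k1.sub k2).mul hf
  rw [contourIntegral_congr hA hB (g := fun z => (coth (z - μ - η) * f z - coth (z - μ) * f z)
      + contourIntegral A B fun w => b w * g w * kernel η (z - w) 0 * f z),
    contourIntegral_add (f := fun z => coth (z - μ - η) * f z - coth (z - μ) * f z) hA hB
      ((d2.continuousOn.mono hsub).sub c1) c3,
    contourIntegral_sub hA hB (d2.continuousOn.mono hsub) c1, h3, contourIntegral_eq_zero hA hB d2,
    contourIntegral_coth_mul hA hB hC.B_le hμ hf]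
  · ring
  · intro z hz
    rw [contourIntegral_mul_const, hg.eq z hz]
    ring

end IntegralEquation

/-! ### Hyperbolic identities -/

section Hyperbolic

/-- Separates the pole part `sinh κ * coth u` from an entire remainder, whose term `cosh (2 * u +
κ)` will cancel between two poles. -/
lemma sinh_two_mul_add_mul_coth {u : ℂ} (κ : ℂ) (hu : sinh u ≠ 0) :
    sinh (2 * u + κ) * coth u = cosh (2 * u + κ) + cosh κ + sinh κ * coth u := by
  rw [coth, mul_div_assoc', mul_div_assoc', div_eq_iff hu, add_mul, div_mul_cancel₀ _ hu,
    sinh_add, cosh_add, sinh_two_mul, cosh_two_mul]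
  linear_combination (cosh κ * sinh u + sinh κ * cosh u) * cosh_sq_sub_sinh_sq u

lemma sinh_add_div_sinh {u : ℂ} (v : ℂ) (hu : sinh u ≠ 0) :
    sinh (u + v) / sinh u = cosh v + sinh v * coth u := by
  rw [sinh_add, coth]; field_simp

/-- By product-to-sum, the numerators share `cosh (w + v - (c + d))`; times `sinh (w - v)` this is
half the difference of `sinh (2 * · - (c + d))`, and `K (w - v)` equals `sinh (2 η) / (sinh (w - v -
η) sinh (w - v + η))`. The other cosines depend on `w - v` alone; expanded around `w - v ∓ η` they
give the two `coth`, while the `sinh (η - c + d)` terms cancel. -/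
lemma sinh_mul_sinh_div_antisymm {w v η : ℂ} (c d : ℂ) (h1 : sinh (w - v - η) ≠ 0)
    (h2 : sinh (w - v + η) ≠ 0) (hη : sinh η ≠ 0) :
    2 * (sinh (w - c) * sinh (v - d) / sinh (w - v - η)
        - sinh (v - c) * sinh (w - d) / sinh (v - w - η)) =
      1 / (2 * sinh η) * ((sinh (2 * w - (c + d)) - sinh (2 * v - (c + d))) * kernel η (w - v) 0)
        - cosh (η - c + d) * (coth (w - v - η) + coth (w - v + η)) := by
  have e0 : sinh (v - w - η) = -sinh (w - v + η) := by rw [← sinh_neg]; ring_nf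
  have hE : sinh (w - v + η) + sinh (w - v - η) = 2 * (sinh (w - v) * cosh η) := by
    rw [sinh_add (w - v), sinh_sub (w - v)]; ring
  have hE' : cosh (w - v - η) * sinh (w - v + η) - cosh (w - v + η) * sinh (w - v - η) =
      2 * (sinh η * cosh η) := by
    rw [← mul_assoc, ← sinh_two_mul, show 2 * η = (w - v + η) - (w - v - η) by ring, sinh_sub (w - v + η)]; ring
  have p1 : sinh (w - c) * sinh (v - d) =
      (cosh (w + v - (c + d)) - cosh (w - v - c + d)) / 2 := by
    rw [show w + v - (c + d) = (w - c) + (v - d) by ring,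
      show w - v - c + d = (w - c) - (v - d) by ring, cosh_add (w - c), cosh_sub (w - c)]; ring
  have p2 : sinh (v - c) * sinh (w - d) =
      (cosh (w + v - (c + d)) - cosh (w - v + c - d)) / 2 := by
    rw [show w + v - (c + d) = (w - d) + (v - c) by ring,
      show w - v + c - d = (w - d) - (v - c) by ring, cosh_add (w - d), cosh_sub (w - d)]; ring
  have p3 : sinh (2 * w - (c + d)) - sinh (2 * v - (c + d)) =
      2 * (cosh (w + v - (c + d)) * sinh (w - v)) := by
    rw [show 2 * w - (c + d) = (w + v - (c + d)) + (w - v) by ring,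
      show 2 * v - (c + d) = (w + v - (c + d)) - (w - v) by ring, sinh_add (w + v - (c + d)),
      sinh_sub (w + v - (c + d))]; ring
  have p4 : cosh (w - v - c + d) =
      cosh (w - v - η) * cosh (η - c + d) + sinh (w - v - η) * sinh (η - c + d) := by
    rw [← cosh_add]; ring_nf
  have p5 : cosh (w - v + c - d) =
      cosh (w - v + η) * cosh (η - c + d) - sinh (w - v + η) * sinh (η - c + d) := by
    rw [← cosh_sub]; ring_nf
  rw [p1, p2, p3, p4, p5, e0, kernel_zero, coth, coth]
  generalize cosh (w + v - (c + d)) = Y at *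
  generalize cosh (η - c + d) = Ck at *
  generalize sinh (η - c + d) = Sk at *
  field_simp
  linear_combination Y * sinh η * hE - Y * sinh (w - v) * hE'

end Hyperbolic

/-! ### Reduction of the double integrals -/

section DoubleIntegral

variable {η : ℂ} {A B : ℝ}

/-- Double contour integral with weight `b w * c v`. -/
def doubleIntegral (A B : ℝ) (b c : ℂ → ℂ) (F : ℂ → ℂ → ℂ) : ℂ :=
  contourIntegral A B fun w => contourIntegral A B fun v => b w * c v * F w v

/-- Single contour integral with weight `b`. -/
def weightedIntegral (A B : ℝ) (b : ℂ → ℂ) (f : ℂ → ℂ) : ℂ :=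
  contourIntegral A B fun w => b w * f w

/-- Continuity on the product of the contour with itself. -/
def ContinuousOn₂ (A B : ℝ) (F : ℂ → ℂ → ℂ) : Prop :=
  ContinuousOn (fun p : ℂ × ℂ => F p.1 p.2) (contour A B ×ˢ contour A B)

lemma ContinuousOn₂.swap {F : ℂ → ℂ → ℂ} (hF : ContinuousOn₂ A B F) :
    ContinuousOn₂ A B fun w v => F v w :=
  ContinuousOn.comp (f := Prod.swap) hF continuous_swap.continuousOn fun _ hp => ⟨hp.2, hp.1⟩

lemma ContinuousOn₂.right {F : ℂ → ℂ → ℂ} (hF : ContinuousOn₂ A B F) {w : ℂ}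
    (hw : w ∈ contour A B) : ContinuousOn (F w) (contour A B) :=
  ContinuousOn.comp (f := fun v => (w, v)) hF (continuousOn_const.prodMk continuousOn_id)
    fun _ hv => ⟨hw, hv⟩

lemma ContinuousOn₂.mul {F G : ℂ → ℂ → ℂ} (hF : ContinuousOn₂ A B F) (hG : ContinuousOn₂ A B G) :
    ContinuousOn₂ A B fun w v => F w v * G w v := ContinuousOn.mul hF hG

lemma ContinuousOn₂.add {F G : ℂ → ℂ → ℂ} (hF : ContinuousOn₂ A B F) (hG : ContinuousOn₂ A B G) :
    ContinuousOn₂ A B fun w v => F w v + G w v := ContinuousOn.add hF hG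

lemma ContinuousOn₂.sub {F G : ℂ → ℂ → ℂ} (hF : ContinuousOn₂ A B F) (hG : ContinuousOn₂ A B G) :
    ContinuousOn₂ A B fun w v => F w v - G w v := ContinuousOn.sub hF hG

lemma _root_.ContinuousOn.xxz_fst {f : ℂ → ℂ} (hf : ContinuousOn f (contour A B)) :
    ContinuousOn₂ A B fun w _ => f w :=
  ContinuousOn.comp (f := Prod.fst) hf continuousOn_fst fun _ hp => hp.1

lemma _root_.ContinuousOn.xxz_snd {f : ℂ → ℂ} (hf : ContinuousOn f (contour A B)) :
    ContinuousOn₂ A B fun _ v => f v :=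
  ContinuousOn.comp (f := Prod.snd) hf continuousOn_snd fun _ hp => hp.2

lemma ContinuousOn₂.integral (hA : 0 < A) (hB : 0 < B) {F : ℂ → ℂ → ℂ}
    (hF : ContinuousOn₂ A B F) :
    ContinuousOn (fun w => contourIntegral A B fun v => F w v) (contour A B) :=
  continuousOn_contourIntegral hA hB (isCompact_contour A B) (F := fun v w => F w v) hF.swap

lemma doubleIntegral_congr (hA : 0 < A) (hB : 0 < B) (b c : ℂ → ℂ) {F F' : ℂ → ℂ → ℂ}
    (h : ∀ w ∈ contour A B, ∀ v ∈ contour A B, F w v = F' w v) :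
    doubleIntegral A B b c F = doubleIntegral A B b c F' :=
  contourIntegral_congr hA hB fun w hw => contourIntegral_congr hA hB fun v hv => by rw [h w hw v hv]

lemma doubleIntegral_const_mul (b c : ℂ → ℂ) (k : ℂ) (F : ℂ → ℂ → ℂ) :
    doubleIntegral A B b c (fun w v => k * F w v) = k * doubleIntegral A B b c F := by
  simp only [doubleIntegral, mul_left_comm _ k, contourIntegral_const_mul]

lemma doubleIntegral_sub (hA : 0 < A) (hB : 0 < B) {b c : ℂ → ℂ} (hb : ContinuousOn b (contour A B))
    (hc : ContinuousOn c (contour A B)) {F F' : ℂ → ℂ → ℂ} (hF : ContinuousOn₂ A B F)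
    (hF' : ContinuousOn₂ A B F') :
    doubleIntegral A B b c (fun w v => F w v - F' w v) =
      doubleIntegral A B b c F - doubleIntegral A B b c F' := by
  have k1 := (hb.xxz_fst.mul hc.xxz_snd).mul hF
  have k2 := (hb.xxz_fst.mul hc.xxz_snd).mul hF'
  rw [doubleIntegral, doubleIntegral, doubleIntegral,
    ← contourIntegral_sub hA hB (k1.integral hA hB) (k2.integral hA hB)]
  refine contourIntegral_congr hA hB fun w hw => ?_
  rw [← contourIntegral_sub hA hB (k1.right hw) (k2.right hw)]
  simp only [mul_sub]

lemma doubleIntegral_swap (hA : 0 < A) (hB : 0 < B) {b c : ℂ → ℂ}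
    (hb : ContinuousOn b (contour A B)) (hc : ContinuousOn c (contour A B)) {F : ℂ → ℂ → ℂ}
    (hF : ContinuousOn₂ A B F) :
    doubleIntegral A B b c F = doubleIntegral A B c b fun w v => F v w := by
  rw [doubleIntegral, contourIntegral_swap hA hB (F := fun w v => b w * c v * F w v)
    ((hb.xxz_fst.mul hc.xxz_snd).mul hF)]
  simp only [doubleIntegral, mul_comm (b _) (c _)]

lemma doubleIntegral_sub_right (hA : 0 < A) (hB : 0 < B) {b c c' : ℂ → ℂ}
    (hb : ContinuousOn b (contour A B)) (hc : ContinuousOn c (contour A B))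
    (hc' : ContinuousOn c' (contour A B)) {F : ℂ → ℂ → ℂ} (hF : ContinuousOn₂ A B F) :
    doubleIntegral A B b (fun w => c w - c' w) F =
      doubleIntegral A B b c F - doubleIntegral A B b c' F := by
  have k1 := (hb.xxz_fst.mul hc.xxz_snd).mul hF
  have k2 := (hb.xxz_fst.mul hc'.xxz_snd).mul hF
  rw [doubleIntegral, doubleIntegral, doubleIntegral,
    ← contourIntegral_sub hA hB (k1.integral hA hB) (k2.integral hA hB)]
  refine contourIntegral_congr hA hB fun w hw => ?_
  rw [← contourIntegral_sub hA hB (k1.right hw) (k2.right hw)]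
  simp only [mul_sub, sub_mul]

lemma doubleIntegral_sub_left (hA : 0 < A) (hB : 0 < B) {b c c' : ℂ → ℂ}
    (hb : ContinuousOn b (contour A B)) (hc : ContinuousOn c (contour A B))
    (hc' : ContinuousOn c' (contour A B)) {F : ℂ → ℂ → ℂ} (hF : ContinuousOn₂ A B F) :
    doubleIntegral A B (fun w => c w - c' w) b F =
      doubleIntegral A B c b F - doubleIntegral A B c' b F := by
  rw [doubleIntegral_swap (b := fun w => c w - c' w) hA hB (hc.sub hc') hb hF, doubleIntegral_sub_right hA hB hb hc hc' hF.swap,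
    doubleIntegral_swap hA hB hc hb hF, doubleIntegral_swap hA hB hc' hb hF]

lemma weightedIntegral_congr (hA : 0 < A) (hB : 0 < B) (b : ℂ → ℂ) {f g : ℂ → ℂ}
    (h : ∀ w ∈ contour A B, f w = g w) :
    weightedIntegral A B b f = weightedIntegral A B b g :=
  contourIntegral_congr hA hB fun w hw => by rw [h w hw]

lemma weightedIntegral_add (hA : 0 < A) (hB : 0 < B) {b f g : ℂ → ℂ}
    (hb : ContinuousOn b (contour A B)) (hf : ContinuousOn f (contour A B))
    (hg : ContinuousOn g (contour A B)) :
    weightedIntegral A B b (fun w => f w + g w) =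
      weightedIntegral A B b f + weightedIntegral A B b g := by
  simp only [weightedIntegral, mul_add]
  exact contourIntegral_add hA hB (hb.mul hf) (hb.mul hg)

lemma weightedIntegral_sub (hA : 0 < A) (hB : 0 < B) {b f g : ℂ → ℂ}
    (hb : ContinuousOn b (contour A B)) (hf : ContinuousOn f (contour A B))
    (hg : ContinuousOn g (contour A B)) :
    weightedIntegral A B b (fun w => f w - g w) =
      weightedIntegral A B b f - weightedIntegral A B b g := by
  simp only [weightedIntegral, mul_sub]
  exact contourIntegral_sub hA hB (hb.mul hf) (hb.mul hg)

lemma weightedIntegral_const_mul (b : ℂ → ℂ) (k : ℂ) (f : ℂ → ℂ) :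
    weightedIntegral A B b (fun w => k * f w) = k * weightedIntegral A B b f := by
  simp only [weightedIntegral, mul_left_comm _ k, contourIntegral_const_mul]

/-- Iterating the integrals one after the other. -/
lemma doubleIntegral_eq (b c : ℂ → ℂ) (F : ℂ → ℂ → ℂ) :
    doubleIntegral A B b c F = weightedIntegral A B b fun w => weightedIntegral A B c (F w) := by
  simp only [doubleIntegral, weightedIntegral, mul_assoc, contourIntegral_const_mul]

end DoubleIntegral

/-! ### Double integrals of the determinant expressed through single integrals. -/

section Reduction

variable {η : ℂ} {A B : ℝ} {b : ℂ → ℂ} {l₁ l₂ μ : ℂ} {g g₁ g₂ : ℂ → ℂ}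

/-- The constant weight `1 / (2 π i)`. -/
def cauchyWeight : ℂ → ℂ := fun _ => 1 / (2 * Real.pi * I)

/-- The determinant of the density functions of two inhomogeneities. -/
def det₂ (g₁ g₂ : ℂ → ℂ) (w v : ℂ) : ℂ := g₁ w * g₂ v - g₂ w * g₁ v

lemma continuousOn_cauchyWeight : ContinuousOn cauchyWeight (contour A B) := continuousOn_const

lemma continuousOn₂_det₂ (h₁ : ContinuousOn g₁ (contour A B)) (h₂ : ContinuousOn g₂ (contour A B)) :
    ContinuousOn₂ A B (det₂ g₁ g₂) :=
  (h₁.xxz_fst.mul h₂.xxz_snd).sub (h₂.xxz_fst.mul h₁.xxz_snd)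

lemma Admissible.continuousOn₂_div_sinh (hC : Admissible η A B) (c d : ℂ) :
    ContinuousOn₂ A B fun w v => sinh (w - c) * sinh (v - d) / sinh (w - v - η) := by
  refine ContinuousOn.div ?_ ?_ fun p hp => hC.sinh_sub_ne _ (contour_subset_rect A B hp.1) _
    (contour_subset_rect A B hp.2)
  · exact Continuous.continuousOn (by fun_prop)
  · exact Continuous.continuousOn (by fun_prop)

lemma Admissible.continuousOn₂_kernel (hC : Admissible η A B) :
    ContinuousOn₂ A B fun w v => kernel η (w - v) 0 :=
  hC.continuousOn_kernel continuousOn_fst continuousOn_snd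
    (fun _ hp => contour_subset_rect A B hp.1) fun _ hp => contour_subset_rect A B hp.2

lemma Admissible.continuousOn₂_coth_sub (hC : Admissible η A B) :
    ContinuousOn₂ A B fun w v => coth (w - v - η) :=
  hC.continuousOn_coth_sub continuousOn_fst continuousOn_snd
    (fun _ hp => contour_subset_rect A B hp.1) fun _ hp => contour_subset_rect A B hp.2

lemma Admissible.continuousOn₂_coth_add (hC : Admissible η A B) :
    ContinuousOn₂ A B fun w v => coth (w - v + η) :=
  hC.continuousOn_coth_add continuousOn_fst continuousOn_snd
    (fun _ hp => contour_subset_rect A B hp.1) fun _ hp => contour_subset_rect A B hp.2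

/-- The integral equation solved for its integral term; in this form it removes one integration from
a double integral containing `K`. -/
lemma IsDensitySolution.weightedIntegral_kernel (hg : IsDensitySolution η A B b μ g) {z : ℂ}
    (hz : z ∈ contour A B) : weightedIntegral A B b (fun v => g v * kernel η (z - v) 0) =
      g z + (coth (z - μ) - coth (z - μ - η)) := by
  rw [hg.eq z hz, weightedIntegral]
  simp only [mul_assoc]
  ring

lemma IsDensitySolution.weightedIntegral_cauchyWeight (hC : Admissible η A B)
    (hb : ContinuousOn b (contour A B)) (hμ : μ ∈ inside A B) (hg : IsDensitySolution η A B b μ g)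
    {f : ℂ → ℂ} (hf : DifferentiableOn ℂ f (rect A B)) :
    weightedIntegral A B cauchyWeight (fun w => g w * f w) = -f μ := by
  simp only [weightedIntegral, cauchyWeight]
  rw [contourIntegral_const_mul, hg.contourIntegral_mul hC hb hμ hf]
  have : (Real.pi : ℂ) ≠ 0 := by exact_mod_cast Real.pi_ne_zero
  field_simp [I_ne_zero]

/-- With equal weights, exchanging the variables flips the sign of the determinant, so only the
antisymmetric part of `r` contributes. -/
lemma two_mul_doubleIntegral_det₂ (hA : 0 < A) (hB : 0 < B) (hb : ContinuousOn b (contour A B))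
    (h₁ : ContinuousOn g₁ (contour A B)) (h₂ : ContinuousOn g₂ (contour A B)) {r : ℂ → ℂ → ℂ}
    (hr : ContinuousOn₂ A B r) :
    2 * doubleIntegral A B b b (fun w v => det₂ g₁ g₂ w v * r w v) =
      doubleIntegral A B b b fun w v => det₂ g₁ g₂ w v * (r w v - r v w) := by
  have hD := continuousOn₂_det₂ h₁ h₂
  have e : doubleIntegral A B b b (fun w v => det₂ g₁ g₂ w v * r v w) =
      -doubleIntegral A B b b (fun w v => det₂ g₁ g₂ w v * r w v) := by
    rw [doubleIntegral_swap hA hB hb hb (hD.mul hr.swap), neg_eq_neg_one_mul,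
      ← doubleIntegral_const_mul]
    refine doubleIntegral_congr hA hB _ _ fun w _ v _ => ?_
    simp only [det₂]; ring
  simp only [mul_sub]
  rw [doubleIntegral_sub hA hB hb hb (hD.mul hr) (hD.mul hr.swap), e]
  ring

/-- Symmetry of the function `ψ` at `α = 0`. -/
lemma IsDensitySolution.symm (hC : Admissible η A B) (hb : ContinuousOn b (contour A B))
    (hg₁ : IsDensitySolution η A B b l₁ g₁) (hg₂ : IsDensitySolution η A B b l₂ g₂)
    (h₁ : l₁ ∈ inside A B) (h₂ : l₂ ∈ inside A B) :
    weightedIntegral A B b (fun w => g₁ w * (coth (w - l₂) - coth (w - l₂ - η))) =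
      weightedIntegral A B b (fun w => g₂ w * (coth (w - l₁) - coth (w - l₁ - η))) := by
  have hA := hC.A_pos
  have hB := hC.B_pos
  have cK := hC.continuousOn₂_kernel
  -- Eliminating the `coth` terms by the equation for `f` leaves the integral of `g f` and a double
  -- integral with `K`. As `K` is even at `α = 0`, both are symmetric in `g` and `f`.
  have e : ∀ {m : ℂ} {g f : ℂ → ℂ}, m ∈ inside A B → IsDensitySolution η A B b m f →
      ContinuousOn g (contour A B) →
      weightedIntegral A B b (fun w => g w * (coth (w - m) - coth (w - m - η))) =
        doubleIntegral A B b b (fun w v => g w * (f v * kernel η (w - v) 0))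
          - weightedIntegral A B b (fun w => g w * f w) := by
    intro m g f hm hf hg
    rw [doubleIntegral_eq, ← weightedIntegral_sub hA hB hb ?_ (hg.fun_mul hf.continuousOn)]
    · refine weightedIntegral_congr hA hB b fun w hw => ?_
      rw [weightedIntegral_const_mul, hf.weightedIntegral_kernel hw]
      ring
    · exact ((hb.xxz_snd.mul (hg.xxz_fst.mul (hf.continuousOn.xxz_snd.mul cK))).integral hA hB)
  rw [e h₂ hg₂ hg₁.continuousOn, e h₁ hg₁ hg₂.continuousOn,
    doubleIntegral_swap hA hB hb hb
      (hg₁.continuousOn.xxz_fst.mul (hg₂.continuousOn.xxz_snd.mul cK))]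
  congr 1
  · refine doubleIntegral_congr hA hB b b fun w _ v _ => ?_
    rw [kernel_zero_sub_comm η v w]; ring
  · simp only [mul_comm (g₁ _)]

/-- Since `K` is even, `(S w - S v) K` is the antisymmetrization of `S w K`, and the `v`-integral is
then given by the integral equation. The terms `S w * g₁ w * g₂ w` it produces cancel in the
determinant. -/
lemma IsDensitySolution.doubleIntegral_kernel (hC : Admissible η A B)
    (hb : ContinuousOn b (contour A B)) (hg₁ : IsDensitySolution η A B b l₁ g₁)
    (hg₂ : IsDensitySolution η A B b l₂ g₂) {S : ℂ → ℂ} (hS : ContinuousOn S (contour A B)) :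
    doubleIntegral A B b b (fun w v => det₂ g₁ g₂ w v * ((S w - S v) * kernel η (w - v) 0)) =
      2 * weightedIntegral A B b fun w =>
        S w * (g₁ w * (coth (w - l₂) - coth (w - l₂ - η)))
          - S w * (g₂ w * (coth (w - l₁) - coth (w - l₁ - η))) := by
  have hA := hC.A_pos
  have hB := hC.B_pos
  have cK := hC.continuousOn₂_kernel
  rw [doubleIntegral_congr hA hB b b (F' := fun w v => det₂ g₁ g₂ w v *
      (S w * kernel η (w - v) 0 - S v * kernel η (v - w) 0)),
    ← two_mul_doubleIntegral_det₂ hA hB hb hg₁.continuousOn hg₂.continuousOn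
      (r := fun w v => S w * kernel η (w - v) 0) (hS.xxz_fst.mul cK), doubleIntegral_eq]
  · congr 1
    refine weightedIntegral_congr hA hB b fun w hw => ?_
    have c1 : ContinuousOn (fun v => g₁ v * kernel η (w - v) 0) (contour A B) :=
      hg₁.continuousOn.fun_mul (cK.right hw)
    have c2 : ContinuousOn (fun v => g₂ v * kernel η (w - v) 0) (contour A B) :=
      hg₂.continuousOn.fun_mul (cK.right hw)
    rw [weightedIntegral_congr hA hB b (g := fun v =>
        S w * g₁ w * (g₂ v * kernel η (w - v) 0) - S w * g₂ w * (g₁ v * kernel η (w - v) 0)),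
      weightedIntegral_sub (f := fun v => S w * g₁ w * (g₂ v * kernel η (w - v) 0))
        (g := fun v => S w * g₂ w * (g₁ v * kernel η (w - v) 0)) hA hB hb
        (continuousOn_const.fun_mul c2) (continuousOn_const.fun_mul c1), weightedIntegral_const_mul,
      weightedIntegral_const_mul, hg₁.weightedIntegral_kernel hw, hg₂.weightedIntegral_kernel hw]
    · ring
    · intro v _; simp only [det₂]; ring
  · intro w _ v _; rw [kernel_zero_sub_comm η v w]; ring

/-- Replaces the `w`-dependent factor in front of each `coth` by its value at the pole. The leftover
`cosh (2 * w - e)` is the same for both poles and drops out of the difference. -/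
lemma weightedIntegral_sinh_mul (hC : Admissible η A B) (hb : ContinuousOn b (contour A B))
    (hg : ContinuousOn g (contour A B)) (hμ : μ ∈ inside A B) (e : ℂ) :
    weightedIntegral A B b (fun w => sinh (2 * w - e) *
        (g w * (coth (w - μ) - coth (w - μ - η)))) =
      (cosh (2 * μ - e) - cosh (2 * μ + 2 * η - e)) * weightedIntegral A B b g
        + sinh (2 * μ - e) * weightedIntegral A B b (fun w => g w * coth (w - μ))
        - sinh (2 * μ + 2 * η - e) * weightedIntegral A B b (fun w => g w * coth (w - μ - η)) := by
  have hA := hC.A_pos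
  have hB := hC.B_pos
  have c1 := hg.fun_mul (hC.continuousOn_coth_inside hμ)
  have c2 := hg.fun_mul (hC.continuousOn_coth_sub_inside hμ)
  simp only [← weightedIntegral_const_mul]
  rw [← weightedIntegral_add hA hB hb (continuousOn_const.fun_mul hg) (continuousOn_const.fun_mul c1),
    ← weightedIntegral_sub hA hB hb
      ((continuousOn_const.fun_mul hg).fun_add (continuousOn_const.fun_mul c1)) (continuousOn_const.fun_mul c2)]
  refine weightedIntegral_congr hA hB b fun w hw => ?_
  have hw' := contour_subset_rect A B hw
  have k1 := sinh_two_mul_add_mul_coth (2 * μ - e)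
    (sinh_sub_ne_zero hC.B_le hw' hμ (ne_of_mem_contour_of_mem_inside hw hμ))
  have k2 := sinh_two_mul_add_mul_coth (2 * μ + 2 * η - e)
    (hC.sinh_sub_ne w hw' μ (inside_subset_rect A B hμ))
  rw [show 2 * (w - μ) + (2 * μ - e) = 2 * w - e by ring] at k1
  rw [show 2 * (w - μ - η) + (2 * μ + 2 * η - e) = 2 * w - e by ring] at k2
  linear_combination g w * k1 - g w * k2

/-- The double integral with both weights equal to `b`. -/
lemma IsDensitySolution.doubleIntegral_sinh (hC : Admissible η A B)
    (hb : ContinuousOn b (contour A B)) (hg₁ : IsDensitySolution η A B b l₁ g₁)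
    (hg₂ : IsDensitySolution η A B b l₂ g₂) (h₁ : l₁ ∈ inside A B) (h₂ : l₂ ∈ inside A B)
    (c d : ℂ) :
    4 * doubleIntegral A B b b (fun w v => det₂ g₁ g₂ w v *
        (sinh (w - c) * sinh (v - d) / sinh (w - v - η))) =
      1 / sinh η *
        ((cosh (2 * l₂ - (c + d)) - cosh (2 * l₂ + 2 * η - (c + d))) * weightedIntegral A B b g₁
          + sinh (2 * l₂ - (c + d)) * weightedIntegral A B b (fun w => g₁ w * coth (w - l₂))
          - sinh (2 * l₂ + 2 * η - (c + d)) *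
              weightedIntegral A B b (fun w => g₁ w * coth (w - l₂ - η))
          - ((cosh (2 * l₁ - (c + d)) - cosh (2 * l₁ + 2 * η - (c + d))) * weightedIntegral A B b g₂
          + sinh (2 * l₁ - (c + d)) * weightedIntegral A B b (fun w => g₂ w * coth (w - l₁))
          - sinh (2 * l₁ + 2 * η - (c + d)) *
              weightedIntegral A B b (fun w => g₂ w * coth (w - l₁ - η))))
        - cosh (η - c + d) * doubleIntegral A B b b (fun w v => det₂ g₁ g₂ w v *
            (coth (w - v - η) + coth (w - v + η))) := by
  have hA := hC.A_pos
  have hB := hC.B_pos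
  have hsub := contour_subset_rect A B
  have hD := continuousOn₂_det₂ hg₁.continuousOn hg₂.continuousOn
  have hS : ContinuousOn (fun w : ℂ => sinh (2 * w - (c + d))) (contour A B) :=
    Continuous.continuousOn (by fun_prop)
  have hE : ∀ {m : ℂ}, m ∈ inside A B →
      ContinuousOn (fun w => coth (w - m) - coth (w - m - η)) (contour A B) := fun hm =>
    (hC.continuousOn_coth_inside hm).fun_sub (hC.continuousOn_coth_sub_inside hm)
  rw [← weightedIntegral_sinh_mul hC hb hg₁.continuousOn h₂,
    ← weightedIntegral_sinh_mul hC hb hg₂.continuousOn h₁,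
    ← weightedIntegral_sub hA hB hb (hS.fun_mul (hg₁.continuousOn.fun_mul (hE h₂)))
      (hS.fun_mul (hg₂.continuousOn.fun_mul (hE h₁)))]
  have key := hg₁.doubleIntegral_kernel hC hb hg₂ hS
  have hanti := two_mul_doubleIntegral_det₂ hA hB hb hg₁.continuousOn hg₂.continuousOn
    (hC.continuousOn₂_div_sinh c d)
  have e := doubleIntegral_const_mul (A := A) (B := B) b b 2 (fun w v => det₂ g₁ g₂ w v *
    (sinh (w - c) * sinh (v - d) / sinh (w - v - η) -
      sinh (v - c) * sinh (w - d) / sinh (v - w - η)))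
  -- Here the antisymmetrized factor is split into the part handled by `doubleIntegral_kernel` and
  -- the odd kernel, which is kept as a double integral.
  rw [doubleIntegral_congr hA hB b b (F' := fun w v =>
      1 / (2 * sinh η) * (det₂ g₁ g₂ w v *
        ((sinh (2 * w - (c + d)) - sinh (2 * v - (c + d))) * kernel η (w - v) 0))
      - cosh (η - c + d) * (det₂ g₁ g₂ w v * (coth (w - v - η) + coth (w - v + η)))),
    doubleIntegral_sub hA hB hb hb, doubleIntegral_const_mul, doubleIntegral_const_mul, key] at e
  · linear_combination 2 * hanti - e
  · exact continuousOn_const.mul (hD.mul ((hS.xxz_fst.sub hS.xxz_snd).mul hC.continuousOn₂_kernel))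
  · exact continuousOn_const.fun_mul
      (hD.mul (hC.continuousOn₂_coth_sub.add hC.continuousOn₂_coth_add))
  · intro w hw v hv
    have := sinh_mul_sinh_div_antisymm c d (hC.sinh_sub_ne w (hsub hw) v (hsub hv))
      (hC.sinh_add_ne w (hsub hw) v (hsub hv)) hC.sinh_ne
    linear_combination det₂ g₁ g₂ w v * this

/-- Closing the contour of the second integration variable. -/
lemma IsDensitySolution.doubleIntegral_cauchyWeight_right (hC : Admissible η A B)
    {b' : ℂ → ℂ} (hb : ContinuousOn b (contour A B))
    (hg₁ : IsDensitySolution η A B b l₁ g₁)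
    (hg₂ : IsDensitySolution η A B b l₂ g₂) (h₁ : l₁ ∈ inside A B) (h₂ : l₂ ∈ inside A B)
    (c d : ℂ) :
    doubleIntegral A B b' cauchyWeight (fun w v => det₂ g₁ g₂ w v *
        (sinh (w - c) * sinh (v - d) / sinh (w - v - η))) =
      weightedIntegral A B b' fun w =>
        g₂ w * (sinh (w - c) * sinh (l₁ - d) / sinh (w - l₁ - η))
        - g₁ w * (sinh (w - c) * sinh (l₂ - d) / sinh (w - l₂ - η)) := by
  have hA := hC.A_pos
  have hB := hC.B_pos
  have hsub := contour_subset_rect A B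
  rw [doubleIntegral_eq]
  refine weightedIntegral_congr hA hB b' fun w hw => ?_
  have hf : DifferentiableOn ℂ (fun v => sinh (w - c) * sinh (v - d) / sinh (w - v - η))
      (rect A B) :=
    DifferentiableOn.div (by fun_prop) (by fun_prop) fun v hv => hC.sinh_sub_ne w (hsub hw) v hv
  have hfc := hf.continuousOn.mono hsub
  have k1 := hg₁.weightedIntegral_cauchyWeight hC hb h₁ hf
  have k2 := hg₂.weightedIntegral_cauchyWeight hC hb h₂ hf
  rw [weightedIntegral_congr hA hB cauchyWeight (g := fun v =>
      g₁ w * (g₂ v * (sinh (w - c) * sinh (v - d) / sinh (w - v - η)))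
      - g₂ w * (g₁ v * (sinh (w - c) * sinh (v - d) / sinh (w - v - η)))),
    weightedIntegral_sub hA hB continuousOn_cauchyWeight
      (continuousOn_const.fun_mul (hg₂.continuousOn.fun_mul hfc))
      (continuousOn_const.fun_mul (hg₁.continuousOn.fun_mul hfc)), weightedIntegral_const_mul,
    weightedIntegral_const_mul, k1, k2]
  · ring
  · intro v _; simp only [det₂]; ring

lemma weightedIntegral_sinh_div_sinh (hC : Admissible η A B) (hb : ContinuousOn b (contour A B))
    (hg : ContinuousOn g (contour A B)) (hμ : μ ∈ inside A B) (c k : ℂ) :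
    weightedIntegral A B b (fun w => g w * (sinh (w - c) * k / sinh (w - μ - η))) =
      k * (cosh (μ + η - c) * weightedIntegral A B b g
        + sinh (μ + η - c) * weightedIntegral A B b (fun w => g w * coth (w - μ - η))) := by
  have hA := hC.A_pos
  have hB := hC.B_pos
  have c2 := hg.fun_mul (hC.continuousOn_coth_sub_inside hμ)
  simp only [← weightedIntegral_const_mul]
  rw [← weightedIntegral_add hA hB hb (continuousOn_const.fun_mul hg) (continuousOn_const.fun_mul c2),
    ← weightedIntegral_const_mul]
  refine weightedIntegral_congr hA hB b fun w hw => ?_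
  have := sinh_add_div_sinh (μ + η - c) (hC.sinh_sub_ne w (contour_subset_rect A B hw) μ
    (inside_subset_rect A B hμ))
  rw [show w - μ - η + (μ + η - c) = w - c by ring] at this
  rw [mul_comm (sinh (w - c)), mul_div_assoc, this]
  ring

/-- The double integral with weight `b` for the first variable, closing the contour of the second
variable. -/
lemma IsDensitySolution.doubleIntegral_sinh_cauchyWeight (hC : Admissible η A B)
    (hb : ContinuousOn b (contour A B)) (hg₁ : IsDensitySolution η A B b l₁ g₁)
    (hg₂ : IsDensitySolution η A B b l₂ g₂) (h₁ : l₁ ∈ inside A B) (h₂ : l₂ ∈ inside A B)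
    (c d : ℂ) :
    doubleIntegral A B b cauchyWeight (fun w v => det₂ g₁ g₂ w v *
        (sinh (w - c) * sinh (v - d) / sinh (w - v - η))) =
      sinh (l₁ - d) * (cosh (l₁ + η - c) * weightedIntegral A B b g₂
        + sinh (l₁ + η - c) * weightedIntegral A B b (fun w => g₂ w * coth (w - l₁ - η)))
      - sinh (l₂ - d) * (cosh (l₂ + η - c) * weightedIntegral A B b g₁
        + sinh (l₂ + η - c) * weightedIntegral A B b (fun w => g₁ w * coth (w - l₂ - η))) := by
  have hA := hC.A_pos
  have hB := hC.B_pos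
  have hr : ∀ {g : ℂ → ℂ} {m : ℂ} (k : ℂ), ContinuousOn g (contour A B) → m ∈ inside A B →
      ContinuousOn (fun w => g w * (sinh (w - c) * k / sinh (w - m - η))) (contour A B) :=
    fun k hg hm => hg.fun_mul (ContinuousOn.div (Continuous.continuousOn (by fun_prop))
      (Continuous.continuousOn (by fun_prop)) fun w hw =>
        hC.sinh_sub_ne w (contour_subset_rect A B hw) _ (inside_subset_rect A B hm))
  rw [hg₁.doubleIntegral_cauchyWeight_right hC hb hg₂ h₁ h₂,
    weightedIntegral_sub hA hB hb (hr _ hg₂.continuousOn h₁) (hr _ hg₁.continuousOn h₂),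
    weightedIntegral_sinh_div_sinh hC hb hg₂.continuousOn h₁,
    weightedIntegral_sinh_div_sinh hC hb hg₁.continuousOn h₂]

/-- Closing both contours. -/
lemma IsDensitySolution.doubleIntegral_cauchyWeight (hC : Admissible η A B)
    (hb : ContinuousOn b (contour A B)) (hg₁ : IsDensitySolution η A B b l₁ g₁)
    (hg₂ : IsDensitySolution η A B b l₂ g₂) (h₁ : l₁ ∈ inside A B) (h₂ : l₂ ∈ inside A B)
    (c d : ℂ) :
    doubleIntegral A B cauchyWeight cauchyWeight (fun w v => det₂ g₁ g₂ w v *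
        (sinh (w - c) * sinh (v - d) / sinh (w - v - η))) =
      sinh (l₁ - c) * sinh (l₂ - d) / sinh (l₁ - l₂ - η)
        - sinh (l₂ - c) * sinh (l₁ - d) / sinh (l₂ - l₁ - η) := by
  have hA := hC.A_pos
  have hB := hC.B_pos
  have hsub := contour_subset_rect A B
  have hf : ∀ {m : ℂ} (k : ℂ), m ∈ inside A B →
      DifferentiableOn ℂ (fun w => sinh (w - c) * k / sinh (w - m - η)) (rect A B) := fun k hm =>
    DifferentiableOn.div (by fun_prop) (by fun_prop) fun w hw =>
      hC.sinh_sub_ne w hw _ (inside_subset_rect A B hm)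
  rw [hg₁.doubleIntegral_cauchyWeight_right hC hb hg₂ h₁ h₂,
    weightedIntegral_sub hA hB continuousOn_cauchyWeight
      (hg₂.continuousOn.fun_mul ((hf (sinh (l₁ - d)) h₁).continuousOn.mono hsub))
      (hg₁.continuousOn.fun_mul ((hf (sinh (l₂ - d)) h₂).continuousOn.mono hsub)),
    hg₁.weightedIntegral_cauchyWeight hC hb h₁ (hf _ h₂),
    hg₂.weightedIntegral_cauchyWeight hC hb h₂ (hf _ h₁)]
  ring

/-- Closing the contour of the first variable, for the special parameters for which no new single
integral appears. -/
lemma IsDensitySolution.doubleIntegral_cauchyWeight_left (hC : Admissible η A B)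
    (hb : ContinuousOn b (contour A B)) (hg₁ : IsDensitySolution η A B b l₁ g₁)
    (hg₂ : IsDensitySolution η A B b l₂ g₂) (h₁ : l₁ ∈ inside A B) (h₂ : l₂ ∈ inside A B) :
    doubleIntegral A B cauchyWeight b (fun w v => det₂ g₁ g₂ w v *
        (sinh (w - l₂) * sinh (v - (l₁ - η)) / sinh (w - v - η))) =
      sinh (l₁ - l₂) * weightedIntegral A B b g₂ := by
  have hA := hC.A_pos
  have hB := hC.B_pos
  have hsub := contour_subset_rect A B
  have hD := continuousOn₂_det₂ hg₁.continuousOn hg₂.continuousOn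
  rw [doubleIntegral_swap hA hB continuousOn_cauchyWeight hb
    (hD.mul (hC.continuousOn₂_div_sinh _ _)), doubleIntegral_eq, ← weightedIntegral_const_mul]
  refine weightedIntegral_congr hA hB b fun v hv => ?_
  have hf : DifferentiableOn ℂ (fun w => sinh (w - l₂) * sinh (v - (l₁ - η)) / sinh (w - v - η))
      (rect A B) :=
    DifferentiableOn.div (by fun_prop) (by fun_prop) fun w hw => hC.sinh_sub_ne w hw v (hsub hv)
  have hfc := hf.continuousOn.mono hsub
  have k1 := hg₁.weightedIntegral_cauchyWeight hC hb h₁ hf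
  have k2 := hg₂.weightedIntegral_cauchyWeight hC hb h₂ hf
  rw [weightedIntegral_congr hA hB cauchyWeight (g := fun w =>
      g₂ v * (g₁ w * (sinh (w - l₂) * sinh (v - (l₁ - η)) / sinh (w - v - η)))
      - g₁ v * (g₂ w * (sinh (w - l₂) * sinh (v - (l₁ - η)) / sinh (w - v - η)))),
    weightedIntegral_sub hA hB continuousOn_cauchyWeight
      (continuousOn_const.fun_mul (hg₁.continuousOn.fun_mul hfc))
      (continuousOn_const.fun_mul (hg₂.continuousOn.fun_mul hfc)), weightedIntegral_const_mul,
    weightedIntegral_const_mul, k1, k2]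
  -- The node `l₂` kills the residue at `w = l₂`; the node `l₁ - η` makes the numerator minus the
  -- denominator at `w = l₁`.
  · have h0 := hC.sinh_sub_ne l₁ (inside_subset_rect A B h₁) v (hsub hv)
    rw [show v - (l₁ - η) = -(l₁ - v - η) by ring, sinh_neg, sub_self, sinh_zero]
    field_simp
    ring
  · intro w _; simp only [det₂]; ring

end Reduction

/-! ### Differentiability of `ψ` and `ω` in the deformation parameter. -/

section Derivative

variable {η : ℂ} {A B : ℝ} {b : ℂ → ℂ} {l₁ l₂ μ : ℂ} {g f g₁ g₂ : ℂ → ℂ}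

lemma continuousOn_doubleContourIntegral (hA : 0 < A) (hB : 0 < B) {S : Set ℂ} (hS : IsCompact S)
    {F : ℂ → ℂ → ℂ → ℂ} (hF : ContinuousOn (fun p : (ℂ × ℂ) × ℂ => F p.1.1 p.1.2 p.2)
      ((contour A B ×ˢ contour A B) ×ˢ S)) :
    ContinuousOn (fun α => contourIntegral A B fun w => contourIntegral A B fun v => F w v α) S := by
  have hcpt := isCompact_contour A B
  refine continuousOn_contourIntegral hA hB hS
    (F := fun w α => contourIntegral A B fun v => F w v α) ?_
  refine continuousOn_contourIntegral hA hB (hcpt.prod hS)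
    (F := fun v (p : ℂ × ℂ) => F p.1 v p.2) ?_
  exact ContinuousOn.comp (f := fun q : ℂ × ℂ × ℂ => ((q.2.1, q.1), q.2.2)) hF
    (Continuous.continuousOn (by fun_prop)) fun q hq => ⟨⟨hq.2.1, hq.1⟩, hq.2.2⟩

lemma ContinuousOn₂.const_mul {F : ℂ → ℂ → ℂ} (hF : ContinuousOn₂ A B F) (k : ℂ) :
    ContinuousOn₂ A B fun w v => k * F w v := continuousOn_const.fun_mul hF

/-- Transfer of the deformation parameter from a solution of the integral equation to the kernel,
by means of the transposed integral equation. -/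
lemma IsDensitySolution.weightedIntegral_transpose (hC : Admissible η A B)
    (hb : ContinuousOn b (contour A B)) (h₁ : l₁ ∈ inside A B) (h₂ : l₂ ∈ inside A B)
    (hg : IsDensitySolution η A B b l₂ g) {α : ℂ} (hf : ContinuousOn f (contour A B))
    (hfeq : ∀ z ∈ contour A B, f z = -coth (z - l₁) + exp (α * η) * coth (z - l₁ - η)
      + contourIntegral A B fun w => b w * f w * kernel η (z - w) α) :
    weightedIntegral A B b
        (fun w => f w * (-coth (w - l₂) + exp (-α * η) * coth (w - l₂ - η))) =
      weightedIntegral A B b (fun w => g w * (-coth (w - l₁) + coth (w - l₁ - η)))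
      + (exp (α * η) - 1) * (weightedIntegral A B b (fun w => g w * coth (w - l₁ - η))
          + doubleIntegral A B b b fun w v => g w * f v * coth (w - v - η))
      + (exp (-α * η) - 1) * (weightedIntegral A B b (fun w => f w * coth (w - l₂ - η))
          - doubleIntegral A B b b fun w v => g w * f v * coth (w - v + η)) := by
  have hA := hC.A_pos
  have hB := hC.B_pos
  have hgc := hg.continuousOn
  have cm := hC.continuousOn₂_coth_sub
  have cp := hC.continuousOn₂_coth_add
  have i1 := hC.continuousOn_coth_inside h₁
  have i2 := hC.continuousOn_coth_inside h₂
  have j1 := hC.continuousOn_coth_sub_inside h₁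
  have j2 := hC.continuousOn_coth_sub_inside h₂
  have cgf : ContinuousOn₂ A B fun w v => g w * f v := hgc.xxz_fst.mul hf.xxz_snd
  have cgm := cgf.mul cm
  have cgp := cgf.mul cp
  have cK : ContinuousOn₂ A B fun w v => g w * f v * kernel η (w - v) 0 :=
    cgf.mul hC.continuousOn₂_kernel
  have int : ∀ {F : ℂ → ℂ → ℂ}, ContinuousOn₂ A B F →
      ContinuousOn (fun w => weightedIntegral A B b (F w)) (contour A B) := fun hF =>
    (hb.xxz_snd.mul hF).integral hA hB
  -- the transposed equation
  have e1 : weightedIntegral A B b (fun w => f w * (-coth (w - l₂) + coth (w - l₂ - η))) =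
      weightedIntegral A B b (fun w => g w * f w)
        - doubleIntegral A B b b fun w v => g w * f v * kernel η (w - v) 0 := by
    rw [doubleIntegral_swap hA hB hb hb cK, doubleIntegral_eq,
      ← weightedIntegral_sub hA hB hb (hgc.fun_mul hf) (int cK.swap)]
    refine weightedIntegral_congr hA hB b fun w hw => ?_
    have := hg.weightedIntegral_kernel hw
    rw [weightedIntegral_congr hA hB b (g := fun v => f w * (g v * kernel η (w - v) 0)),
      weightedIntegral_const_mul, this]
    · ring
    · intro v _; rw [kernel_zero_sub_comm]; ring
  have cKα : ContinuousOn₂ A B fun w v => g w * f v * kernel η (w - v) α := by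
    refine cgf.mul ?_
    exact (continuousOn_const.fun_mul cm).fun_sub (continuousOn_const.fun_mul cp)
  -- The deformed equation for `f`, tested against `b * g`; together with `e1` it eliminates the
  -- integral of `g * f`.
  have e2 : weightedIntegral A B b (fun w => g w * f w) =
      weightedIntegral A B b (fun w => g w * (-coth (w - l₁) + exp (α * η) * coth (w - l₁ - η)))
        + doubleIntegral A B b b fun w v => g w * f v * kernel η (w - v) α := by
    rw [doubleIntegral_eq, ← weightedIntegral_add hA hB hb
      (hgc.fun_mul (i1.fun_neg.fun_add (continuousOn_const.fun_mul j1))) (int cKα)]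
    refine weightedIntegral_congr hA hB b fun w hw => ?_
    rw [hfeq w hw, mul_add]
    congr 1
    simp only [weightedIntegral, ← contourIntegral_const_mul]
    refine contourIntegral_congr hA hB fun v _ => ?_
    ring
  -- Only the difference of the deformed and undeformed kernels survives, and its coefficients `exp
  -- (±α η) - 1` vanish at `α = 0`.
  have e3 : doubleIntegral A B b b (fun w v => g w * f v * kernel η (w - v) α)
      - doubleIntegral A B b b (fun w v => g w * f v * kernel η (w - v) 0) =
      (exp (α * η) - 1) * doubleIntegral A B b b (fun w v => g w * f v * coth (w - v - η))
      - (exp (-α * η) - 1) * doubleIntegral A B b b fun w v => g w * f v * coth (w - v + η) := by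
    rw [← doubleIntegral_sub hA hB hb hb cKα cK, ← doubleIntegral_const_mul,
      ← doubleIntegral_const_mul, ← doubleIntegral_sub hA hB hb hb
        (cgm.const_mul _) (cgp.const_mul _)]
    refine doubleIntegral_congr hA hB b b fun w _ v _ => ?_
    rw [kernel_zero, kernel]; ring
  have e4 : weightedIntegral A B b
      (fun w => g w * (-coth (w - l₁) + exp (α * η) * coth (w - l₁ - η))) =
      weightedIntegral A B b (fun w => g w * (-coth (w - l₁) + coth (w - l₁ - η)))
      + (exp (α * η) - 1) * weightedIntegral A B b (fun w => g w * coth (w - l₁ - η)) := by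
    rw [← weightedIntegral_const_mul, ← weightedIntegral_add hA hB hb
      (hgc.fun_mul (i1.fun_neg.fun_add j1)) (continuousOn_const.fun_mul (hgc.fun_mul j1))]
    refine weightedIntegral_congr hA hB b fun w _ => ?_
    ring
  have e5 : weightedIntegral A B b
      (fun w => f w * (-coth (w - l₂) + exp (-α * η) * coth (w - l₂ - η))) =
      weightedIntegral A B b (fun w => f w * (-coth (w - l₂) + coth (w - l₂ - η)))
      + (exp (-α * η) - 1) * weightedIntegral A B b (fun w => f w * coth (w - l₂ - η)) := by
    rw [← weightedIntegral_const_mul, ← weightedIntegral_add hA hB hb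
      (hf.fun_mul (i2.fun_neg.fun_add j2)) (continuousOn_const.fun_mul (hf.fun_mul j2))]
    refine weightedIntegral_congr hA hB b fun w _ => ?_
    ring
  linear_combination e5 + e1 + e2 + e4 + e3

/-- The double integral with the odd kernel. -/
lemma doubleIntegral_det₂_coth (hC : Admissible η A B) (hb : ContinuousOn b (contour A B))
    (h₁ : ContinuousOn g₁ (contour A B)) (h₂ : ContinuousOn g₂ (contour A B)) :
    doubleIntegral A B b b
        (fun w v => det₂ g₁ g₂ w v * (coth (w - v - η) + coth (w - v + η))) =
      -2 * (doubleIntegral A B b b (fun w v => g₂ w * g₁ v * coth (w - v - η))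
        + doubleIntegral A B b b fun w v => g₂ w * g₁ v * coth (w - v + η)) := by
  have hA := hC.A_pos
  have hB := hC.B_pos
  have cm := hC.continuousOn₂_coth_sub
  have cp := hC.continuousOn₂_coth_add
  have c21 : ContinuousOn₂ A B fun w v => g₂ w * g₁ v := h₂.xxz_fst.mul h₁.xxz_snd
  have c12 : ContinuousOn₂ A B fun w v => g₁ w * g₂ v := h₁.xxz_fst.mul h₂.xxz_snd
  have ck := cm.add cp
  have e1 : doubleIntegral A B b b (fun w v => g₁ w * g₂ v * (coth (w - v - η) + coth (w - v + η)))
      = -1 * doubleIntegral A B b b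
        (fun w v => g₂ w * g₁ v * (coth (w - v - η) + coth (w - v + η))) := by
    rw [doubleIntegral_swap hA hB hb hb (c12.mul ck), ← doubleIntegral_const_mul]
    refine doubleIntegral_congr hA hB b b fun w _ v _ => ?_
    rw [show v - w - η = -(w - v + η) by ring, show v - w + η = -(w - v - η) by ring,
      coth_neg, coth_neg]
    ring
  have e2 : doubleIntegral A B b b (fun w v => g₂ w * g₁ v * (coth (w - v - η) + coth (w - v + η)))
      = doubleIntegral A B b b (fun w v => g₂ w * g₁ v * coth (w - v - η))
        - -1 * doubleIntegral A B b b fun w v => g₂ w * g₁ v * coth (w - v + η) := by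
    rw [← doubleIntegral_const_mul, ← doubleIntegral_sub hA hB hb hb (c21.mul cm)
      ((c21.mul cp).const_mul _)]
    refine doubleIntegral_congr hA hB b b fun w _ v _ => ?_
    ring
  have e3 : doubleIntegral A B b b
        (fun w v => det₂ g₁ g₂ w v * (coth (w - v - η) + coth (w - v + η))) =
      doubleIntegral A B b b (fun w v => g₁ w * g₂ v * (coth (w - v - η) + coth (w - v + η)))
      - doubleIntegral A B b b
        (fun w v => g₂ w * g₁ v * (coth (w - v - η) + coth (w - v + η))) := by
    rw [← doubleIntegral_sub hA hB hb hb (c12.mul ck) (c21.mul ck)]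
    refine doubleIntegral_congr hA hB b b fun w _ v _ => ?_
    simp only [det₂]; ring
  linear_combination e3 + e1 - 2 * e2

/-- The slope of the product is the slope of `E` times `u`, because `E` vanishes at `x`. This
matters because `G` is only known to be continuous in `α`. -/
lemma _root_.HasDerivAt.xxz_mul_continuousAt {E u : ℂ → ℂ} {E' x : ℂ} (hE : HasDerivAt E E' x)
    (h0 : E x = 0) (hu : ContinuousAt u x) : HasDerivAt (fun y => E y * u y) (E' * u x) x := by
  rw [hasDerivAt_iff_tendsto_slope] at hE ⊢
  refine (hE.mul (hu.tendsto.mono_left nhdsWithin_le_nhds)).congr fun y => ?_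
  simp only [slope_def_field, h0, zero_mul, sub_zero]
  ring

/-- The weight `1 / (2 π i (1 + 𝔞))`. -/
def weight (a : ℂ → ℂ) (w : ℂ) : ℂ := 1 / (2 * Real.pi * I * (1 + a w))

variable {a : ℂ → ℂ} {G : ℂ → ℂ → ℂ → ℂ}

lemma psi_eq (μ₁ μ₂ α : ℂ) : psi η A B a G μ₁ μ₂ α =
    2 * weightedIntegral A B (weight a) (fun w =>
      G w μ₁ α * (-coth (w - μ₂) + exp (-α * η) * coth (w - μ₂ - η))) := by
  simp only [psi, weightedIntegral, ← contourIntegral_const_mul, weight]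
  congr 1; funext w; simp only [div_eq_mul_inv, mul_inv]; ring

lemma phi_eq (μ α : ℂ) : phi A B a G μ α =
    1 + 2 * weightedIntegral A B (weight a) (fun w => G w μ α) := by
  simp only [phi, weightedIntegral, ← contourIntegral_const_mul, weight]
  congr 2; funext w; simp only [div_eq_mul_inv, mul_inv]; ring

/-- For the functions at `α = 0`. -/
lemma IsDensityFunction.isDensitySolution (hG : IsDensityFunction η A B a G)
    (hμ : μ ∈ inside A B) : IsDensitySolution η A B (weight a) μ (fun w => G w μ 0) := by
  obtain ⟨r, hr, hc, he⟩ := hG μ hμ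
  have h0 := Metric.mem_ball_self (x := (0 : ℂ)) hr
  refine ⟨hc.comp (f := fun w => (w, (0 : ℂ))) (continuousOn_id.prodMk continuousOn_const)
    fun w hw => ⟨hw, h0⟩, fun z hz => ?_⟩
  rw [he 0 h0 z hz]
  simp only [zero_mul, exp_zero, one_mul, weight, one_div_mul_eq_div]

/-- Continuity of parametric contour integrals is used over compact parameter sets; half of the
smaller radius gives a closed disc inside both open ones. -/
lemma IsDensityFunction.exists_ball (hG : IsDensityFunction η A B a G)
    (h₁ : l₁ ∈ inside A B) (h₂ : l₂ ∈ inside A B) : ∃ r > 0,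
      ContinuousOn (fun p : ℂ × ℂ => G p.1 l₁ p.2) (contour A B ×ˢ Metric.closedBall 0 r) ∧
      ContinuousOn (fun p : ℂ × ℂ => G p.1 l₂ p.2) (contour A B ×ˢ Metric.closedBall 0 r) ∧
      ∀ α ∈ Metric.closedBall (0 : ℂ) r, ∀ z ∈ contour A B,
        G z l₁ α = -coth (z - l₁) + exp (α * η) * coth (z - l₁ - η)
        + contourIntegral A B fun w => weight a w * G w l₁ α * kernel η (z - w) α := by
  obtain ⟨r, hr, hc, he⟩ := hG l₁ h₁
  obtain ⟨r', hr', hc', -⟩ := hG l₂ h₂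
  have hs : Metric.closedBall (0 : ℂ) (min r r' / 2) ⊆ Metric.ball 0 (min r r') :=
    Metric.closedBall_subset_ball (half_lt_self (lt_min hr hr'))
  have s1 := hs.trans (Metric.ball_subset_ball (min_le_left r r'))
  have s2 := hs.trans (Metric.ball_subset_ball (min_le_right r r'))
  refine ⟨min r r' / 2, half_pos (lt_min hr hr'), hc.mono (Set.prod_mono_right s1),
    hc'.mono (Set.prod_mono_right s2), fun α hα z hz => ?_⟩
  rw [he α (s1 hα) z hz]
  simp only [weight, one_div_mul_eq_div]

/-- The function `ψ` is differentiable in `α` at `0`. -/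
lemma IsDensityFunction.hasDerivAt_psi (hC : Admissible η A B)
    (hb : ContinuousOn (weight a) (contour A B)) (hG : IsDensityFunction η A B a G)
    (h₁ : l₁ ∈ inside A B) (h₂ : l₂ ∈ inside A B) :
    HasDerivAt (fun α => psi η A B a G l₁ l₂ α)
      (η * (2 * (weightedIntegral A B (weight a) (fun w => G w l₂ 0 * coth (w - l₁ - η))
          - weightedIntegral A B (weight a) (fun w => G w l₁ 0 * coth (w - l₂ - η)))
        - doubleIntegral A B (weight a) (weight a) (fun w v =>
            det₂ (fun w => G w l₁ 0) (fun w => G w l₂ 0) w v *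
              (coth (w - v - η) + coth (w - v + η))))) 0 := by
  have hA := hC.A_pos
  have hB := hC.B_pos
  have hsub := contour_subset_rect A B
  obtain ⟨r, hr, hc, -, he⟩ := hG.exists_ball h₁ h₂
  have hg₁ := hG.isDensitySolution h₁
  have hg₂ := hG.isDensitySolution h₂
  have hK := isCompact_closedBall (0 : ℂ) r
  have hnhds : Metric.closedBall (0 : ℂ) r ∈ 𝓝 0 := Metric.closedBall_mem_nhds 0 hr
  set u : ℂ → ℂ := fun α =>
    weightedIntegral A B (weight a) (fun w => G w l₁ α * coth (w - l₂ - η))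
      - doubleIntegral A B (weight a) (weight a) (fun w v => G w l₂ 0 * G v l₁ α * coth (w - v + η))
    with hu
  set v : ℂ → ℂ := fun α =>
    weightedIntegral A B (weight a) (fun w => G w l₂ 0 * coth (w - l₁ - η))
      + doubleIntegral A B (weight a) (weight a) (fun w v => G w l₂ 0 * G v l₁ α * coth (w - v - η))
    with hv
  have cd : ∀ {k : ℂ → ℂ → ℂ}, ContinuousOn₂ A B k → ContinuousAt (fun α =>
      doubleIntegral A B (weight a) (weight a)
        (fun w v => G w l₂ 0 * G v l₁ α * k w v)) 0 := by
    intro k hk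
    refine ContinuousOn.continuousAt (s := Metric.closedBall 0 r) ?_ hnhds
    refine continuousOn_doubleContourIntegral hA hB hK
      (F := fun w v α => weight a w * weight a v * (G w l₂ 0 * G v l₁ α * k w v)) ?_
    have m1 : Set.MapsTo (fun p : (ℂ × ℂ) × ℂ => p.1)
      ((contour A B ×ˢ contour A B) ×ˢ Metric.closedBall 0 r) (contour A B ×ˢ contour A B) :=
      fun p hp => hp.1
    have c1 := ContinuousOn.comp (f := fun p : (ℂ × ℂ) × ℂ => p.1) (hb.xxz_fst.mul hb.xxz_snd)
      continuousOn_fst m1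
    have c2 := ContinuousOn.comp (f := fun p : (ℂ × ℂ) × ℂ => p.1) hg₂.continuousOn.xxz_fst
      continuousOn_fst m1
    have c3 := ContinuousOn.comp (f := fun p : (ℂ × ℂ) × ℂ => p.1) hk continuousOn_fst m1
    have c4 := ContinuousOn.comp (f := fun p : (ℂ × ℂ) × ℂ => (p.1.2, p.2))
      (s := (contour A B ×ˢ contour A B) ×ˢ Metric.closedBall 0 r) hc
      (Continuous.continuousOn (by fun_prop)) fun p hp => ⟨hp.1.2, hp.2⟩
    exact c1.mul ((c2.mul c4).mul c3)
  have cu : ContinuousAt u 0 := by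
    refine ContinuousAt.sub ?_ (cd hC.continuousOn₂_coth_add)
    refine ContinuousOn.continuousAt (s := Metric.closedBall 0 r) ?_ hnhds
    refine continuousOn_contourIntegral hA hB hK
      (F := fun w α => weight a w * (G w l₁ α * coth (w - l₂ - η))) ?_
    have c1 : ∀ {f : ℂ → ℂ}, ContinuousOn f (contour A B) →
        ContinuousOn (fun p : ℂ × ℂ => f p.1) (contour A B ×ˢ Metric.closedBall 0 r) := fun hf =>
      hf.comp continuousOn_fst fun p hp => hp.1
    exact (c1 hb).mul (hc.mul (c1 (hC.continuousOn_coth_sub_inside h₂)))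
  have cv : ContinuousAt v 0 := continuousAt_const.add (cd hC.continuousOn₂_coth_sub)
  have d1 : HasDerivAt (fun α : ℂ => exp (α * η) - 1) η 0 := by
    simpa using (((hasDerivAt_id (0 : ℂ)).mul_const η).cexp).sub_const 1
  have d2 : HasDerivAt (fun α : ℂ => exp (-α * η) - 1) (-η) 0 := by
    simpa using (((hasDerivAt_id (0 : ℂ)).neg.mul_const η).cexp).sub_const 1
  -- By the transposed equation, near `0` the function `ψ` is a constant plus `2 * ((exp (α η) - 1)
  -- * v α + (exp (-α η) - 1) * u α)`.
  have D := (((d1.xxz_mul_continuousAt (by simp) cv).add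
    (d2.xxz_mul_continuousAt (by simp) cu)).const_mul 2).const_add
      (2 * weightedIntegral A B (weight a)
        (fun w => G w l₂ 0 * (-coth (w - l₁) + coth (w - l₁ - η))))
  refine (D.congr_of_eventuallyEq ?_).congr_deriv ?_
  · filter_upwards [hnhds] with α hα
    rw [psi_eq, hg₂.weightedIntegral_transpose hC hb h₁ h₂ (α := α) (f := fun w => G w l₁ α)
      (hc.comp (f := fun w => (w, α)) (continuousOn_id.prodMk continuousOn_const)
        fun w hw => ⟨hw, hα⟩) (he α hα)]
    simp only [hu, hv, Pi.add_apply]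
    ring
  · rw [doubleIntegral_det₂_coth hC hb hg₁.continuousOn hg₂.continuousOn]
    simp only [hu, hv]
    ring

/-- The exponential prefactors of `ω` cancel, and `cosh (α η / 2) ^ 2` is stationary at `0`, so
beyond `ψ'` only the explicit `α` in `K` contributes. -/
lemma hasDerivAt_exp_mul_omega {ψ' : ℂ}
    (hψ : HasDerivAt (fun α => psi η A B a G l₁ l₂ α) ψ' 0) :
    HasDerivAt (fun α => exp (α * (l₂ - l₁)) * omega η A B a G l₁ l₂ α)
      (-ψ' + η / 2 * (coth (l₁ - l₂ - η) + coth (l₁ - l₂ + η))) 0 := by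
  have d1 : HasDerivAt (fun α : ℂ => kernel η (l₁ - l₂) (-α))
      (-η * coth (l₁ - l₂ - η) - η * coth (l₁ - l₂ + η)) 0 := by
    have k1 : HasDerivAt (fun α : ℂ => exp (-α * η)) (-η) 0 := by
      simpa using ((hasDerivAt_id (0 : ℂ)).neg.mul_const η).cexp
    have k2 : HasDerivAt (fun α : ℂ => exp (- -α * η)) η 0 := by
      simpa using ((hasDerivAt_id (0 : ℂ)).mul_const η).cexp
    exact (k1.mul_const _).sub (k2.mul_const _)
  have d2 : HasDerivAt (fun α : ℂ => 2 * cosh (α * η / 2) ^ 2) 0 0 := by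
    simpa using (((((hasDerivAt_id (0 : ℂ)).mul_const η).div_const 2).ccosh).pow 2).const_mul 2
  have D := hψ.neg.sub (d1.div d2 (by simp))
  refine (D.congr_of_eventuallyEq ?_).congr_deriv ?_
  · refine Eventually.of_forall fun α => ?_
    have : exp (α * (l₂ - l₁)) * exp (α * (l₁ - l₂)) = 1 := by
      rw [← exp_add, ← exp_zero]; ring_nf
    simp only [omega, Pi.neg_apply, Pi.sub_apply, Pi.div_apply]
    linear_combination (-psi η A B a G l₁ l₂ α
      - kernel η (l₁ - l₂) (-α) / (2 * cosh (α * η / 2) ^ 2)) * this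
  · simp
    ring

end Derivative

/-! ### Matrix elements as double integrals, and their continuity in `α`. -/

section Elements

variable {η : ℂ} {A B : ℝ} {l₁ l₂ : ℂ} {a : ℂ → ℂ} {G : ℂ → ℂ → ℂ → ℂ}

/-- The weight of an integration variable, `s` being true for the variables that belong to plus
signs. -/
def spinWeight (a : ℂ → ℂ) (s : Bool) (w : ℂ) : ℂ :=
  if s then weight a w else cauchyWeight w - weight a w

/-- The zero of the numerator that belongs to an integration variable with position `x`. -/
def node (η l₁ l₂ : ℂ) (s : Bool) (x : Fin 2) : ℂ :=
  if x = 0 then l₂ else if s then l₁ + η else l₁ - η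

/-- The twist factor that belongs to an integration variable. -/
def twist (η α : ℂ) (s : Bool) : ℂ := if s then exp (-α * η) else exp (α * η)

/-- Splits the weight with `1 / 𝔞` into a constant, for which the contour can be closed, and the
weight with `𝔞`. -/
lemma one_div_one_add_inv {z : ℂ} (h0 : z ≠ 0) (h1 : 1 + z ≠ 0) :
    1 / (2 * Real.pi * I * (1 + z⁻¹)) = 1 / (2 * Real.pi * I) - 1 / (2 * Real.pi * I * (1 + z)) := by
  have : (Real.pi : ℂ) ≠ 0 := by exact_mod_cast Real.pi_ne_zero
  have h2 : z + 1 ≠ 0 := by rwa [add_comm]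
  have h3 : 1 + z⁻¹ = (1 + z) / z := by field_simp; ring
  rw [h3]
  field_simp [I_ne_zero]
  ring

/-- The double integral that represents a matrix element for two sites. -/
lemma densityElement_two (hA : 0 < A) (hB : 0 < B)
    (ha : ∀ w ∈ contour A B, a w ≠ 0 ∧ 1 + a w ≠ 0)
    {up low : Fin 2 → Fin 2} {x y : Fin 2} (hp : positions up low = [x, y]) (α : ℂ) :
    densityElement η A B a G ![l₁, l₂] α up low =
      twist η α (decide (0 < numPlus low)) * twist η α (decide (1 < numPlus low)) / sinh (l₂ - l₁) *
      doubleIntegral A B (spinWeight a (decide (0 < numPlus low)))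
        (spinWeight a (decide (1 < numPlus low))) fun w v =>
          det₂ (fun w => G w l₁ α) (fun w => G w l₂ α) w v *
            (sinh (w - node η l₁ l₂ (decide (0 < numPlus low)) x) *
              sinh (v - node η l₁ l₂ (decide (1 < numPlus low)) y) / sinh (w - v - η)) := by
  -- With two sites one of the two products is empty and the other has one factor, so each variable
  -- contributes a single `sinh` vanishing at its node.
  have key : ∀ (s : Bool) (x : Fin 2) (w : ℂ), w ∈ contour A B →
      (if s then
        exp (-α * η) / (2 * Real.pi * I * (1 + a w))
          * (∏ k with k < x, sinh (w - ![l₁, l₂] k - η)) * ∏ k with x < k, sinh (w - ![l₁, l₂] k)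
      else
        exp (α * η) / (2 * Real.pi * I * (1 + (a w)⁻¹))
          * (∏ k with k < x, sinh (w - ![l₁, l₂] k + η)) * ∏ k with x < k, sinh (w - ![l₁, l₂] k)) =
      twist η α s * spinWeight a s w * sinh (w - node η l₁ l₂ s x) := by
    intro s x w hw
    have h2 : (Finset.univ.filter fun k : Fin 2 => 0 < k) = {1} := by decide
    have h4 : (Finset.univ.filter fun k : Fin 2 => 1 < k) = ∅ := by decide
    have e1 : exp (α * η) / (2 * Real.pi * I * (1 + (a w)⁻¹)) =
        exp (α * η) * (cauchyWeight w - weight a w) := by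
      rw [cauchyWeight, weight, ← one_div_one_add_inv (ha w hw).1 (ha w hw).2, mul_one_div]
    have e2 : exp (-α * η) / (2 * Real.pi * I * (1 + a w)) = exp (-α * η) * weight a w := by
      rw [weight, mul_one_div]
    rw [e1, e2]
    fin_cases x <;> cases s <;>
      simp [node, twist, spinWeight, h2, h4, Finset.filter_eq', sub_sub, sub_add]
  rw [densityElement, dif_pos (by rw [hp]; rfl), doubleIntegral, ← contourIntegral_const_mul]
  refine contourIntegral_congr hA hB fun w hw => ?_
  rw [← contourIntegral_const_mul]
  refine contourIntegral_congr hA hB fun v hv => ?_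
  have k1 := key (decide (0 < numPlus low)) x w hw
  have k2 := key (decide (1 < numPlus low)) y v hv
  simp only [decide_eq_true_eq] at k1 k2
  have h2 : (Finset.univ.filter fun k : Fin 2 => 0 < k) = {1} := by decide
  have h4 : (Finset.univ.filter fun k : Fin 2 => 1 < k) = ∅ := by decide
  simp only [iteratedIntegral, Fin.prod_univ_two, hp, Fin.val_zero, Fin.val_one,
    List.getElem_cons_zero, List.getElem_cons_succ, Fin.cons_zero, Fin.cons_one, Matrix.det_fin_two,
    Matrix.of_apply, h2, h4, Finset.prod_singleton, Finset.prod_empty, mul_one, k1, k2,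
    Matrix.cons_val_zero, Matrix.cons_val_one]
  simp only [det₂]
  ring

/-- The matrix elements depend continuously on `α` at `α = 0`. -/
lemma continuousAt_densityElement (hC : Admissible η A B)
    (ha : ∀ w ∈ contour A B, a w ≠ 0 ∧ 1 + a w ≠ 0)
    (hb : ContinuousOn (weight a) (contour A B)) (hG : IsDensityFunction η A B a G)
    (h₁ : l₁ ∈ inside A B) (h₂ : l₂ ∈ inside A B) (up low : Fin 2 → Fin 2) :
    ContinuousAt (fun α => densityElement η A B a G ![l₁, l₂] α up low) 0 := by
  have hA := hC.A_pos
  have hB := hC.B_pos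
  by_cases hn : (positions up low).length = 2
  swap
  · simp only [densityElement, dif_neg hn]
    exact continuousAt_const
  obtain ⟨x, y, hp⟩ := List.length_eq_two.1 hn
  simp only [densityElement_two hA hB ha hp]
  generalize decide (0 < numPlus low) = s
  generalize decide (1 < numPlus low) = t
  have ct : ∀ s : Bool, Continuous fun α => twist η α s := by
    intro s; cases s <;> simp [twist] <;> fun_prop
  have cs : ∀ s : Bool, ContinuousOn (spinWeight a s) (contour A B) := by
    intro s
    cases s
    · exact continuousOn_cauchyWeight.fun_sub hb
    · exact hb
  refine ContinuousAt.mul (((ct s).mul (ct t)).div_const _).continuousAt ?_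
  obtain ⟨r, hr, c1, c2, -⟩ := hG.exists_ball h₁ h₂
  refine ContinuousOn.continuousAt (s := Metric.closedBall 0 r) ?_ (Metric.closedBall_mem_nhds 0 hr)
  refine continuousOn_doubleContourIntegral hA hB (isCompact_closedBall (0 : ℂ) r)
    (F := fun w v α => spinWeight a s w * spinWeight a t v *
      (det₂ (fun w => G w l₁ α) (fun w => G w l₂ α) w v *
        (sinh (w - node η l₁ l₂ s x) * sinh (v - node η l₁ l₂ t y) / sinh (w - v - η)))) ?_
  have m1 : Set.MapsTo (fun p : (ℂ × ℂ) × ℂ => p.1)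
    ((contour A B ×ˢ contour A B) ×ˢ Metric.closedBall 0 r) (contour A B ×ˢ contour A B) :=
    fun p hp => hp.1
  have k1 := ContinuousOn.comp (f := fun p : (ℂ × ℂ) × ℂ => p.1) ((cs s).xxz_fst.mul (cs t).xxz_snd)
    continuousOn_fst m1
  have k2 := ContinuousOn.comp (f := fun p : (ℂ × ℂ) × ℂ => p.1)
    (hC.continuousOn₂_div_sinh (node η l₁ l₂ s x) (node η l₁ l₂ t y)) continuousOn_fst m1
  have k3 : ∀ {g : ℂ → ℂ → ℂ},
      ContinuousOn (fun p : ℂ × ℂ => g p.1 p.2) (contour A B ×ˢ Metric.closedBall 0 r) →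
      ContinuousOn (fun p : (ℂ × ℂ) × ℂ => g p.1.1 p.2)
        ((contour A B ×ˢ contour A B) ×ˢ Metric.closedBall 0 r) := fun hg =>
    ContinuousOn.comp (f := fun p : (ℂ × ℂ) × ℂ => (p.1.1, p.2)) hg
      (Continuous.continuousOn (by fun_prop)) fun p hp => ⟨hp.1.1, hp.2⟩
  have k4 : ∀ {g : ℂ → ℂ → ℂ},
      ContinuousOn (fun p : ℂ × ℂ => g p.1 p.2) (contour A B ×ˢ Metric.closedBall 0 r) →
      ContinuousOn (fun p : (ℂ × ℂ) × ℂ => g p.1.2 p.2)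
        ((contour A B ×ˢ contour A B) ×ˢ Metric.closedBall 0 r) := fun hg =>
    ContinuousOn.comp (f := fun p : (ℂ × ℂ) × ℂ => (p.1.2, p.2)) hg
      (Continuous.continuousOn (by fun_prop)) fun p hp => ⟨hp.1.2, hp.2⟩
  exact k1.mul ((((k3 (g := fun w α => G w l₁ α) c1).mul (k4 (g := fun w α => G w l₂ α) c2)).sub
    ((k3 (g := fun w α => G w l₂ α) c2).mul (k4 (g := fun w α => G w l₁ α) c1))).mul k2)

lemma IsAuxiliaryFunction.ne_zero {J T h : ℝ} (ha : IsAuxiliaryFunction J T h η A B a) :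
    ∀ w ∈ contour A B, a w ≠ 0 ∧ 1 + a w ≠ 0 := by
  obtain ⟨L, -, hL, hz⟩ := ha
  refine fun w hw => ⟨?_, ?_⟩
  · rw [hz w hw]; exact exp_ne_zero _
  · rw [← hL w hw]; exact exp_ne_zero _

lemma IsAuxiliaryFunction.continuousOn_weight {J T h : ℝ}
    (ha : IsAuxiliaryFunction J T h η A B a) : ContinuousOn (weight a) (contour A B) := by
  have h0 := ha.ne_zero
  obtain ⟨L, hc, hL, -⟩ := ha
  have hπ : (Real.pi : ℂ) ≠ 0 := by exact_mod_cast Real.pi_ne_zero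
  have h1 : ContinuousOn (fun w => 1 + a w) (contour A B) :=
    (hc.cexp).congr fun w hw => (hL w hw).symm
  exact continuousOn_const.div (continuousOn_const.mul h1) fun w hw =>
    mul_ne_zero (mul_ne_zero (mul_ne_zero two_ne_zero hπ) I_ne_zero) (h0 w hw).2

/-- The one-point function. -/
lemma two_mul_onePoint (μ : ℂ) : 2 * onePoint η A B a G μ = 1 - phi A B a G μ 0 := by
  have hp : positions ![(0 : Fin 2)] ![0] = [0] := by decide
  have hn : numPlus ![(0 : Fin 2)] = 1 := by decide
  rw [phi_eq, onePoint, densityElement, dif_pos (by rw [hp]; rfl)]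
  simp only [iteratedIntegral, hp, hn, weightedIntegral, weight]
  simp [contourIntegral_neg, Finset.filter_singleton]

end Elements

/-! ### Rational identities behind the two-point elements. -/

section TwoPoint

variable {η : ℂ} {A B : ℝ} {l₁ l₂ : ℂ} {a : ℂ → ℂ} {G : ℂ → ℂ → ℂ → ℂ}

/-- The double integral with both weights equal to `1 / (2 π i (1 + 𝔞))`, in terms of single
integrals. -/
def reducedSame (η l₁ l₂ c d m₁ m₂ q₁ q₂ ψ ψ' : ℂ) : ℂ :=
  1 / 4 * (1 / sinh η *
      ((cosh (2 * l₂ - (c + d)) - cosh (2 * l₂ + 2 * η - (c + d))) * m₁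
        + sinh (2 * l₂ - (c + d)) * (q₁ - ψ / 2) - sinh (2 * l₂ + 2 * η - (c + d)) * q₁
        - ((cosh (2 * l₁ - (c + d)) - cosh (2 * l₁ + 2 * η - (c + d))) * m₂
        + sinh (2 * l₁ - (c + d)) * (q₂ - ψ / 2) - sinh (2 * l₁ + 2 * η - (c + d)) * q₂))
      - cosh (η - c + d) * (2 * (q₂ - q₁) - ψ' / η))

/-- The double integral with weights `1 / (2 π i (1 + 𝔞))` and `1 / (2 π i)`, in terms of single
integrals. -/
def reducedMixed (η l₁ l₂ c d m₁ m₂ q₁ q₂ : ℂ) : ℂ :=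
  sinh (l₁ - d) * (cosh (l₁ + η - c) * m₂ + sinh (l₁ + η - c) * q₂)
    - sinh (l₂ - d) * (cosh (l₂ + η - c) * m₁ + sinh (l₂ + η - c) * q₁)

section Algebra

variable (m₁ m₂ q₁ q₂ ψ ψ' : ℂ)

lemma sinh_eq_of_exp (z : ℂ) : sinh z = (exp z ^ 2 - 1) / (2 * exp z) := by
  have := exp_ne_zero z
  rw [sinh, exp_neg]; field_simp

lemma sinh_sub_eq_of_exp (z w : ℂ) :
    sinh (z - w) = (exp z ^ 2 - exp w ^ 2) / (2 * exp z * exp w) := by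
  have := exp_ne_zero z
  have := exp_ne_zero w
  rw [sinh, exp_neg, exp_sub]; field_simp

/-- In this and the next five lemmas, `m_j` stands for the integral in `φ_j = 1 + 2 m_j`, and the
auxiliary integrals `q₁`, `q₂` drop out. In terms of the exponentials of `l₁`, `l₂`, `η` each claim
is a rational identity, linear in `m_j`, `q_j`, `ψ`, `ψ'`. The factor `sinh (l₂ - l₁)` is the
denominator in the matrix element. -/
lemma reduced_plus_plus (hη : η ≠ 0) (hs : sinh η ≠ 0) (hl : sinh (l₁ - l₂) ≠ 0) :
    reducedSame η l₁ l₂ (l₁ + η) (l₂) m₁ m₂ q₁ q₂ ψ ψ' =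
      sinh (l₂ - l₁) * (1 / 2 - 1 / 4 * ((1 + 2 * m₁) + (1 + 2 * m₂)) - coth η / 4 * ψ
        - coth (l₁ - l₂) / (4 * η) * ψ') := by
  simp only [reducedSame, coth]
  rw [sinh_eq_of_exp] at hs
  rw [sinh_sub_eq_of_exp] at hl
  have hs' := (div_ne_zero_iff.1 hs).1
  have hl' := (div_ne_zero_iff.1 hl).1
  rw [sinh_eq_of_exp η, sinh_sub_eq_of_exp l₁ l₂, sinh_sub_eq_of_exp l₂ l₁]
  simp only [sinh, cosh, exp_neg, exp_sub, exp_add, two_mul]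
  have hx := exp_ne_zero l₁
  have hy := exp_ne_zero l₂
  have hq := exp_ne_zero η
  generalize exp l₁ = x at *
  generalize exp l₂ = y at *
  generalize exp η = q at *
  field_simp
  ring

/-- Both weights are differences, hence four terms on the left: both contours closed, the first
closed, the second closed, none closed. -/
lemma reduced_minus_minus (hη : η ≠ 0) (hs : sinh η ≠ 0) (hl : sinh (l₁ - l₂) ≠ 0) :
    -sinh (l₁ - l₂) - sinh (l₁ - l₂) * m₂ - (reducedMixed η l₁ l₂ (l₂) (l₁ - η) m₁ m₂ q₁ q₂
      - reducedSame η l₁ l₂ (l₂) (l₁ - η) m₁ m₂ q₁ q₂ ψ ψ') =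
      sinh (l₂ - l₁) * (1 / 2 + 1 / 4 * ((1 + 2 * m₁) + (1 + 2 * m₂))
        - (coth η / 4 * ψ + coth (l₁ - l₂) / (4 * η) * ψ')) := by
  simp only [reducedSame, reducedMixed, coth]
  rw [sinh_eq_of_exp] at hs
  rw [sinh_sub_eq_of_exp] at hl
  have hs' := (div_ne_zero_iff.1 hs).1
  have hl' := (div_ne_zero_iff.1 hl).1
  rw [sinh_eq_of_exp η, sinh_sub_eq_of_exp l₁ l₂, sinh_sub_eq_of_exp l₂ l₁]
  simp only [sinh, cosh, exp_neg, exp_sub, exp_add, two_mul]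
  have hx := exp_ne_zero l₁
  have hy := exp_ne_zero l₂
  have hq := exp_ne_zero η
  generalize exp l₁ = x at *
  generalize exp l₂ = y at *
  generalize exp η = q at *
  field_simp
  ring

lemma reduced_plus_minus (hη : η ≠ 0) (hs : sinh η ≠ 0) (hl : sinh (l₁ - l₂) ≠ 0) :
    reducedMixed η l₁ l₂ (l₂) (l₁ - η) m₁ m₂ q₁ q₂
      - reducedSame η l₁ l₂ (l₂) (l₁ - η) m₁ m₂ q₁ q₂ ψ ψ' =
      sinh (l₂ - l₁) * ((coth η / 4 * ψ + coth (l₁ - l₂) / (4 * η) * ψ')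
        - (1 + 2 * m₁) / 4 + (1 + 2 * m₂) / 4) := by
  simp only [reducedSame, reducedMixed, coth]
  rw [sinh_eq_of_exp] at hs
  rw [sinh_sub_eq_of_exp] at hl
  have hs' := (div_ne_zero_iff.1 hs).1
  have hl' := (div_ne_zero_iff.1 hl).1
  rw [sinh_eq_of_exp η, sinh_sub_eq_of_exp l₁ l₂, sinh_sub_eq_of_exp l₂ l₁]
  simp only [sinh, cosh, exp_neg, exp_sub, exp_add, two_mul]
  have hx := exp_ne_zero l₁
  have hy := exp_ne_zero l₂
  have hq := exp_ne_zero η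
  generalize exp l₁ = x at *
  generalize exp l₂ = y at *
  generalize exp η = q at *
  field_simp
  ring

lemma reduced_minus_plus (hη : η ≠ 0) (hs : sinh η ≠ 0) (hl : sinh (l₁ - l₂) ≠ 0) :
    reducedMixed η l₁ l₂ (l₁ + η) (l₂) m₁ m₂ q₁ q₂
      - reducedSame η l₁ l₂ (l₁ + η) (l₂) m₁ m₂ q₁ q₂ ψ ψ' =
      sinh (l₂ - l₁) * ((coth η / 4 * ψ + coth (l₁ - l₂) / (4 * η) * ψ')
        + (1 + 2 * m₁) / 4 - (1 + 2 * m₂) / 4) := by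
  simp only [reducedSame, reducedMixed, coth]
  rw [sinh_eq_of_exp] at hs
  rw [sinh_sub_eq_of_exp] at hl
  have hs' := (div_ne_zero_iff.1 hs).1
  have hl' := (div_ne_zero_iff.1 hl).1
  rw [sinh_eq_of_exp η, sinh_sub_eq_of_exp l₁ l₂, sinh_sub_eq_of_exp l₂ l₁]
  simp only [sinh, cosh, exp_neg, exp_sub, exp_add, two_mul]
  have hx := exp_ne_zero l₁
  have hy := exp_ne_zero l₂
  have hq := exp_ne_zero η
  generalize exp l₁ = x at *
  generalize exp l₂ = y at *
  generalize exp η = q at *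
  field_simp
  ring

lemma reduced_exchange_left (hη : η ≠ 0) (hs : sinh η ≠ 0) (hl : sinh (l₁ - l₂) ≠ 0) :
    reducedMixed η l₁ l₂ (l₁ + η) (l₁ - η) m₁ m₂ q₁ q₂
      - reducedSame η l₁ l₂ (l₁ + η) (l₁ - η) m₁ m₂ q₁ q₂ ψ ψ' =
      sinh (l₂ - l₁) * ((cosh (l₁ - l₂) / sinh η / 4 * ψ + cosh η / (4 * η * sinh (l₁ - l₂)) * ψ')
        + sinh η * ((1 + 2 * m₁) - (1 + 2 * m₂)) / (4 * sinh (l₁ - l₂))) := by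
  simp only [reducedSame, reducedMixed]
  rw [sinh_eq_of_exp] at hs
  rw [sinh_sub_eq_of_exp] at hl
  have hs' := (div_ne_zero_iff.1 hs).1
  have hl' := (div_ne_zero_iff.1 hl).1
  rw [sinh_eq_of_exp η, sinh_sub_eq_of_exp l₁ l₂, sinh_sub_eq_of_exp l₂ l₁]
  simp only [sinh, cosh, exp_neg, exp_sub, exp_add, two_mul]
  have hx := exp_ne_zero l₁
  have hy := exp_ne_zero l₂
  have hq := exp_ne_zero η
  generalize exp l₁ = x at *
  generalize exp l₂ = y at *
  generalize exp η = q at *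
  field_simp
  ring

lemma reduced_exchange_right (hη : η ≠ 0) (hs : sinh η ≠ 0) (hl : sinh (l₁ - l₂) ≠ 0) :
    reducedMixed η l₁ l₂ (l₂) (l₂) m₁ m₂ q₁ q₂
      - reducedSame η l₁ l₂ (l₂) (l₂) m₁ m₂ q₁ q₂ ψ ψ' =
      sinh (l₂ - l₁) * ((cosh (l₁ - l₂) / sinh η / 4 * ψ + cosh η / (4 * η * sinh (l₁ - l₂)) * ψ')
        - sinh η * ((1 + 2 * m₁) - (1 + 2 * m₂)) / (4 * sinh (l₁ - l₂))) := by
  simp only [reducedSame, reducedMixed]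
  rw [sinh_eq_of_exp] at hs
  rw [sinh_sub_eq_of_exp] at hl
  have hs' := (div_ne_zero_iff.1 hs).1
  have hl' := (div_ne_zero_iff.1 hl).1
  rw [sinh_eq_of_exp η, sinh_sub_eq_of_exp l₁ l₂, sinh_sub_eq_of_exp l₂ l₁]
  simp only [sinh, cosh, exp_neg, exp_sub, exp_add, two_mul]
  have hx := exp_ne_zero l₁
  have hy := exp_ne_zero l₂
  have hq := exp_ne_zero η
  generalize exp l₁ = x at *
  generalize exp l₂ = y at *
  generalize exp η = q at *
  field_simp
  ring

end Algebra

end TwoPoint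

/-! ### Values of the two-point matrix elements at `α = 0`. -/

section TwoPointValues

variable {η : ℂ} {A B : ℝ} {l₁ l₂ : ℂ} {a : ℂ → ℂ} {G : ℂ → ℂ → ℂ → ℂ}

/-- The derivative of `ψ` replaces the double integral with the odd kernel, and `ψ` itself the
integrals with a pole at `l₁` or `l₂`; only those with a pole shifted by `η` remain. -/
lemma doubleIntegral_eq_reducedSame (hC : Admissible η A B)
    (hb : ContinuousOn (weight a) (contour A B)) (hG : IsDensityFunction η A B a G)
    (h₁ : l₁ ∈ inside A B) (h₂ : l₂ ∈ inside A B) (c d : ℂ) :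
    doubleIntegral A B (weight a) (weight a) (fun w v =>
        det₂ (fun w => G w l₁ 0) (fun w => G w l₂ 0) w v *
          (sinh (w - c) * sinh (v - d) / sinh (w - v - η))) =
      reducedSame η l₁ l₂ c d (weightedIntegral A B (weight a) fun w => G w l₁ 0)
        (weightedIntegral A B (weight a) fun w => G w l₂ 0)
        (weightedIntegral A B (weight a) fun w => G w l₁ 0 * coth (w - l₂ - η))
        (weightedIntegral A B (weight a) fun w => G w l₂ 0 * coth (w - l₁ - η))
        (psi η A B a G l₁ l₂ 0) (psiPrime η A B a G l₁ l₂ 0) := by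
  have hA := hC.A_pos
  have hB := hC.B_pos
  have hg₁ := hG.isDensitySolution h₁
  have hg₂ := hG.isDensitySolution h₂
  have hψ' : psiPrime η A B a G l₁ l₂ 0 = _ := (hG.hasDerivAt_psi hC hb h₁ h₂).deriv
  have split : ∀ {g : ℂ → ℂ} {m : ℂ}, ContinuousOn g (contour A B) → m ∈ inside A B →
      weightedIntegral A B (weight a) (fun w => g w * (coth (w - m) - coth (w - m - η))) =
        weightedIntegral A B (weight a) (fun w => g w * coth (w - m))
        - weightedIntegral A B (weight a) (fun w => g w * coth (w - m - η)) := by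
    intro g m hg hm
    simp only [mul_sub]
    exact weightedIntegral_sub hA hB hb (hg.fun_mul (hC.continuousOn_coth_inside hm))
      (hg.fun_mul (hC.continuousOn_coth_sub_inside hm))
  have hsymm := hg₁.symm hC hb hg₂ h₁ h₂
  have hψ : psi η A B a G l₁ l₂ 0 = -2 * weightedIntegral A B (weight a)
      (fun w => G w l₁ 0 * (coth (w - l₂) - coth (w - l₂ - η))) := by
    rw [psi_eq, show (-2 : ℂ) = 2 * -1 by norm_num, mul_assoc,
      ← weightedIntegral_const_mul _ (-1)]
    congr 2; funext w
    simp only [neg_zero, zero_mul, exp_zero, one_mul]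
    ring
  have key := hg₁.doubleIntegral_sinh hC hb hg₂ h₁ h₂ c d
  have e₁ := split hg₁.continuousOn h₂
  have e₂ := split hg₂.continuousOn h₁
  -- By the symmetry of `ψ`, the same quantity `s = -ψ / 2` occurs for both inhomogeneities.
  rw [hsymm] at e₁
  rw [hsymm] at hψ
  rw [hψ', reducedSame, mul_div_cancel_left₀ _ hC.ne_zero]
  generalize weightedIntegral A B (weight a) (fun w => G w l₂ 0 * (coth (w - l₁) - coth (w - l₁ - η)))
    = s at *
  generalize doubleIntegral A B (weight a) (weight a) (fun w v =>
        det₂ (fun w => G w l₁ 0) (fun w => G w l₂ 0) w v *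
          (sinh (w - c) * sinh (v - d) / sinh (w - v - η))) = X at *
  rw [hψ]
  linear_combination key / 4
    - 1 / 4 * (1 / sinh η) * (sinh (2 * l₂ - (c + d)) * e₁ - sinh (2 * l₁ - (c + d)) * e₂)

lemma twist_zero (s : Bool) : twist η 0 s = 1 := by cases s <;> simp [twist]

/-- The six nonvanishing two-point matrix elements. -/
lemma twoPoint_values (hC : Admissible η A B) (ha : ∀ w ∈ contour A B, a w ≠ 0 ∧ 1 + a w ≠ 0)
    (hb : ContinuousOn (weight a) (contour A B)) (hG : IsDensityFunction η A B a G)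
    (h₁ : l₁ ∈ inside A B) (h₂ : l₂ ∈ inside A B) (hne : l₁ ≠ l₂) :
    let φ₁ := phi A B a G l₁ 0
    let φ₂ := phi A B a G l₂ 0
    let ψ := psi η A B a G l₁ l₂ 0
    let ψ' := psiPrime η A B a G l₁ l₂ 0
    let Z := coth η / 4 * ψ + coth (l₁ - l₂) / (4 * η) * ψ'
    let W := cosh (l₁ - l₂) / sinh η / 4 * ψ + cosh η / (4 * η * sinh (l₁ - l₂)) * ψ'
    twoPoint η A B a G l₁ l₂ 0 0 0 0 0 = 1 / 2 - 1 / 4 * (φ₁ + φ₂) - Z ∧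
    twoPoint η A B a G l₁ l₂ 0 1 1 1 1 = 1 / 2 + 1 / 4 * (φ₁ + φ₂) - Z ∧
    twoPoint η A B a G l₁ l₂ 0 0 1 0 1 = Z - φ₁ / 4 + φ₂ / 4 ∧
    twoPoint η A B a G l₁ l₂ 0 1 0 1 0 = Z + φ₁ / 4 - φ₂ / 4 ∧
    twoPoint η A B a G l₁ l₂ 0 0 1 1 0 = W + sinh η * (φ₁ - φ₂) / (4 * sinh (l₁ - l₂)) ∧
    twoPoint η A B a G l₁ l₂ 0 1 0 0 1 = W - sinh η * (φ₁ - φ₂) / (4 * sinh (l₁ - l₂)) := by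
  intro φ₁ φ₂ ψ ψ' Z W
  have hA := hC.A_pos
  have hB := hC.B_pos
  have hg₁ := hG.isDensitySolution h₁
  have hg₂ := hG.isDensitySolution h₂
  have hl := sinh_sub_ne_zero hC.B_le (inside_subset_rect A B h₁) h₂ hne
  have hl' : sinh (l₂ - l₁) ≠ 0 := by rwa [← neg_sub, sinh_neg, neg_ne_zero]
  have same := doubleIntegral_eq_reducedSame hC hb hG h₁ h₂
  have mixed : ∀ c d : ℂ, _ := hg₁.doubleIntegral_sinh_cauchyWeight hC hb hg₂ h₁ h₂
  have hF : ∀ c d : ℂ, ContinuousOn₂ A B (fun w v =>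
      det₂ (fun w => G w l₁ 0) (fun w => G w l₂ 0) w v *
        (sinh (w - c) * sinh (v - d) / sinh (w - v - η))) := fun c d =>
    (continuousOn₂_det₂ hg₁.continuousOn hg₂.continuousOn).mul (hC.continuousOn₂_div_sinh c d)
  have hκ := continuousOn_cauchyWeight (A := A) (B := B)
  have ht : spinWeight a true = weight a := by funext w; simp [spinWeight]
  have hf : spinWeight a false = fun w => cauchyWeight w - weight a w := by
    funext w; simp [spinWeight]
  have hφ₁ : φ₁ = _ := phi_eq (A := A) (B := B) (a := a) (G := G) l₁ 0
  have hφ₂ : φ₂ = _ := phi_eq (A := A) (B := B) (a := a) (G := G) l₂ 0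
  have two : ∀ {u₁ u₂ d₁ d₂ x y : Fin 2} (s t : Bool), positions ![u₁, u₂] ![d₁, d₂] = [x, y] →
      decide (0 < numPlus ![d₁, d₂]) = s → decide (1 < numPlus ![d₁, d₂]) = t →
      twoPoint η A B a G l₁ l₂ 0 u₁ u₂ d₁ d₂ = 1 / sinh (l₂ - l₁) *
        doubleIntegral A B (spinWeight a s) (spinWeight a t) fun w v =>
          det₂ (fun w => G w l₁ 0) (fun w => G w l₂ 0) w v *
            (sinh (w - node η l₁ l₂ s x) * sinh (v - node η l₁ l₂ t y) / sinh (w - v - η)) := by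
    rintro u₁ u₂ d₁ d₂ x y s t hp rfl rfl
    rw [twoPoint, densityElement_two hA hB ha hp, twist_zero, twist_zero, one_mul]
  rw [hφ₁, hφ₂]
  refine ⟨?_, ?_, ?_, ?_, ?_, ?_⟩
  · rw [two true true (x := 1) (y := 0) (by decide) (by decide) (by decide), ht,
      show node η l₁ l₂ true 1 = l₁ + η by simp [node], show node η l₁ l₂ true 0 = l₂ by simp [node],
      same, reduced_plus_plus _ _ _ _ _ _ hC.ne_zero hC.sinh_ne hl, one_div_mul_eq_div,
      mul_div_cancel_left₀ _ hl']
    ring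
  · rw [two false false (x := 0) (y := 1) (by decide) (by decide) (by decide), hf,
      show node η l₁ l₂ false 0 = l₂ by simp [node],
      show node η l₁ l₂ false 1 = l₁ - η by simp [node],
      doubleIntegral_sub_left hA hB (hκ.fun_sub hb) hκ hb (hF _ _),
      doubleIntegral_sub_right hA hB hκ hκ hb (hF _ _),
      doubleIntegral_sub_right hA hB hb hκ hb (hF _ _), same, mixed,
      hg₁.doubleIntegral_cauchyWeight_left hC hb hg₂ h₁ h₂,
      hg₁.doubleIntegral_cauchyWeight hC hb hg₂ h₁ h₂]
    have e := reduced_minus_minus (weightedIntegral A B (weight a) fun w => G w l₁ 0)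
        (weightedIntegral A B (weight a) fun w => G w l₂ 0)
        (weightedIntegral A B (weight a) fun w => G w l₁ 0 * coth (w - l₂ - η))
        (weightedIntegral A B (weight a) fun w => G w l₂ 0 * coth (w - l₁ - η)) ψ ψ'
        hC.ne_zero hC.sinh_ne hl
    have h0 := hC.sinh_sub_ne l₁ (inside_subset_rect A B h₁) l₂ (inside_subset_rect A B h₂)
    -- One residue term simplifies since the node `l₁ - η` cancels its denominator; the other
    -- contains `sinh (l₂ - l₂)`.
    have e1 : sinh (l₁ - l₂) * sinh (l₂ - (l₁ - η)) / sinh (l₁ - l₂ - η) = -sinh (l₁ - l₂) := by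
      rw [show l₂ - (l₁ - η) = -(l₁ - l₂ - η) by ring, sinh_neg]; field_simp
    rw [e1, sub_self, sinh_zero, zero_mul, zero_div, sub_zero, one_div_mul_eq_div, div_eq_iff hl',
      mul_comm _ (sinh (l₂ - l₁))]
    exact e
  · rw [two true false (x := 0) (y := 1) (by decide) (by decide) (by decide), ht, hf,
      show node η l₁ l₂ true 0 = l₂ by simp [node],
      show node η l₁ l₂ false 1 = l₁ - η by simp [node],
      doubleIntegral_sub_right hA hB hb hκ hb (hF _ _), same, mixed, ← reducedMixed,
      reduced_plus_minus _ _ _ _ _ _ hC.ne_zero hC.sinh_ne hl, one_div_mul_eq_div,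
      mul_div_cancel_left₀ _ hl']
  · rw [two true false (x := 1) (y := 0) (by decide) (by decide) (by decide), ht, hf,
      show node η l₁ l₂ true 1 = l₁ + η by simp [node],
      show node η l₁ l₂ false 0 = l₂ by simp [node],
      doubleIntegral_sub_right hA hB hb hκ hb (hF _ _), same, mixed, ← reducedMixed,
      reduced_minus_plus _ _ _ _ _ _ hC.ne_zero hC.sinh_ne hl, one_div_mul_eq_div,
      mul_div_cancel_left₀ _ hl']
  · rw [two true false (x := 1) (y := 1) (by decide) (by decide) (by decide), ht, hf,
      show node η l₁ l₂ true 1 = l₁ + η by simp [node],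
      show node η l₁ l₂ false 1 = l₁ - η by simp [node],
      doubleIntegral_sub_right hA hB hb hκ hb (hF _ _), same, mixed, ← reducedMixed,
      reduced_exchange_left _ _ _ _ _ _ hC.ne_zero hC.sinh_ne hl, one_div_mul_eq_div,
      mul_div_cancel_left₀ _ hl']
  · rw [two true false (x := 0) (y := 0) (by decide) (by decide) (by decide), ht, hf,
      show node η l₁ l₂ true 0 = l₂ by simp [node],
      show node η l₁ l₂ false 0 = l₂ by simp [node],
      doubleIntegral_sub_right hA hB hb hκ hb (hF _ _), same, mixed, ← reducedMixed,
      reduced_exchange_right _ _ _ _ _ _ hC.ne_zero hC.sinh_ne hl, one_div_mul_eq_div,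
      mul_div_cancel_left₀ _ hl']

end TwoPointValues

/-! ### The operators of the exponential formula -/

section Operators

local notation "Mat₄" => Matrix (Fin 2 × Fin 2) (Fin 2 × Fin 2) ℂ

/-- The matrix of total spin zero with prescribed entries: the diagonal, followed by the two
exchange entries. -/
def spinZeroMatrix (a b c d o o' : ℂ) : Mat₄ :=
  a • (unit 0 0 ⊗ₖ unit 0 0) + b • (unit 0 0 ⊗ₖ unit 1 1) + c • (unit 1 1 ⊗ₖ unit 0 0)
    + d • (unit 1 1 ⊗ₖ unit 1 1) + o • (unit 0 1 ⊗ₖ unit 1 0) + o' • (unit 1 0 ⊗ₖ unit 0 1)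

lemma operatorOf_apply (img : (d₁ u₁ d₂ u₂ : Fin 2) → Mat₄) (O : Mat₄) :
    operatorOf img O = ∑ p : Fin 2 × Fin 2, ∑ r : Fin 2 × Fin 2,
      O p r • img p.1 r.1 p.2 r.2 := by
  conv_lhs => rw [Matrix.matrix_eq_sum_single O]
  simp only [map_sum]
  refine Finset.sum_congr rfl fun p _ => Finset.sum_congr rfl fun r _ => ?_
  have h : Matrix.single p r (O p r) =
      O p r • Matrix.stdBasis ℂ (Fin 2 × Fin 2) (Fin 2 × Fin 2) (p, r) := by
    rw [Matrix.stdBasis_eq_single, Matrix.smul_single, smul_eq_mul, mul_one]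
  rw [h, map_smul, operatorOf, Module.Basis.constr_basis]

/-- The value `off 0` goes with the entry in row `(0, 1)` and column `(1, 0)`, as `unit 0 1 ⊗ₖ unit
1 0` has its entry there. -/
lemma spinZeroOperator_apply (diag : Fin 2 → Fin 2 → Mat₄) (off : Fin 2 → Mat₄) (O : Mat₄) :
    spinZeroOperator diag off O =
      O (0, 0) (0, 0) • diag 0 0 + O (0, 1) (0, 1) • diag 0 1 + O (1, 0) (1, 0) • diag 1 0
        + O (1, 1) (1, 1) • diag 1 1 + O (0, 1) (1, 0) • off 0 + O (1, 0) (0, 1) • off 1 := by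
  rw [spinZeroOperator, operatorOf_apply]
  simp [Fintype.sum_prod_type]
  abel

lemma one_eq_unit : (1 : Matrix (Fin 2) (Fin 2) ℂ) = unit 0 0 + unit 1 1 := by
  ext i j; fin_cases i <;> fin_cases j <;> simp [unit]

lemma spinZeroMatrix_entries (a b c d o o' : ℂ) :
    spinZeroMatrix a b c d o o' (0, 0) (0, 0) = a ∧ spinZeroMatrix a b c d o o' (0, 1) (0, 1) = b ∧
    spinZeroMatrix a b c d o o' (1, 0) (1, 0) = c ∧ spinZeroMatrix a b c d o o' (1, 1) (1, 1) = d ∧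
    spinZeroMatrix a b c d o o' (0, 1) (1, 0) = o ∧
    spinZeroMatrix a b c d o o' (1, 0) (0, 1) = o' := by
  simp [spinZeroMatrix, unit, Matrix.kroneckerMap_apply]

lemma spinZeroMatrix_one : (1 : Mat₄) = spinZeroMatrix 1 1 1 1 0 0 := by
  rw [← Matrix.one_kronecker_one, one_eq_unit]
  simp only [Matrix.add_kronecker, Matrix.kronecker_add, spinZeroMatrix]
  module

lemma trace_spinZeroMatrix (a b c d o o' : ℂ) :
    Matrix.trace (spinZeroMatrix a b c d o o') = a + b + c + d := by
  simp [spinZeroMatrix, Matrix.trace_kronecker, unit]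

lemma trace_spinZeroMatrix_mul (a b c d o o' : ℂ) (O : Mat₄) :
    Matrix.trace (spinZeroMatrix a b c d o o' * O) =
      a * O (0, 0) (0, 0) + b * O (0, 1) (0, 1) + c * O (1, 0) (1, 0) + d * O (1, 1) (1, 1)
        + o * O (1, 0) (0, 1) + o' * O (0, 1) (1, 0) := by
  simp [spinZeroMatrix, Matrix.trace, Matrix.mul_apply, Fintype.sum_prod_type, unit,
    Matrix.kroneckerMap_apply, Matrix.single_apply]
  ring

lemma opH1_apply (q x₁ x₂ : ℂ) (O : Mat₄) :
    opH1 q x₁ x₂ O = (1 / 2 : ℂ) • spinZeroMatrix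
      (f1 x₁ x₂ 0 * (O (0, 0) (0, 0) - O (1, 0) (1, 0))
        + f1 x₁ x₂ 1 * (O (0, 1) (0, 1) - O (1, 1) (1, 1))
        + q⁻¹ * f3 x₁ x₂ 0 * O (0, 1) (1, 0) + q * f3 x₁ x₂ 0 * O (1, 0) (0, 1))
      (f2 q x₁ x₂ 0 * (O (0, 0) (0, 0) - O (1, 0) (1, 0))
        + f2 q x₁ x₂ 1 * (O (0, 1) (0, 1) - O (1, 1) (1, 1))
        + q⁻¹ * g2 q x₁ x₂ 0 * O (0, 1) (1, 0) + q * g2 q x₁ x₂ 1 * O (1, 0) (0, 1))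
      (f2 q x₁ x₂ 1 * (O (0, 0) (0, 0) - O (1, 0) (1, 0))
        + f2 q x₁ x₂ 0 * (O (0, 1) (0, 1) - O (1, 1) (1, 1))
        - q * g2 q x₁ x₂ 1 * O (0, 1) (1, 0) - q⁻¹ * g2 q x₁ x₂ 0 * O (1, 0) (0, 1))
      (f1 x₁ x₂ 1 * (O (0, 0) (0, 0) - O (1, 0) (1, 0))
        + f1 x₁ x₂ 0 * (O (0, 1) (0, 1) - O (1, 1) (1, 1))
        + q * f3 x₁ x₂ 1 * O (0, 1) (1, 0) + q⁻¹ * f3 x₁ x₂ 1 * O (1, 0) (0, 1))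
      (g3 q x₁ x₂ * (O (0, 1) (1, 0) + O (1, 0) (0, 1))
        - g1 q x₁ x₂ * (O (0, 0) (0, 0) - O (0, 1) (0, 1) - O (1, 0) (1, 0) + O (1, 1) (1, 1)))
      (-(g3 q x₁ x₂ * (O (0, 1) (1, 0) + O (1, 0) (0, 1))
        - g1 q x₁ x₂ * (O (0, 0) (0, 0) - O (0, 1) (0, 1) - O (1, 0) (1, 0) + O (1, 1) (1, 1)))) := by
  rw [opH1, spinZeroOperator_apply]
  simp only [spinZeroMatrix, exchangeOdd, sgn, zero_add, add_zero, if_true,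
    one_ne_zero, if_false, show (1 + 1 : Fin 2) = 0 from rfl]
  module

lemma opH2_apply (q x₁ x₂ : ℂ) (O : Mat₄) :
    opH2 q x₁ x₂ O = (1 / 2 : ℂ) • spinZeroMatrix
      (f1 x₁ x₂ 1 * (O (0, 0) (0, 0) - O (0, 1) (0, 1))
        + f1 x₁ x₂ 0 * (O (1, 0) (1, 0) - O (1, 1) (1, 1))
        - q⁻¹ * f3 x₁ x₂ 0 * O (0, 1) (1, 0) + q * f3 x₁ x₂ 1 * O (1, 0) (0, 1))
      (f1 x₁ x₂ 1 * (O (0, 0) (0, 0) - O (0, 1) (0, 1))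
        + f1 x₁ x₂ 0 * (O (1, 0) (1, 0) - O (1, 1) (1, 1))
        - q⁻¹ * f3 x₁ x₂ 0 * O (0, 1) (1, 0) + q * f3 x₁ x₂ 1 * O (1, 0) (0, 1))
      (f1 x₁ x₂ 0 * (O (0, 0) (0, 0) - O (0, 1) (0, 1))
        + f1 x₁ x₂ 1 * (O (1, 0) (1, 0) - O (1, 1) (1, 1))
        - q * f3 x₁ x₂ 1 * O (0, 1) (1, 0) + q⁻¹ * f3 x₁ x₂ 0 * O (1, 0) (0, 1))
      (f1 x₁ x₂ 0 * (O (0, 0) (0, 0) - O (0, 1) (0, 1))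
        + f1 x₁ x₂ 1 * (O (1, 0) (1, 0) - O (1, 1) (1, 1))
        - q * f3 x₁ x₂ 1 * O (0, 1) (1, 0) + q⁻¹ * f3 x₁ x₂ 0 * O (1, 0) (0, 1)) 0 0 := by
  rw [opH2, spinZeroOperator_apply]
  simp only [spinZeroMatrix, sgn, zero_add, if_true, one_eq_unit, Matrix.kronecker_add,
    one_ne_zero, if_false, show (1 + 1 : Fin 2) = 0 from rfl]
  module

/-- The functions entering the operators, with common denominators, for `x = ξ₁ / ξ₂`. -/
lemma coefficients_eq {q x₁ x₂ x r s t : ℂ} (hq : q ≠ 0) (h₁ : x₁ ≠ 0) (h₂ : x₂ ≠ 0) (hx : x = x₁ / x₂)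
    (hr : r = q ^ 2 * x ^ 2 - 1) (hs : s = q ^ 2 - x ^ 2) (ht : t = x ^ 2 - 1)
    (hr0 : r ≠ 0) (hs0 : s ≠ 0) (ht0 : t ≠ 0) :
    f1 x₁ x₂ 0 = -1 / t ∧ f1 x₁ x₂ 1 = x ^ 2 / t ∧
    f2 q x₁ x₂ 0 = -((q ^ 2 - 1) ^ 2 + q ^ 2 * t ^ 2) * x ^ 2 /
      (t * r * s) ∧
    f2 q x₁ x₂ 1 = ((q ^ 2 - 1) ^ 2 * x ^ 4 + q ^ 2 * t ^ 2) /
      (t * r * s) ∧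
    f3 x₁ x₂ 0 = x / t ∧ f3 x₁ x₂ 1 = -x / t ∧
    g1 q x₁ x₂ = (x ^ 2 + 1) * (q ^ 2 - 1) * q * x / (r * s) ∧
    g2 q x₁ x₂ 0 = x * ((q ^ 2 - 1) ^ 2 * x ^ 2 + q ^ 4 * t ^ 2) /
      (t * r * s) ∧
    g2 q x₁ x₂ 1 = x * ((q ^ 2 - 1) ^ 2 * x ^ 2 + t ^ 2) /
      (t * r * s) ∧
    g3 q x₁ x₂ = (q ^ 4 - 1) * x ^ 2 / (r * s) := by
  subst hr hs ht
  have hx0 : x ≠ 0 := by rw [hx]; exact div_ne_zero h₁ h₂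
  have hinv : x₂ / x₁ = x⁻¹ := by rw [hx, inv_div]
  have hsq : x₁ ^ 2 / x₂ ^ 2 = x ^ 2 := by rw [hx, div_pow]
  have hsq' : x₂ ^ 2 / x₁ ^ 2 = (x ^ 2)⁻¹ := by rw [hx, div_pow, inv_div]
  have hden : den q x₁ x₂ = (q ^ 2 * x ^ 2 - 1) * (q ^ 2 - x ^ 2) / (q ^ 2 * x ^ 2) := by
    rw [den, hinv, ← hx]; field_simp
  have hden' : den q x₂ x₁ = (q ^ 2 * x ^ 2 - 1) * (q ^ 2 - x ^ 2) / (q ^ 2 * x ^ 2) := by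
    rw [den, hinv, ← hx]; field_simp
  have e1 : 1 - x ^ 2 = -(x ^ 2 - 1) := by ring
  have e2 : 1 - (x ^ 2)⁻¹ = (x ^ 2 - 1) / x ^ 2 := by field_simp
  have e3 : x - x⁻¹ = (x ^ 2 - 1) / x := by field_simp
  have e4 : x⁻¹ - x = -(x ^ 2 - 1) / x := by field_simp; ring
  have e5 : q - q⁻¹ = (q ^ 2 - 1) / q := by field_simp
  simp only [f1, f2, f3, g1, g2, g3, hden, hden', hsq, hsq', hinv, ← hx, if_true, one_ne_zero,
    if_false, e1, e2, e3, e4, e5]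
  refine ⟨?_, ?_, ?_, ?_, ?_, ?_, ?_, ?_, ?_, ?_⟩ <;> field_simp

/-- The linear functional whose product with the identity is `-ω Ω₁⁺ - ω' Ω₁⁻`. -/
def omegaFunctional (κ ν : ℂ) (O : Mat₄) : ℂ :=
  κ * (O (0, 0) (0, 0) - O (0, 1) (0, 1) - O (1, 0) (1, 0) + O (1, 1) (1, 1))
    + ν * (O (0, 1) (1, 0) + O (1, 0) (0, 1))

lemma spinZeroMatrix_eq_zero {a b c d o o' : ℂ} (h₁ : a = 0) (h₂ : b = 0) (h₃ : c = 0)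
    (h₄ : d = 0) (h₅ : o = 0) (h₆ : o' = 0) : spinZeroMatrix a b c d o o' = 0 := by
  simp [spinZeroMatrix, h₁, h₂, h₃, h₄, h₅, h₆]

lemma spinZeroMatrix_add (a b c d o o' a' b' c' d' p p' : ℂ) :
    spinZeroMatrix a b c d o o' + spinZeroMatrix a' b' c' d' p p' =
      spinZeroMatrix (a + a') (b + b') (c + c') (d + d') (o + p) (o' + p') := by
  simp only [spinZeroMatrix]
  module

lemma omegaFunctional_opH2 (q x₁ x₂ κ ν : ℂ) (O : Mat₄) :
    omegaFunctional κ ν (opH2 q x₁ x₂ O) = 0 := by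
  simp only [opH2_apply, omegaFunctional, Matrix.smul_apply, spinZeroMatrix_entries, smul_eq_mul]
  ring

/-- The image of `H₂` consists of matrices `D ⊗ I` with `D` diagonal, whereas `H₂` sees only
exchange entries and differences over the second spin. -/
lemma opH2_opH2 (q x₁ x₂ : ℂ) (O : Mat₄) : opH2 q x₁ x₂ (opH2 q x₁ x₂ O) = 0 := by
  rw [opH2_apply q x₁ x₂ O, map_smul, opH2_apply]
  simp only [spinZeroMatrix_entries]
  rw [spinZeroMatrix_eq_zero, smul_zero, smul_zero] <;> ring

section Relations

variable {q x₁ x₂ x r s t : ℂ} (hq : q ≠ 0) (h₁ : x₁ ≠ 0) (h₂ : x₂ ≠ 0) (hx : x = x₁ / x₂)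
    (hr : r = q ^ 2 * x ^ 2 - 1) (hs : s = q ^ 2 - x ^ 2) (ht : t = x ^ 2 - 1)
    (hr0 : r ≠ 0) (hs0 : s ≠ 0) (ht0 : t ≠ 0)
include hq h₁ h₂ hx hr hs ht hr0 hs0 ht0

/-- The two exchange entries of `H₁ O` are opposite, so `ν` drops out; the alternating sum of its
diagonal vanishes by the explicit coefficients. -/
lemma omegaFunctional_opH1 (κ ν : ℂ) (O : Mat₄) :
    omegaFunctional κ ν (opH1 q x₁ x₂ O) = 0 := by
  obtain ⟨e1, e2, e3, e4, e5, e6, e7, e8, e9, e10⟩ := coefficients_eq hq h₁ h₂ hx hr hs ht hr0 hs0 ht0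
  simp only [opH1_apply, omegaFunctional, Matrix.smul_apply, spinZeroMatrix_entries,
    e1, e2, e3, e4, e5, e6, e7, e8, e9, e10, smul_eq_mul]
  field_simp
  -- `r`, `s`, `t` stay atoms while denominators are cleared and are expanded only for the final
  -- polynomial identity.
  rw [hr, hs, ht]
  ring

lemma opH1_opH1 (O : Mat₄) : opH1 q x₁ x₂ (opH1 q x₁ x₂ O) = 0 := by
  obtain ⟨e1, e2, e3, e4, e5, e6, e7, e8, e9, e10⟩ := coefficients_eq hq h₁ h₂ hx hr hs ht hr0 hs0 ht0
  rw [opH1_apply q x₁ x₂ O, map_smul, opH1_apply]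
  simp only [spinZeroMatrix_entries, e1, e2, e3, e4, e5, e6, e7, e8, e9, e10]
  generalize O (0, 0) (0, 0) = a
  generalize O (0, 1) (0, 1) = b
  generalize O (1, 0) (1, 0) = c
  generalize O (1, 1) (1, 1) = d
  generalize O (0, 1) (1, 0) = o
  generalize O (1, 0) (0, 1) = o'
  rw [spinZeroMatrix_eq_zero, smul_zero, smul_zero]
  all_goals field_simp
  all_goals rw [hr, hs, ht]
  all_goals ring

lemma opH1_opH2_add (O : Mat₄) :
    opH1 q x₁ x₂ (opH2 q x₁ x₂ O) + opH2 q x₁ x₂ (opH1 q x₁ x₂ O) = 0 := by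
  obtain ⟨e1, e2, e3, e4, e5, e6, e7, e8, e9, e10⟩ := coefficients_eq hq h₁ h₂ hx hr hs ht hr0 hs0 ht0
  rw [opH1_apply q x₁ x₂ O, opH2_apply q x₁ x₂ O, map_smul, map_smul, opH1_apply, opH2_apply]
  simp only [spinZeroMatrix_entries, e1, e2, e3, e4, e5, e6, e7, e8, e9, e10]
  generalize O (0, 0) (0, 0) = a
  generalize O (0, 1) (0, 1) = b
  generalize O (1, 0) (1, 0) = c
  generalize O (1, 1) (1, 1) = d
  generalize O (0, 1) (1, 0) = o
  generalize O (1, 0) (0, 1) = o'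
  rw [← smul_add, ← smul_add, spinZeroMatrix_add, spinZeroMatrix_eq_zero, smul_zero, smul_zero]
  all_goals field_simp
  all_goals rw [hr, hs, ht]
  all_goals ring

/-- For `q = exp η` and `x = exp (l₁ - l₂)` the coefficient of the exchange entries is `sinh η /
sinh (l₁ - l₂)`, as in `Dodd`. -/
lemma trace_opH1 (O : Mat₄) : Matrix.trace (opH1 q x₁ x₂ O) =
    O (0, 0) (0, 0) + O (0, 1) (0, 1) - O (1, 0) (1, 0) - O (1, 1) (1, 1)
      + x * (q ^ 2 - 1) / (q * t) * (O (1, 0) (0, 1) - O (0, 1) (1, 0)) := by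
  obtain ⟨e1, e2, e3, e4, e5, e6, e7, e8, e9, e10⟩ := coefficients_eq hq h₁ h₂ hx hr hs ht hr0 hs0 ht0
  simp only [opH1_apply, Matrix.trace_smul, trace_spinZeroMatrix,
    e1, e2, e3, e4, e5, e6, e7, e8, e9, e10, smul_eq_mul]
  field_simp
  rw [hr, hs, ht]
  ring

lemma trace_opH2 (O : Mat₄) : Matrix.trace (opH2 q x₁ x₂ O) =
    O (0, 0) (0, 0) - O (0, 1) (0, 1) + O (1, 0) (1, 0) - O (1, 1) (1, 1)
      - x * (q ^ 2 - 1) / (q * t) * (O (1, 0) (0, 1) - O (0, 1) (1, 0)) := by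
  obtain ⟨e1, e2, -, -, e5, e6, -⟩ := coefficients_eq hq h₁ h₂ hx hr hs ht hr0 hs0 ht0
  simp only [opH2_apply, Matrix.trace_smul, trace_spinZeroMatrix,
    e1, e2, e5, e6, smul_eq_mul]
  field_simp
  rw [ht]
  ring

end Relations

end Operators

/-! ### Nilpotency of `Ω`, and the density matrix in terms of matrix units. -/

section Exponential

local notation "Mat₄" => Matrix (Fin 2 × Fin 2) (Fin 2 × Fin 2) ℂ

variable {η : ℂ} {A B : ℝ} {l₁ l₂ : ℂ} {a : ℂ → ℂ} {G : ℂ → ℂ → ℂ → ℂ}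

lemma opOmega_apply (η : ℂ) (A B : ℝ) (a : ℂ → ℂ) (G : ℂ → ℂ → ℂ → ℂ) (l₁ l₂ : ℂ) (O : Mat₄) :
    opOmega η A B a G l₁ l₂ O =
      omegaFunctional
          ((coth η * omega η A B a G l₁ l₂ 0
            + coth (l₁ - l₂) / η * omegaPrime η A B a G l₁ l₂ 0) / 4)
          (-(cosh (l₁ - l₂) / sinh η * omega η A B a G l₁ l₂ 0
            + cosh η / (η * sinh (l₁ - l₂)) * omegaPrime η A B a G l₁ l₂ 0) / 4) O • (1 : Mat₄)
        - phi A B a G l₁ 0 • opH1 (exp η) (exp l₁) (exp l₂) O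
        - phi A B a G l₂ 0 • opH2 (exp η) (exp l₁) (exp l₂) O := by
  simp only [opOmega, LinearMap.add_apply, LinearMap.sub_apply, LinearMap.smul_apply, opOmegaPlus,
    opOmegaMinus, spinZeroOperator_apply, omegaFunctional, sgn, if_true, one_ne_zero, if_false,
    div_eq_mul_inv, mul_inv]
  module

/-- Nonvanishing of the denominators of the operators `H₁` and `H₂`. -/
lemma Admissible.denominators_ne_zero (hC : Admissible η A B) (h₁ : l₁ ∈ inside A B)
    (h₂ : l₂ ∈ inside A B) (hne : l₁ ≠ l₂) :
    exp η ^ 2 * (exp l₁ / exp l₂) ^ 2 - 1 ≠ 0 ∧ exp η ^ 2 - (exp l₁ / exp l₂) ^ 2 ≠ 0 ∧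
      (exp l₁ / exp l₂) ^ 2 - 1 ≠ 0 := by
  have hl := sinh_sub_ne_zero hC.B_le (inside_subset_rect A B h₁) h₂ hne
  have hp := hC.sinh_add_ne l₁ (inside_subset_rect A B h₁) l₂ (inside_subset_rect A B h₂)
  have hm := hC.sinh_sub_ne l₁ (inside_subset_rect A B h₁) l₂ (inside_subset_rect A B h₂)
  rw [sinh_eq_of_exp, div_ne_zero_iff] at hl hp
  rw [sinh_sub_eq_of_exp, div_ne_zero_iff] at hm
  rw [exp_add, exp_sub, mul_pow, mul_comm] at hp
  rw [exp_sub] at hl hm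
  exact ⟨hp.1, fun h => hm.1 (by linear_combination -h), hl.1⟩

/-- The part of `Ω` with `ω`, `ω'` has values in multiples of the identity, which all of `Ω`
annihilates, and it kills the images of `H₁` and `H₂`. The rest squares to zero by `H₁² = H₂² = 0`
and `H₁ H₂ + H₂ H₁ = 0`. -/
lemma opOmega_opOmega (hC : Admissible η A B) (h₁ : l₁ ∈ inside A B)
    (h₂ : l₂ ∈ inside A B) (hne : l₁ ≠ l₂) (O : Mat₄) :
    opOmega η A B a G l₁ l₂ (opOmega η A B a G l₁ l₂ O) = 0 := by
  obtain ⟨hr, hs, ht⟩ := hC.denominators_ne_zero h₁ h₂ hne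
  have hq := exp_ne_zero η
  have hx₁ := exp_ne_zero l₁
  have hx₂ := exp_ne_zero l₂
  set κ := (coth η * omega η A B a G l₁ l₂ 0
            + coth (l₁ - l₂) / η * omegaPrime η A B a G l₁ l₂ 0) / 4 with hκ
  set ν := -(cosh (l₁ - l₂) / sinh η * omega η A B a G l₁ l₂ 0
            + cosh η / (η * sinh (l₁ - l₂)) * omegaPrime η A B a G l₁ l₂ 0) / 4 with hν
  have k1 := omegaFunctional_opH1 hq hx₁ hx₂ rfl rfl rfl rfl hr hs ht κ ν O
  have k2 := omegaFunctional_opH2 (exp η) (exp l₁) (exp l₂) κ ν O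
  have k3 := opH1_opH1 hq hx₁ hx₂ rfl rfl rfl rfl hr hs ht O
  have k4 := opH2_opH2 (exp η) (exp l₁) (exp l₂) O
  have k5 := opH1_opH2_add hq hx₁ hx₂ rfl rfl rfl rfl hr hs ht O
  have k6 : omegaFunctional κ ν 1 = 0 := by
    rw [spinZeroMatrix_one]
    simp only [omegaFunctional, spinZeroMatrix_entries]
    ring
  have k7 : opH1 (exp η) (exp l₁) (exp l₂) 1 = 0 := by
    rw [opH1_apply, spinZeroMatrix_one]
    simp only [spinZeroMatrix_entries]
    rw [spinZeroMatrix_eq_zero, smul_zero] <;> ring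
  have k8 : opH2 (exp η) (exp l₁) (exp l₂) 1 = 0 := by
    rw [opH2_apply, spinZeroMatrix_one]
    simp only [spinZeroMatrix_entries]
    rw [spinZeroMatrix_eq_zero, smul_zero] <;> ring
  have lin : ∀ (x y z : ℂ) (M N P : Mat₄), omegaFunctional κ ν (x • M - y • N - z • P) =
      x * omegaFunctional κ ν M - y * omegaFunctional κ ν N - z * omegaFunctional κ ν P := by
    intro x y z M N P
    simp only [omegaFunctional, Matrix.sub_apply, Matrix.smul_apply, smul_eq_mul]
    ring
  rw [opOmega_apply η A B a G l₁ l₂ O, ← hκ, ← hν, opOmega_apply, ← hκ, ← hν, lin, k6, k1, k2]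
  simp only [map_sub, map_smul, k3, k4, k7, k8]
  have k5' := eq_neg_of_add_eq_zero_left k5
  rw [k5']
  module

/-- The exponential of a linear operator with square zero. -/
lemma hasSum_exp_of_sq_zero (Ω : Module.End ℂ Mat₄) (O : Mat₄) (h : Ω (Ω O) = 0) :
    HasSum (fun k : ℕ => ((k ! : ℂ))⁻¹ * (1 / 4 * Matrix.trace ((Ω ^ k) O)))
      (1 / 4 * (Matrix.trace O + Matrix.trace (Ω O))) := by
  have h2 : ∀ k : ℕ, (Ω ^ (k + 2)) O = 0 := by
    intro k
    rw [pow_add, Module.End.mul_apply, pow_two, Module.End.mul_apply, h, map_zero]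
  have h3 : HasSum (fun k : ℕ => ((k ! : ℂ))⁻¹ * (1 / 4 * Matrix.trace ((Ω ^ k) O)))
      (∑ k ∈ Finset.range 2, ((k ! : ℂ))⁻¹ * (1 / 4 * Matrix.trace ((Ω ^ k) O))) :=
    hasSum_sum_of_ne_finset_zero fun k hk => by
      obtain ⟨m, rfl⟩ : ∃ m, k = m + 2 := ⟨k - 2, by simp at hk; omega⟩
      simp [h2]
  convert h3 using 1
  simp [Finset.sum_range_succ]
  ring

/-! ### The density matrix for two sites -/

lemma twoPoint_eq_zero {u₁ u₂ d₁ d₂ : Fin 2} (α : ℂ)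
    (h : (positions ![u₁, u₂] ![d₁, d₂]).length ≠ 2) :
    twoPoint η A B a G l₁ l₂ α u₁ u₂ d₁ d₂ = 0 := by
  rw [twoPoint, densityElement, dif_neg h]

/-- The ten elements violating spin conservation vanish because their list of positions has the
wrong length. -/
lemma densityMatrix₂_eq (α : ℂ) : densityMatrix₂ η A B a G l₁ l₂ α = spinZeroMatrix
    (twoPoint η A B a G l₁ l₂ α 0 0 0 0) (twoPoint η A B a G l₁ l₂ α 0 1 0 1)
    (twoPoint η A B a G l₁ l₂ α 1 0 1 0) (twoPoint η A B a G l₁ l₂ α 1 1 1 1)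
    (twoPoint η A B a G l₁ l₂ α 1 0 0 1) (twoPoint η A B a G l₁ l₂ α 0 1 1 0) := by
  simp only [densityMatrix₂, Fin.sum_univ_two, spinZeroMatrix]
  rw [twoPoint_eq_zero (u₁ := 0) (u₂ := 0) (d₁ := 0) (d₂ := 1) α (by decide),
    twoPoint_eq_zero (u₁ := 0) (u₂ := 0) (d₁ := 1) (d₂ := 0) α (by decide),
    twoPoint_eq_zero (u₁ := 0) (u₂ := 0) (d₁ := 1) (d₂ := 1) α (by decide),
    twoPoint_eq_zero (u₁ := 0) (u₂ := 1) (d₁ := 0) (d₂ := 0) α (by decide),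
    twoPoint_eq_zero (u₁ := 0) (u₂ := 1) (d₁ := 1) (d₂ := 1) α (by decide),
    twoPoint_eq_zero (u₁ := 1) (u₂ := 0) (d₁ := 0) (d₂ := 0) α (by decide),
    twoPoint_eq_zero (u₁ := 1) (u₂ := 0) (d₁ := 1) (d₂ := 1) α (by decide),
    twoPoint_eq_zero (u₁ := 1) (u₂ := 1) (d₁ := 0) (d₂ := 0) α (by decide),
    twoPoint_eq_zero (u₁ := 1) (u₂ := 1) (d₁ := 0) (d₂ := 1) α (by decide),
    twoPoint_eq_zero (u₁ := 1) (u₂ := 1) (d₁ := 1) (d₂ := 0) α (by decide)]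
  module

lemma sigmaZ_eq_unit : sigmaZ = unit 0 0 + (-1 : ℂ) • unit 1 1 := by
  ext i j; fin_cases i <;> fin_cases j <;> simp [unit, sigmaZ]

lemma sigmaPlus_eq_unit : sigmaPlus = unit 0 1 := by
  ext i j; fin_cases i <;> fin_cases j <;> simp [unit, sigmaPlus]

lemma sigmaMinus_eq_unit : sigmaMinus = unit 1 0 := by
  ext i j; fin_cases i <;> fin_cases j <;> simp [unit, sigmaMinus]

/-- The factorized form of the density matrix in terms of matrix units. -/
lemma Deven_add_Dodd_eq (η : ℂ) (A B : ℝ) (a : ℂ → ℂ) (G : ℂ → ℂ → ℂ → ℂ) (l₁ l₂ : ℂ) :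
    Deven η A B a G l₁ l₂ + Dodd η A B a G l₁ l₂ =
      spinZeroMatrix
        (1 / 4 + 1 / 4 * (coth η * omega η A B a G l₁ l₂ 0
            + coth (l₁ - l₂) / η * omegaPrime η A B a G l₁ l₂ 0)
          - phi A B a G l₁ 0 / 4 - phi A B a G l₂ 0 / 4)
        (1 / 4 - 1 / 4 * (coth η * omega η A B a G l₁ l₂ 0
            + coth (l₁ - l₂) / η * omegaPrime η A B a G l₁ l₂ 0)
          - phi A B a G l₁ 0 / 4 + phi A B a G l₂ 0 / 4)
        (1 / 4 - 1 / 4 * (coth η * omega η A B a G l₁ l₂ 0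
            + coth (l₁ - l₂) / η * omegaPrime η A B a G l₁ l₂ 0)
          + phi A B a G l₁ 0 / 4 - phi A B a G l₂ 0 / 4)
        (1 / 4 + 1 / 4 * (coth η * omega η A B a G l₁ l₂ 0
            + coth (l₁ - l₂) / η * omegaPrime η A B a G l₁ l₂ 0)
          + phi A B a G l₁ 0 / 4 + phi A B a G l₂ 0 / 4)
        (-(1 / 4 * (cosh (l₁ - l₂) / sinh η * omega η A B a G l₁ l₂ 0
            + cosh η / (η * sinh (l₁ - l₂)) * omegaPrime η A B a G l₁ l₂ 0))
          - sinh η * (phi A B a G l₁ 0 - phi A B a G l₂ 0) / (4 * sinh (l₁ - l₂)))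
        (-(1 / 4 * (cosh (l₁ - l₂) / sinh η * omega η A B a G l₁ l₂ 0
            + cosh η / (η * sinh (l₁ - l₂)) * omegaPrime η A B a G l₁ l₂ 0))
          + sinh η * (phi A B a G l₁ 0 - phi A B a G l₂ 0) / (4 * sinh (l₁ - l₂))) := by
  simp only [Deven, Dodd, spinZeroMatrix, sigmaZ_eq_unit, sigmaPlus_eq_unit, sigmaMinus_eq_unit,
    one_eq_unit, Matrix.add_kronecker, Matrix.kronecker_add, Matrix.smul_kronecker,
    Matrix.kronecker_smul]
  module

/-- Half of this is the part of the `σᶻ ⊗ σᶻ` coefficient free of `ψ`; the resulting `1` turns the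
constant `1/4` of the diagonal into `1/2` or `0`. -/
lemma coth_identity {l : ℂ} (hη : sinh η ≠ 0) (hl : sinh l ≠ 0) (hp : sinh (l + η) ≠ 0)
    (hm : sinh (l - η) ≠ 0) :
    coth l * (coth (l - η) + coth (l + η)) - coth η * (coth (l - η) - coth (l + η)) = 2 := by
  rw [sinh_eq_of_exp] at hη hl hp
  rw [sinh_sub_eq_of_exp] at hm
  have h1 := (div_ne_zero_iff.1 hη).1
  have h2 := (div_ne_zero_iff.1 hl).1
  have h3 := (div_ne_zero_iff.1 hp).1
  have h4 := (div_ne_zero_iff.1 hm).1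
  simp only [coth]
  rw [sinh_sub_eq_of_exp l η, sinh_eq_of_exp l, sinh_eq_of_exp η, sinh_eq_of_exp (l + η)]
  simp only [cosh, exp_neg, exp_sub, exp_add, mul_pow] at *
  have hx := exp_ne_zero l
  have hq := exp_ne_zero η
  generalize exp l = x at *
  generalize exp η = q at *
  field_simp
  ring

/-- In the exchange coefficient, the explicit terms of `ω` and `ω'` cancel. -/
lemma cosh_identity {l : ℂ} (hη : sinh η ≠ 0) (hl : sinh l ≠ 0) (hp : sinh (l + η) ≠ 0)
    (hm : sinh (l - η) ≠ 0) :
    cosh η / sinh l * (coth (l - η) + coth (l + η)) =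
      cosh l / sinh η * (coth (l - η) - coth (l + η)) := by
  rw [sinh_eq_of_exp] at hη hl hp
  rw [sinh_sub_eq_of_exp] at hm
  have h1 := (div_ne_zero_iff.1 hη).1
  have h2 := (div_ne_zero_iff.1 hl).1
  have h3 := (div_ne_zero_iff.1 hp).1
  have h4 := (div_ne_zero_iff.1 hm).1
  simp only [coth]
  rw [sinh_sub_eq_of_exp l η, sinh_eq_of_exp l, sinh_eq_of_exp η, sinh_eq_of_exp (l + η)]
  simp only [cosh, exp_neg, exp_sub, exp_add, mul_pow] at *
  have hx := exp_ne_zero l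
  have hq := exp_ne_zero η
  generalize exp l = x at *
  generalize exp η = q at *
  have h5 : q ^ 2 * x ^ 2 - 1 ≠ 0 := by rwa [mul_comm]
  field_simp
  ring

end Exponential

/-! ### The factorized form and the exponential formula -/

section Factorization

variable {η : ℂ} {A B : ℝ} {l₁ l₂ : ℂ} {a : ℂ → ℂ} {G : ℂ → ℂ → ℂ → ℂ}

lemma omega_zero : omega η A B a G l₁ l₂ 0 =
    -psi η A B a G l₁ l₂ 0 - 1 / 2 * (coth (l₁ - l₂ - η) - coth (l₁ - l₂ + η)) := by
  simp [omega, kernel]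

lemma omegaPrime_zero (hC : Admissible η A B) (hb : ContinuousOn (weight a) (contour A B))
    (hG : IsDensityFunction η A B a G) (h₁ : l₁ ∈ inside A B) (h₂ : l₂ ∈ inside A B) :
    omegaPrime η A B a G l₁ l₂ 0 = -psiPrime η A B a G l₁ l₂ 0
      + η / 2 * (coth (l₁ - l₂ - η) + coth (l₁ - l₂ + η)) :=
  (hasDerivAt_exp_mul_omega
    (hG.hasDerivAt_psi hC hb h₁ h₂).differentiableAt.hasDerivAt).deriv

/-- The coefficient of `σᶻ ⊗ σᶻ`, in terms of `ψ` and its derivative. -/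
lemma coth_mul_omega_add (hC : Admissible η A B) (hb : ContinuousOn (weight a) (contour A B))
    (hG : IsDensityFunction η A B a G) (h₁ : l₁ ∈ inside A B) (h₂ : l₂ ∈ inside A B)
    (hne : l₁ ≠ l₂) :
    coth η * omega η A B a G l₁ l₂ 0 + coth (l₁ - l₂) / η * omegaPrime η A B a G l₁ l₂ 0 =
      1 - coth η * psi η A B a G l₁ l₂ 0
        - coth (l₁ - l₂) / η * psiPrime η A B a G l₁ l₂ 0 := by
  have hη := hC.ne_zero
  have key := coth_identity hC.sinh_ne
    (sinh_sub_ne_zero hC.B_le (inside_subset_rect A B h₁) h₂ hne)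
    (hC.sinh_add_ne l₁ (inside_subset_rect A B h₁) l₂ (inside_subset_rect A B h₂))
    (hC.sinh_sub_ne l₁ (inside_subset_rect A B h₁) l₂ (inside_subset_rect A B h₂))
  rw [omega_zero, omegaPrime_zero hC hb hG h₁ h₂]
  field_simp
  linear_combination η * key

/-- The coefficient of `σ⁺ ⊗ σ⁻ + σ⁻ ⊗ σ⁺`, in terms of `ψ` and its derivative. -/
lemma cosh_mul_omega_add (hC : Admissible η A B) (hb : ContinuousOn (weight a) (contour A B))
    (hG : IsDensityFunction η A B a G) (h₁ : l₁ ∈ inside A B) (h₂ : l₂ ∈ inside A B)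
    (hne : l₁ ≠ l₂) :
    cosh (l₁ - l₂) / sinh η * omega η A B a G l₁ l₂ 0
        + cosh η / (η * sinh (l₁ - l₂)) * omegaPrime η A B a G l₁ l₂ 0 =
      -(cosh (l₁ - l₂) / sinh η * psi η A B a G l₁ l₂ 0
        + cosh η / (η * sinh (l₁ - l₂)) * psiPrime η A B a G l₁ l₂ 0) := by
  have hη := hC.ne_zero
  have hs := hC.sinh_ne
  have hl := sinh_sub_ne_zero hC.B_le (inside_subset_rect A B h₁) h₂ hne
  have key := cosh_identity hs hl
    (hC.sinh_add_ne l₁ (inside_subset_rect A B h₁) l₂ (inside_subset_rect A B h₂))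
    (hC.sinh_sub_ne l₁ (inside_subset_rect A B h₁) l₂ (inside_subset_rect A B h₂))
  rw [omega_zero, omegaPrime_zero hC hb hG h₁ h₂]
  field_simp at key ⊢
  linear_combination η * key

/-- The factorized form of the density matrix for two sites. -/
lemma densityMatrix₂_zero (hC : Admissible η A B) (ha : ∀ w ∈ contour A B, a w ≠ 0 ∧ 1 + a w ≠ 0)
    (hb : ContinuousOn (weight a) (contour A B)) (hG : IsDensityFunction η A B a G)
    (h₁ : l₁ ∈ inside A B) (h₂ : l₂ ∈ inside A B) (hne : l₁ ≠ l₂) :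
    densityMatrix₂ η A B a G l₁ l₂ 0 = Deven η A B a G l₁ l₂ + Dodd η A B a G l₁ l₂ := by
  have hη := hC.ne_zero
  have hs := hC.sinh_ne
  have hl := sinh_sub_ne_zero hC.B_le (inside_subset_rect A B h₁) h₂ hne
  obtain ⟨e1, e2, e3, e4, e5, e6⟩ := twoPoint_values hC ha hb hG h₁ h₂ hne
  rw [densityMatrix₂_eq, Deven_add_Dodd_eq, coth_mul_omega_add hC hb hG h₁ h₂ hne,
    cosh_mul_omega_add hC hb hG h₁ h₂ hne, e1, e2, e3, e4, e5, e6]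
  congr 1 <;> field_simp <;> ring

lemma continuousAt_densityMatrix₂ (hC : Admissible η A B)
    (ha : ∀ w ∈ contour A B, a w ≠ 0 ∧ 1 + a w ≠ 0)
    (hb : ContinuousOn (weight a) (contour A B)) (hG : IsDensityFunction η A B a G)
    (h₁ : l₁ ∈ inside A B) (h₂ : l₂ ∈ inside A B) :
    ContinuousAt (fun α => densityMatrix₂ η A B a G l₁ l₂ α) 0 := by
  simp only [densityMatrix₂]
  refine tendsto_finsetSum _ fun u₁ _ => tendsto_finsetSum _ fun u₂ _ =>
    tendsto_finsetSum _ fun d₁ _ => tendsto_finsetSum _ fun d₂ _ => ?_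
  exact (continuousAt_densityElement hC ha hb hG h₁ h₂ _ _).smul continuousAt_const

/-- The quantum group invariant combination. -/
lemma Dq_eq (hC : Admissible η A B) (ha : ∀ w ∈ contour A B, a w ≠ 0 ∧ 1 + a w ≠ 0)
    (hb : ContinuousOn (weight a) (contour A B)) (hG : IsDensityFunction η A B a G)
    (h₁ : l₁ ∈ inside A B) (h₂ : l₂ ∈ inside A B) (hne : l₁ ≠ l₂) :
    Dq η A B a G l₁ l₂ =
      sinh (l₁ - l₂ + η) * sinh (l₁ - l₂ - η) / (2 * sinh η) * psi η A B a G l₁ l₂ 0 := by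
  have hη := hC.ne_zero
  have hs := hC.sinh_ne
  have hl := sinh_sub_ne_zero hC.B_le (inside_subset_rect A B h₁) h₂ hne
  obtain ⟨-, -, e3, e4, e5, e6⟩ := twoPoint_values hC ha hb hG h₁ h₂ hne
  rw [Dq, e3, e4, e5, e6, ← neg_sub l₁ l₂]
  generalize l₁ - l₂ = l at *
  rw [sinh_eq_of_exp] at hs hl
  have hs' := (div_ne_zero_iff.1 hs).1
  have hl' := (div_ne_zero_iff.1 hl).1
  simp only [coth]
  rw [sinh_sub_eq_of_exp l η, sinh_eq_of_exp l, sinh_eq_of_exp η, sinh_eq_of_exp (l + η)]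
  simp only [cosh, exp_neg, exp_add]
  have hx := exp_ne_zero l
  have hq := exp_ne_zero η
  generalize exp l = x at *
  generalize exp η = q at *
  field_simp
  ring

/-- The exponential formula for two sites. -/
lemma hasSum_exp_opOmega (hC : Admissible η A B) (h₁ : l₁ ∈ inside A B) (h₂ : l₂ ∈ inside A B)
    (hne : l₁ ≠ l₂) (O : Matrix (Fin 2 × Fin 2) (Fin 2 × Fin 2) ℂ) :
    HasSum (fun k : ℕ => ((k ! : ℂ))⁻¹ *
        (1 / 4 * Matrix.trace (((opOmega η A B a G l₁ l₂) ^ k) O)))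
      (Matrix.trace ((Deven η A B a G l₁ l₂ + Dodd η A B a G l₁ l₂) * O)) := by
  obtain ⟨hr, hs, ht⟩ := hC.denominators_ne_zero h₁ h₂ hne
  have hq := exp_ne_zero η
  have hx₁ := exp_ne_zero l₁
  have hx₂ := exp_ne_zero l₂
  have hratio : exp l₁ / exp l₂ * (exp η ^ 2 - 1) / (exp η * ((exp l₁ / exp l₂) ^ 2 - 1)) =
      sinh η / sinh (l₁ - l₂) := by
    rw [← exp_sub] at ht ⊢
    have := exp_ne_zero (l₁ - l₂)
    rw [sinh_eq_of_exp η, sinh_eq_of_exp (l₁ - l₂)]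
    field_simp
  have htr : Matrix.trace O = O (0, 0) (0, 0) + O (0, 1) (0, 1) + O (1, 0) (1, 0)
      + O (1, 1) (1, 1) := by
    simp [Matrix.trace, Fintype.sum_prod_type, add_assoc]
  -- Only the traces of `O` and `Ω O` remain; as the identity has trace `4`, the factor `1/4`
  -- returns the functional of `ω`, `ω'` itself.
  convert hasSum_exp_of_sq_zero _ O (opOmega_opOmega (a := a) (G := G) hC h₁ h₂ hne O) using 1
  rw [opOmega_apply, Deven_add_Dodd_eq, trace_spinZeroMatrix_mul, Matrix.trace_sub,
    Matrix.trace_sub, Matrix.trace_smul, Matrix.trace_smul, Matrix.trace_smul,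
    trace_opH1 hq hx₁ hx₂ rfl rfl rfl rfl hr hs ht, trace_opH2 hq hx₁ hx₂ rfl rfl rfl rfl hr hs ht,
    hratio, htr, Matrix.trace_one]
  simp only [omegaFunctional, smul_eq_mul, Fintype.card_prod, Fintype.card_fin]
  push_cast
  rw [← div_div _ (4 : ℂ)]
  ring

end Factorization

end

end XXZ

open XXZ in
theorem mainTheorem1 (J T h : ℝ) (hJ : 0 < J) (hT : 0 < T) (η : ℂ) (A B : ℝ)
    (hC : XXZ.IsCanonicalContour η A B)
    (a : ℂ → ℂ) (ha : XXZ.IsAuxiliaryFunction J T h η A B a)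
    (G : ℂ → ℂ → ℂ → ℂ) (hG : XXZ.IsDensityFunction η A B a G) :
    -- the one-point function
    (∀ μ ∈ XXZ.inside A B,
      2 * XXZ.onePoint η A B a G μ = 1 - XXZ.phi A B a G μ 0) ∧
    ∀ l₁ ∈ XXZ.inside A B, ∀ l₂ ∈ XXZ.inside A B, l₁ ≠ l₂ →
      -- the derivatives with respect to `α` exist
      DifferentiableAt ℂ (fun α => XXZ.psi η A B a G l₁ l₂ α) 0 ∧
      DifferentiableAt ℂ (fun α => exp (α * (l₂ - l₁)) * XXZ.omega η A B a G l₁ l₂ α) 0 ∧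
      -- the quantum group invariant combination
      XXZ.Dq η A B a G l₁ l₂ =
        sinh (l₁ - l₂ + η) * sinh (l₁ - l₂ - η) / (2 * sinh η) * XXZ.psi η A B a G l₁ l₂ 0 ∧
      -- the emptiness formation probability
      XXZ.twoPoint η A B a G l₁ l₂ 0 0 0 0 0 =
        1 / 2 - 1 / 4 * (XXZ.phi A B a G l₁ 0 + XXZ.phi A B a G l₂ 0)
          - XXZ.coth η / 4 * XXZ.psi η A B a G l₁ l₂ 0
          - XXZ.coth (l₁ - l₂) / (4 * η) * XXZ.psiPrime η A B a G l₁ l₂ 0 ∧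
      -- the factorized form of the density matrix
      XXZ.densityMatrix₂ η A B a G l₁ l₂ 0 =
        XXZ.Deven η A B a G l₁ l₂ + XXZ.Dodd η A B a G l₁ l₂ ∧
      Tendsto (fun α => XXZ.densityMatrix₂ η A B a G l₁ l₂ α) (𝓝[≠] 0)
        (𝓝 (XXZ.Deven η A B a G l₁ l₂ + XXZ.Dodd η A B a G l₁ l₂)) ∧
      -- the exponential formula: `tr (D O) = 1/4 tr (exp(Ω)(O))`
      ∀ O : Matrix (Fin 2 × Fin 2) (Fin 2 × Fin 2) ℂ, XXZ.IsSpinZero O →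
        HasSum (fun k : ℕ => ((k ! : ℂ))⁻¹ *
            (1 / 4 * Matrix.trace (((XXZ.opOmega η A B a G l₁ l₂) ^ k) O)))
          (Matrix.trace (XXZ.densityMatrix₂ η A B a G l₁ l₂ 0 * O)) := by

  have hA := hC.admissible
  have ha' := ha.ne_zero
  have hb := ha.continuousOn_weight
  refine ⟨fun μ _ => two_mul_onePoint μ, fun l₁ h₁ l₂ h₂ hne => ?_⟩
  have hψ := hG.hasDerivAt_psi hA hb h₁ h₂
  have hD := densityMatrix₂_zero hA ha' hb hG h₁ h₂ hne
  refine ⟨hψ.differentiableAt, (hasDerivAt_exp_mul_omega hψ).differentiableAt,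
    Dq_eq hA ha' hb hG h₁ h₂ hne, ?_, hD, ?_, fun O _ => ?_⟩
  · rw [(twoPoint_values hA ha' hb hG h₁ h₂ hne).1]
    ring
  · rw [← hD]
    exact (continuousAt_densityMatrix₂ hA ha' hb hG h₁ h₂).tendsto.mono_left nhdsWithin_le_nhds
  · rw [hD]
    exact hasSum_exp_opOmega hA h₁ h₂ hne O
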